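/- Let $N\ge 3$, $\alpha\in(0,2)$, $\beta>0$, $b\in\mathbb R$, $c<0$ and $2\le p<\infty$. All function spaces are complex. Let $$A_{b,c}u=(1+|x|^\alpha)\Delta u+b|x|^{\alpha-2}x\cdot\nabla u-c|x|^{\alpha-2}u-|x|^\beta u ,\qquad u\in\mathcal D_0:=C_c^\infty(\mathbb R^N\setminus\{0\}).$$ Let $\lambda>0$ be such that, for all $x\in\mathbb R^N\setminus\{0\}$, $$\frac{1}{2|x|^2}\Big(\frac{N-2}{2}\Big)^2+\Big(\frac{cp}{2}-1-\frac{\alpha-b}{2}(\alpha-2+N)\Big)|x|^{\alpha-2}+\lambda>0 .$$ On $D(\mathfrak a)=\{u\in H^1(\mathbb R^N): (1+|x|^\alpha)^{1/2}\nabla u,\ |x|^{(\alpha-2)/2}u,\ |x|^{\beta/2}u\in L^2(\mathbb R^N)\}$ consider the form $$\mathfrak a(u,v)=\int_{\mathbb R^N}\Big((1+|x|^\alpha)\nabla u\cdot\nabla\overline v+(\alpha-b)|x|^{\alpha-2}x\cdot\nabla u\,\overline v+|x|^\beta u\overline v+\lambda u\overline v\Big)\,dx ,$$ and let $\widetilde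 A_{b,0}$ be the operator on $L^2(\mathbb R^N)$ such that $-\widetilde A_{b,0}$ is associated with $\mathfrak a$: $u\in D(\widetilde A_{b,0})$ and $\widetilde A_{b,0}u=w$ if and only if $u\in D(\mathfrak a)$, $w\in L^2(\mathbb R^N)$ and $\mathfrak a(u,h)=-\int_{\mathbb R^N} w\overline h\,dx$ for all $h\in D(\mathfrak a)$. For $n\in\mathbb N$ let $W_n=\max\{-n,c|x|^{\alpha-2}\}$. Then $\widetilde A_{b,0}$ generates a contractive $C_0$-semigroup on $L^2(\mathbb R^N)$, and there is a contractive $C_0$-semigroup on $L^p(\mathbb R^N)$ that agrees with it on $L^2\cap L^p$; its generator is again denoted by $\widetilde A_{b,0}$. For every $n$ the operator $\widetilde A_{b,0}-W_n$, with the domain of $\widetilde A_{b,0}$ in $L^p(\mathbb R^N)$, generates a $C_0$-semigroup on $L^p(\mathbb R^N)$. These semigroups are contractive and satisfy, in the sense of positive operators, $$0\le e^{t(\widetilde A_{b,0}-W_n)}\le e^{t(\widetilde A_{b,0}-W_{n+1})}\qquad(t\ge0,\ n\in\mathbb N).$$ As $n\to\infty$ they converge strongly on $L^p(\mathbb R^N)$,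 for every $t\ge 0$, to a contractive $C_0$-semigroup on $L^p(\mathbb R^N)$, and the generator of this semigroup is an extension of $(A_{b,c}-\lambda,\mathcal D_0)$. -/

import Mathlib

open MeasureTheory Filter Topology
open scoped ENNReal NNReal ContDiff ComplexOrder ComplexConjugate

noncomputable section

/-- A `C₀`-semigroup of bounded linear operators on a complex normed space. -/
structure C0Semigroup (X : Type*) [NormedAddCommGroup X] [NormedSpace ℂ X] where
  op : ℝ≥0 → X →L[ℂ] X
  op_zero : op 0 = ContinuousLinearMap.id ℂ X
  op_add : ∀ s t, op (s + t) = (op s).comp (op t)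
  tendsto_zero : ∀ f, Tendsto (fun t => op t f) (𝓝[>] 0) (𝓝 f)

/-- `T.Gen f g`: `f` lies in the domain of the generator of `T`, and the generator maps `f`
to `g`. -/
def C0Semigroup.Gen {X : Type*} [NormedAddCommGroup X] [NormedSpace ℂ X]
    (T : C0Semigroup X) (f g : X) : Prop :=
  Tendsto (fun t : ℝ≥0 => ((t : ℝ)⁻¹ : ℝ) • (T.op t f - f)) (𝓝[>] 0) (𝓝 g)

/-- All operators of the semigroup are contractions. -/
def C0Semigroup.IsContractive {X : Type*} [NormedAddCommGroup X] [NormedSpace ℂ X]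
    (T : C0Semigroup X) : Prop :=
  ∀ t, ‖T.op t‖ ≤ 1

/-- The complex space `L^p(ℝ^N)` with respect to Lebesgue measure. -/
abbrev LpRN (N : ℕ) (p : ℝ≥0∞) : Type :=
  Lp ℂ p (volume : Measure (EuclideanSpace ℝ (Fin N)))

/-- `G = (G₁, …, G_N)` is the weak gradient of `u` on `ℝ^N`. -/
def IsWeakGradient {N : ℕ} (u : LpRN N 2) (G : Fin N → LpRN N 2) : Prop :=
  ∀ (i : Fin N) (φ : EuclideanSpace ℝ (Fin N) → ℝ), ContDiff ℝ ∞ φ → HasCompactSupport φ →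
    ∫ x, (fderiv ℝ φ x (EuclideanSpace.single i 1)) • u x = - ∫ x, φ x • G i x

/-- `u` belongs to the form domain `D(𝔞)` and `G` is its weak gradient: `u ∈ H¹(ℝ^N)`, and
`(1+|x|^α)^{1/2} ∇u`, `(|x|^{α-2})^{1/2} u` and `(|x|^β)^{1/2} u` are in `L²(ℝ^N)`. -/
structure InFormDomain {N : ℕ} (α β : ℝ) (u : LpRN N 2) (G : Fin N → LpRN N 2) : Prop where
  weakGradient : IsWeakGradient u G
  gradient_memLp : ∀ i, MemLp (fun x => √(1 + ‖x‖ ^ α) • G i x) 2 volume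
  singular_memLp : MemLp (fun x => √(‖x‖ ^ (α - 2)) • u x) 2 volume
  growth_memLp : MemLp (fun x => √(‖x‖ ^ β) • u x) 2 volume

/-- The form `𝔞(u, v)`, where `G = ∇u` and `H = ∇v`. -/
def sesqForm {N : ℕ} (α β b c lam : ℝ) (u : LpRN N 2) (G : Fin N → LpRN N 2)
    (v : LpRN N 2) (H : Fin N → LpRN N 2) : ℂ :=
  ∫ x : EuclideanSpace ℝ (Fin N),
    (((1 + ‖x‖ ^ α : ℝ) : ℂ) * ∑ i, G i x * conj (H i x)
      + (((α - b) * ‖x‖ ^ (α - 2) : ℝ) : ℂ) * (∑ i, (x i : ℂ) * G i x) * conj (v x)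
      + ((c * ‖x‖ ^ (α - 2) : ℝ) : ℂ) * u x * conj (v x)
      + ((‖x‖ ^ β : ℝ) : ℂ) * u x * conj (v x)
      + (lam : ℂ) * u x * conj (v x))

/-- The operator `Ã` on `L²(ℝ^N)` for which `-Ã` is associated with `𝔞`:
`FormOperator α β b c lam u w` says that `u ∈ D(Ã)` and `Ã u = w`, that is `u ∈ D(𝔞)` and
`𝔞(u, h) = ⟨-w, h⟩` for all `h ∈ D(𝔞)`. -/
def FormOperator {N : ℕ} (α β b c lam : ℝ) (u w : LpRN N 2) : Prop :=
  ∃ G, InFormDomain α β u G ∧ ∀ h H, InFormDomain α β h H →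
    sesqForm α β b c lam u G h H = ∫ x, (- w x) * conj (h x)

/-- `S` on `L^p` and `T` on `L²` agree on `L² ∩ L^p`. -/
def IsConsistent {N : ℕ} {p : ℝ≥0∞} [Fact (1 ≤ p)]
    (T : C0Semigroup (LpRN N 2)) (S : C0Semigroup (LpRN N p)) : Prop :=
  ∀ (t : ℝ≥0) (f : LpRN N 2) (g : LpRN N p), f =ᵐ[volume] g → T.op t f =ᵐ[volume] S.op t g

/-- The truncated potential `W_n = max {-n, c|x|^{α-2}}`. -/
def truncPot {N : ℕ} (α c : ℝ) (n : ℕ) (x : EuclideanSpace ℝ (Fin N)) : ℝ :=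
  max (-(n : ℝ)) (c * ‖x‖ ^ (α - 2))

/-- `𝒟₀ = C_c^∞(ℝ^N ∖ {0})`, complex valued. -/
def IsTestAwayFromZero {N : ℕ} (u : EuclideanSpace ℝ (Fin N) → ℂ) : Prop :=
  ContDiff ℝ ∞ u ∧ HasCompactSupport u ∧ 0 ∉ tsupport u

/-- The differential expression
`A_{b,c} u = (1+|x|^α) Δu + b|x|^{α-2} x·∇u - c|x|^{α-2} u - |x|^β u`. -/
def diffOp {N : ℕ} (α β b c : ℝ) (u : EuclideanSpace ℝ (Fin N) → ℂ)
    (x : EuclideanSpace ℝ (Fin N)) : ℂ :=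
  ((1 + ‖x‖ ^ α : ℝ) : ℂ) * Laplacian.laplacian u x
    + ((b * ‖x‖ ^ (α - 2) : ℝ) : ℂ) * fderiv ℝ u x x
    - ((c * ‖x‖ ^ (α - 2) : ℝ) : ℂ) * u x
    - ((‖x‖ ^ β : ℝ) : ℂ) * u x

end

/-! ### Contractive semigroups, orbit estimates and strong limits -/

namespace C0Semigroup

variable {X : Type*} [NormedAddCommGroup X] [NormedSpace ℂ X]

/-! Everything is built from resolvents. For each `n` the truncated potential `W_n` is bounded and
satisfies `c|x|^{α-2} ≤ W_n ≤ 0`. On the form domain, Hardy's inequality (`IsWeakGradient.hardy`)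
spends half of `∫|∇u|²` on `((N-2)/2)²/(2|x|²)`. The field `|x|^{α-2}x` has divergence
`(α-2+N)|x|^{α-2}`, so integration by parts turns the drift into the zero-order term
`-(α-b)/2·(α-2+N)|x|^{α-2}` (`InFormDomain.integral_drift`). The hypothesis on `λ` says exactly that
what remains is nonnegative, with `∫|x|^{α-2}|u|²` to spare: this is `InFormDomain.core_inequality`.
Since `cp/2 ≤ c`, it makes the form plus `W_n` coercive, and Lax–Milgram (`exists_formOperator`)
yields resolvents `R_n(μ)` on `L²` of norm at most `1/μ` for all `μ > 0`.

The exponent `p` enters by testing the resolvent equation with `W·W'`, where `W` is a truncation of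
`(Re u)₊^{p/2}`. Then `W' ∇Re u = ∇W`, so the principal part and the drift become those of the
quadratic form at `W`, while the potential is multiplied by at most `p/2`; this is where `cp/2`
comes from (`FormOperator.integral_test_le`). The outcome is positivity of `R_n(μ)` and the sharp
bound `‖R_n(μ)f‖_p ≤ ‖f‖_p/μ` (`IsFormResolvent.re_nonneg`, `IsFormResolvent.eLpNorm_le`). Hence
`R_n(μ)` extends consistently to `L^p` (`exists_consistent_extension`), and resolvent identities
transfer by density of `L² ∩ L^p`.

`hille_yosida` gives the `L²` semigroup from `R_0`, and from the extended resolvents a contractive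
semigroup on `L^p` for every `n`. As `W_0 = 0`, the case `n = 0` is the extrapolated semigroup
itself, and the second resolvent identity shows that the other generators differ from it by `-W_n`
on the same domain (`IsFormResolvent.extension_iff`). Since `W_{n+1} ≤ W_n`, the identity `R' - R =
R'(V - V')R` shows that the resolvents increase with `n`; positivity and order pass to the
semigroups through the Yosida approximation.

An increasing sequence of positive contractions on `L^p`, `p < ∞`, converges strongly, because
`‖·‖^p` is superadditive on nonnegative functions. A test function supported away from `0` sees the
full potential once `n` is large, so on `𝒟₀` the generators are eventually equal to `A_{b,c} - λ`.
Density of `𝒟₀` and `C0Semigroup.exists_limit` then give strong continuity of the limit and the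
description of its generator on `𝒟₀`. -/

lemma IsContractive.norm_op_le {T : C0Semigroup X} (hT : T.IsContractive) (t : ℝ≥0) (f : X) :
    ‖T.op t f‖ ≤ ‖f‖ := by
  simpa using (T.op t).le_of_opNorm_le (hT t) f

lemma op_add_apply (T : C0Semigroup X) (s t : ℝ≥0) (f : X) :
    T.op (s + t) f = T.op s (T.op t f) := by
  rw [T.op_add]; rfl

lemma tendsto_nhds_zero (T : C0Semigroup X) (f : X) :
    Tendsto (fun t => T.op t f) (𝓝 0) (𝓝 f) := by
  have h : (𝓝 (0 : ℝ≥0)) = 𝓝[>] 0 ⊔ pure 0 := by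
    rw [← nhdsWithin_singleton, ← nhdsWithin_union, ← nhdsWithin_univ]
    congr 1
    ext x
    rcases eq_or_ne x 0 with h | h <;> simp [h]
  rw [h]
  refine (T.tendsto_zero f).sup ?_
  have : T.op 0 f = f := by simp [T.op_zero]
  simpa [this] using tendsto_pure_nhds (fun t => T.op t f) 0

lemma IsContractive.norm_op_sub_op_le {T : C0Semigroup X} (hT : T.IsContractive) {s t : ℝ≥0}
    (hst : s ≤ t) (f : X) : ‖T.op t f - T.op s f‖ ≤ ‖T.op (t - s) f - f‖ := by
  have : T.op t f - T.op s f = T.op s (T.op (t - s) f - f) := by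
    rw [map_sub, ← op_add_apply, add_tsub_cancel_of_le hst]
  rw [this]
  exact hT.norm_op_le _ _

lemma IsContractive.continuous_op {T : C0Semigroup X} (hT : T.IsContractive) (f : X) :
    Continuous fun t => T.op t f := by
  rw [continuous_iff_continuousAt]
  intro s
  rw [ContinuousAt, tendsto_iff_norm_sub_tendsto_zero]
  have h0 : Tendsto (fun t => ‖T.op t f - f‖) (𝓝 0) (𝓝 0) :=
    tendsto_iff_norm_sub_tendsto_zero.1 (T.tendsto_nhds_zero f)
  have h1 : Tendsto (fun t : ℝ≥0 => t - s) (𝓝 s) (𝓝 0) := by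
    have : Continuous fun t : ℝ≥0 => t - s := by fun_prop
    simpa using this.tendsto s
  have h2 : Tendsto (fun t : ℝ≥0 => s - t) (𝓝 s) (𝓝 0) := by
    have : Continuous fun t : ℝ≥0 => s - t := by fun_prop
    simpa using this.tendsto s
  have h3 := (h0.comp h1).add (h0.comp h2)
  rw [add_zero] at h3
  refine squeeze_zero (fun _ => norm_nonneg _) (fun t => ?_) h3
  rcases le_total s t with h | h
  · exact (hT.norm_op_sub_op_le h f).trans (le_add_of_nonneg_right (norm_nonneg _))
  · rw [norm_sub_rev]
    exact (hT.norm_op_sub_op_le h f).trans (le_add_of_nonneg_left (norm_nonneg _))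

/-- The generator limit is one-sided, and applying `T(x)` to it gives the right derivative of the
orbit at every `x ≥ 0`. A right derivative is all that the mean value inequality needs. -/
lemma Gen.hasDerivWithinAt {T : C0Semigroup X} {f g : X} (h : T.Gen f g) {x : ℝ} (hx : 0 ≤ x) :
    HasDerivWithinAt (fun t : ℝ => T.op t.toNNReal f) (T.op x.toNNReal g) (Set.Ici x) x := by
  rw [← hasDerivWithinAt_Ioi_iff_Ici, hasDerivWithinAt_iff_tendsto_slope' (by simp)]
  have h1 : Tendsto (fun y : ℝ => (y - x).toNNReal) (𝓝[>] x) (𝓝[>] 0) := by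
    refine tendsto_nhdsWithin_iff.2 ⟨?_, ?_⟩
    · have : Continuous fun y : ℝ => (y - x).toNNReal := by fun_prop
      simpa using (this.tendsto x).mono_left nhdsWithin_le_nhds
    · filter_upwards [self_mem_nhdsWithin] with y hy
      simpa using hy
  have h2 := ((T.op x.toNNReal).continuous.tendsto g).comp (h.comp h1)
  refine h2.congr' ?_
  filter_upwards [self_mem_nhdsWithin] with y hy
  have hy' : 0 ≤ y - x := by simpa using le_of_lt hy
  simp only [Function.comp_apply, slope_def_module, Real.coe_toNNReal _ hy']
  rw [ContinuousLinearMap.map_smul_of_tower, map_sub, ← op_add_apply,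
    ← Real.toNNReal_add hx hy', add_sub_cancel]

/-- Mean value inequality for `s ↦ T(s)f - s k`, whose right derivative is `T(s)g - k`. -/
lemma IsContractive.norm_sub_sub_smul_le {T : C0Semigroup X} (hT : T.IsContractive) {f g k : X}
    (h : T.Gen f g) {C : ℝ} {t : ℝ≥0} (hC : ∀ s ≤ t, ‖T.op s g - k‖ ≤ C) :
    ‖T.op t f - f - (t : ℝ) • k‖ ≤ C * t := by
  have hd : ∀ x ∈ Set.Ico (0 : ℝ) t, HasDerivWithinAt
      (fun s : ℝ => T.op s.toNNReal f - s • k) (T.op x.toNNReal g - k) (Set.Ici x) x := by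
    intro x hx
    have := ((hasDerivAt_id x).smul_const k).hasDerivWithinAt (s := Set.Ici x)
    exact (h.hasDerivWithinAt hx.1).sub (by simpa using this)
  have hcont : Continuous fun s : ℝ => T.op s.toNNReal f - s • k :=
    ((hT.continuous_op f).comp continuous_real_toNNReal).sub (by fun_prop)
  have := norm_image_sub_le_of_norm_deriv_right_le_segment hcont.continuousOn hd
    (fun x hx => hC _ (by simpa using Real.toNNReal_le_toNNReal hx.2.le)) t ⟨t.2, le_rfl⟩
  simpa [T.op_zero, sub_right_comm] using this

lemma IsContractive.norm_op_sub_le {T : C0Semigroup X} (hT : T.IsContractive) {f g : X}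
    (h : T.Gen f g) (t : ℝ≥0) : ‖T.op t f - f‖ ≤ ‖g‖ * t := by
  simpa using hT.norm_sub_sub_smul_le (k := 0) h (t := t) (C := ‖g‖)
    (fun s _ => by simpa using hT.norm_op_le s g)

/-- Replacing `g` by an element `y` of the domain makes `T(s)g - k` small with explicit constants.
Only norms of fixed vectors occur on the right, so the estimate is uniform in the semigroup and
survives a strong limit. -/
lemma IsContractive.norm_sub_sub_smul_le_of_gen {T : C0Semigroup X} (hT : T.IsContractive)
    {f g y z k : X} (h : T.Gen f g) (h' : T.Gen y z) (t : ℝ≥0) :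
    ‖T.op t f - f - (t : ℝ) • k‖ ≤ (‖z‖ * t + ‖g - y‖ + ‖y - k‖) * t := by
  refine hT.norm_sub_sub_smul_le h fun s hs => ?_
  have h1 : T.op s g - k = T.op s (g - y) + (T.op s y - y) + (y - k) := by
    rw [map_sub]; abel
  have hs' : (s : ℝ) ≤ t := hs
  have h2 : ‖T.op s (g - y)‖ ≤ ‖g - y‖ := hT.norm_op_le s (g - y)
  have h3 : ‖T.op s y - y‖ ≤ ‖z‖ * t :=
    (hT.norm_op_sub_le h' s).trans (mul_le_mul_of_nonneg_left hs' (norm_nonneg _))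
  rw [h1]
  refine (norm_add_le _ _).trans ?_
  have := norm_add_le (T.op s (g - y)) (T.op s y - y)
  linarith

lemma Gen.unique {T : C0Semigroup X} {f g g' : X} (h : T.Gen f g) (h' : T.Gen f g') : g = g' := by
  have : (𝓝[>] (0 : ℝ≥0)).NeBot := inferInstance
  exact tendsto_nhds_unique h h'

/-- A strong limit of contractive semigroups whose generators converge on a dense set is a
contractive semigroup whose generator extends the limit. -/
theorem exists_limit (T : ℕ → C0Semigroup X) (hT : ∀ n, (T n).IsContractive)
    (L : ℝ≥0 → X → X) (hL : ∀ t f, Tendsto (fun n => (T n).op t f) atTop (𝓝 (L t f)))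
    (D : Set (X × X)) (hD : Dense (Prod.fst '' D))
    (hgen : ∀ a ∈ D, ∃ g : ℕ → X, Tendsto g atTop (𝓝 a.2) ∧
      ∀ᶠ n in atTop, (T n).Gen a.1 (g n)) :
    ∃ S : C0Semigroup X, S.IsContractive ∧ (∀ t f, S.op t f = L t f) ∧
      ∀ a ∈ D, S.Gen a.1 a.2 := by
  have hnorm : ∀ t f, ‖L t f‖ ≤ ‖f‖ := fun t f =>
    le_of_tendsto (hL t f).norm (Eventually.of_forall fun n => (hT n).norm_op_le t f)
  have hadd : ∀ t f g, L t (f + g) = L t f + L t g := fun t f g =>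
    tendsto_nhds_unique (hL t (f + g)) (by simpa using (hL t f).add (hL t g))
  have hsmul : ∀ t (c : ℂ) f, L t (c • f) = c • L t f := fun t c f =>
    tendsto_nhds_unique (hL t (c • f)) (by simpa using (hL t f).const_smul c)
  let O : ℝ≥0 → X →L[ℂ] X := fun t =>
    LinearMap.mkContinuous ⟨⟨L t, hadd t⟩, hsmul t⟩ 1 (fun f => by simpa using hnorm t f)
  have hO : ∀ t f, O t f = L t f := fun t f => rfl
  have key : ∀ a ∈ D, ∀ y ∈ D, ∀ t : ℝ≥0,
      ‖L t a.1 - a.1 - (t : ℝ) • a.2‖ ≤ (‖y.2‖ * t + ‖a.2 - y.1‖ + ‖y.1 - a.2‖) * t := by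
    intro a ha y hy t
    obtain ⟨g, hg, hg'⟩ := hgen a ha
    obtain ⟨z, hz, hz'⟩ := hgen y hy
    refine le_of_tendsto_of_tendsto (((hL t a.1).sub_const _).sub_const _).norm
      ((((hz.norm.mul_const _).add (hg.sub_const _).norm).add_const _).mul_const _) ?_
    filter_upwards [hg', hz'] with n hn hn'
    exact (hT n).norm_sub_sub_smul_le_of_gen hn hn' t
  have hgenD : ∀ a ∈ D, Tendsto (fun t : ℝ≥0 => ((t : ℝ)⁻¹ : ℝ) • (L t a.1 - a.1))
      (𝓝[>] 0) (𝓝 a.2) := by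
    intro a ha
    rw [Metric.tendsto_nhds]
    intro ε hε
    -- `y` is fixed before `t`, so its possibly large image `y.2` is harmless: after division by
    -- `t`, `key` bounds the error by `‖y.2‖ t + 2‖a.2 - y.1‖ < 3ε/4`.
    obtain ⟨_, ⟨y, hy, rfl⟩, hy'⟩ := hD.exists_dist_lt a.2 (show 0 < ε / 4 by linarith)
    have h1 : Tendsto (fun t : ℝ≥0 => ‖y.2‖ * (t : ℝ)) (𝓝[>] 0) (𝓝 0) := by
      have : Continuous fun t : ℝ≥0 => ‖y.2‖ * (t : ℝ) := by fun_prop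
      simpa using (this.tendsto 0).mono_left nhdsWithin_le_nhds
    filter_upwards [h1.eventually_lt_const (show 0 < ε / 4 by linarith), self_mem_nhdsWithin]
      with t ht ht0
    have ht0' : (0 : ℝ) < t := ht0
    have h2 := key a ha y hy t
    rw [dist_eq_norm] at hy' ⊢
    have h3 : ((t : ℝ)⁻¹ : ℝ) • (L t a.1 - a.1) - a.2
        = ((t : ℝ)⁻¹ : ℝ) • (L t a.1 - a.1 - (t : ℝ) • a.2) := by
      rw [smul_sub _ (L t a.1 - a.1), smul_smul, inv_mul_cancel₀ ht0'.ne', one_smul]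
    rw [h3, norm_smul, norm_inv, Real.norm_of_nonneg ht0'.le, inv_mul_lt_iff₀ ht0']
    rw [norm_sub_rev y.1] at h2
    calc _ ≤ _ := h2
      _ < t * ε := by rw [mul_comm]; gcongr; linarith
  have hcont : ∀ f, Tendsto (fun t => L t f) (𝓝[>] 0) (𝓝 f) := by
    -- Strong continuity at zero passes to limits of vectors because all `L t` are contractions; it
    -- then suffices to have it on the dense set, where it follows from convergence of the
    -- difference quotients.
    have hclosed : IsClosed {f : X | Tendsto (fun t => L t f) (𝓝[>] 0) (𝓝 f)} := by
      rw [← isSeqClosed_iff_isClosed]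
      intro u f hu huf
      simp only [Set.mem_ofPred_eq] at hu ⊢
      rw [Metric.tendsto_nhds]
      intro ε hε
      obtain ⟨n, hn⟩ := (Metric.tendsto_atTop.1 huf (ε / 3) (by linarith))
      have hn := hn n le_rfl
      filter_upwards [Metric.tendsto_nhds.1 (hu n) (ε / 3) (by linarith)] with t ht
      have h1 : dist (L t f) (L t (u n)) ≤ dist f (u n) := by
        rw [dist_eq_norm, dist_eq_norm, ← hO, ← hO, ← map_sub]
        exact hnorm t _
      have := dist_triangle4 (L t f) (L t (u n)) (u n) f
      rw [dist_comm f] at h1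
      linarith
    have hsub : Prod.fst '' D ⊆ {f : X | Tendsto (fun t => L t f) (𝓝[>] 0) (𝓝 f)} := by
      rintro _ ⟨a, ha, rfl⟩
      have h0 : Tendsto (fun t : ℝ≥0 => (t : ℝ)) (𝓝[>] 0) (𝓝 0) := by
        have : Continuous fun t : ℝ≥0 => (t : ℝ) := by fun_prop
        simpa using (this.tendsto 0).mono_left nhdsWithin_le_nhds
      have h1 := (h0.smul (hgenD a ha)).add_const a.1
      rw [zero_smul, zero_add] at h1
      refine h1.congr' ?_
      filter_upwards [self_mem_nhdsWithin] with t ht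
      have ht0' : (0 : ℝ) < t := ht
      rw [smul_smul, mul_inv_cancel₀ ht0'.ne', one_smul, sub_add_cancel]
    intro f
    have := hclosed.closure_subset_iff.2 hsub (hD f)
    exact this
  refine ⟨⟨O, ?_, ?_, hcont⟩, ?_, fun _ _ => rfl, hgenD⟩
  · ext f
    refine tendsto_nhds_unique (hL 0 f) ?_
    simp [C0Semigroup.op_zero]
  · intro s t
    ext f
    refine tendsto_nhds_unique (hL (s + t) f) ?_
    have h1 : Tendsto (fun n => (T n).op s ((T n).op t f - L t f) + (T n).op s (L t f)) atTop
        (𝓝 (0 + L s (L t f))) := by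
      refine Tendsto.add ?_ (hL s _)
      refine squeeze_zero_norm (fun n => (hT n).norm_op_le s _) ?_
      exact tendsto_iff_norm_sub_tendsto_zero.1 (hL t f)
    rw [zero_add] at h1
    refine h1.congr fun n => ?_
    rw [op_add_apply, map_sub, sub_add_cancel]
  · intro t
    exact ContinuousLinearMap.opNorm_le_bound _ zero_le_one fun f => by rw [one_mul]; exact hnorm t f

variable [CompleteSpace X]

/-- The semigroup `t ↦ exp (t A)` of a bounded operator. -/
noncomputable def ofBounded (A : X →L[ℂ] X) : C0Semigroup X where
  op t := NormedSpace.exp ((t : ℝ) • A)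
  op_zero := by simp [ContinuousLinearMap.one_def]
  op_add s t := by
    let := NormedAlgebra.restrictScalars ℚ ℂ (X →L[ℂ] X)
    have : Commute ((s : ℝ) • A) ((t : ℝ) • A) :=
      ((Commute.refl A).smul_left _).smul_right _
    rw [NNReal.coe_add, add_smul, NormedSpace.exp_add_of_commute this]
    rfl
  tendsto_zero f := by
    have h1 : Continuous fun t : ℝ≥0 => NormedSpace.exp ((t : ℝ) • A) f := by
      let := NormedAlgebra.restrictScalars ℚ ℂ (X →L[ℂ] X)
      have h := NormedSpace.exp_continuous (𝔸 := X →L[ℂ] X)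
      have h2 : Continuous fun t : ℝ≥0 => NormedSpace.exp ((t : ℝ) • A) := by
        fun_prop
      exact h2.clm_apply continuous_const
    simpa using (h1.tendsto 0).mono_left nhdsWithin_le_nhds

lemma ofBounded_gen (A : X →L[ℂ] X) (f : X) : (ofBounded A).Gen f (A f) := by
  have h := hasDerivAt_exp_smul_const (𝕂 := ℝ) A (0 : ℝ)
  have h1 : HasDerivAt (fun t : ℝ => NormedSpace.exp (t • A) f) (A f) 0 := by
    have := ((ContinuousLinearMap.apply ℂ X f).restrictScalars ℝ).hasFDerivAt.comp_hasDerivAt 0 h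
    simpa [Function.comp_def] using this
  have h2 := h1.hasDerivWithinAt (s := Set.Ioi 0)
  rw [hasDerivWithinAt_iff_tendsto_slope' (by simp)] at h2
  have h3 : Tendsto (fun t : ℝ≥0 => (t : ℝ)) (𝓝[>] 0) (𝓝[>] 0) := by
    refine tendsto_nhdsWithin_iff.2 ⟨?_, ?_⟩
    · have : Continuous fun t : ℝ≥0 => (t : ℝ) := by fun_prop
      simpa using (this.tendsto 0).mono_left nhdsWithin_le_nhds
    · filter_upwards [self_mem_nhdsWithin] with t ht
      exact ht
  refine (h2.comp h3).congr fun t => ?_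
  simp [slope_def_module, ofBounded]

end C0Semigroup

/-! ### The Hille–Yosida theorem by Yosida approximation -/

section HilleYosida

variable {X : Type*} [NormedAddCommGroup X] [NormedSpace ℂ X]

lemma norm_clm_pow_le (B : X →L[ℂ] X) (k : ℕ) : ‖B ^ k‖ ≤ ‖B‖ ^ k := by
  induction k with
  | zero =>
    rw [pow_zero, pow_zero, ContinuousLinearMap.one_def]
    exact ContinuousLinearMap.norm_id_le
  | succ k ih =>
    rw [pow_succ, pow_succ]
    exact (norm_mul_le _ _).trans (mul_le_mul_of_nonneg_right ih (norm_nonneg _))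

variable [CompleteSpace X]

lemma norm_clm_exp_le (B : X →L[ℂ] X) : ‖NormedSpace.exp B‖ ≤ Real.exp ‖B‖ := by
  have h1 := NormedSpace.exp_series_hasSum_exp' (𝕂 := ℂ) B
  have h2 := NormedSpace.exp_series_hasSum_exp' (𝕂 := ℝ) ‖B‖
  rw [← Real.exp_eq_exp_ℝ] at h2
  refine h1.norm_le_of_bounded h2 fun k => ?_
  rw [norm_smul, norm_inv, smul_eq_mul]
  simpa using mul_le_mul_of_nonneg_left (norm_clm_pow_le B k) (by positivity)

/-- The Yosida approximation `ν² R(ν) - ν`. -/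
noncomputable def yosida (R : ℝ → X →L[ℂ] X) (ν : ℝ) : X →L[ℂ] X :=
  ν ^ 2 • R ν - ν • (1 : X →L[ℂ] X)

/-- The scalar part commutes with `R ν`, so the exponential splits. For `t ≥ 0` the second factor is
a power series in `R ν` with nonnegative coefficients, which is how norm bounds, positivity, order
and consistency of the resolvent reach the semigroup. -/
lemma exp_smul_yosida (R : ℝ → X →L[ℂ] X) (ν t : ℝ) :
    NormedSpace.exp (t • yosida R ν) =
      Real.exp (-(t * ν)) • NormedSpace.exp ((t * ν ^ 2) • R ν) := by
  let := NormedAlgebra.restrictScalars ℚ ℂ (X →L[ℂ] X)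
  have h1 : t • yosida R ν =
      algebraMap ℝ (X →L[ℂ] X) (-(t * ν)) + (t * ν ^ 2) • R ν := by
    rw [yosida, smul_sub, smul_smul, smul_smul, Algebra.algebraMap_eq_smul_one, neg_smul]
    abel
  rw [h1, NormedSpace.exp_add_of_commute (Algebra.commutes _ _), Real.exp_eq_exp_ℝ,
    ← NormedSpace.algebraMap_exp_comm, ← Algebra.smul_def]

lemma ofBounded_yosida_op (R : ℝ → X →L[ℂ] X) (ν : ℝ) (t : ℝ≥0) :
    (C0Semigroup.ofBounded (yosida R ν)).op t =
      ((Real.exp (-(t * ν)) : ℝ) : ℂ) • NormedSpace.exp (((t * ν ^ 2 : ℝ) : ℂ) • R ν) := by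
  have h := exp_smul_yosida R ν t
  rw [← Complex.coe_smul (t * ν ^ 2) (R ν), ← Complex.coe_smul (Real.exp _)] at h
  exact h

lemma norm_exp_smul_yosida_le {R : ℝ → X →L[ℂ] X} {ν t : ℝ} (hν : 0 < ν) (ht : 0 ≤ t)
    (hR : ‖R ν‖ ≤ ν⁻¹) : ‖NormedSpace.exp (t • yosida R ν)‖ ≤ 1 := by
  rw [exp_smul_yosida, norm_smul, Real.norm_of_nonneg (Real.exp_pos _).le]
  have h1 : ‖(t * ν ^ 2) • R ν‖ ≤ t * ν := by
    rw [norm_smul, Real.norm_of_nonneg (by positivity)]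
    calc t * ν ^ 2 * ‖R ν‖ ≤ t * ν ^ 2 * ν⁻¹ := by gcongr
      _ = t * ν := by field_simp
  calc _ ≤ Real.exp (-(t * ν)) * Real.exp (t * ν) := by
        gcongr
        exact (norm_clm_exp_le _).trans (Real.exp_le_exp.2 h1)
    _ = 1 := by rw [← Real.exp_add]; simp

/-- Interpolate by `s ↦ e^{(t-s)B} e^{sA}`, whose derivative is `e^{(t-s)B} e^{sA}(A - B)` because
`A` and `B` commute; both exponentials are contractions. -/
lemma norm_exp_sub_exp_apply_le {A B : X →L[ℂ] X} (hAB : Commute A B)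
    (hA : ∀ t : ℝ, 0 ≤ t → ‖NormedSpace.exp (t • A)‖ ≤ 1)
    (hB : ∀ t : ℝ, 0 ≤ t → ‖NormedSpace.exp (t • B)‖ ≤ 1) {t : ℝ} (ht : 0 ≤ t) (f : X) :
    ‖NormedSpace.exp (t • A) f - NormedSpace.exp (t • B) f‖ ≤ ‖A f - B f‖ * t := by
  let E : ℝ → X →L[ℂ] X := fun s => NormedSpace.exp ((t - s) • B) * NormedSpace.exp (s • A)
  have hE : ∀ s, HasDerivAt E
      (NormedSpace.exp ((t - s) • B) * NormedSpace.exp (s • A) * (A - B)) s := by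
    intro s
    have h1 : HasDerivAt (fun s : ℝ => NormedSpace.exp ((t - s) • B))
        ((-1 : ℝ) • (NormedSpace.exp ((t - s) • B) * B)) s :=
      (hasDerivAt_exp_smul_const (𝕂 := ℝ) B (t - s)).scomp s ((hasDerivAt_id s).const_sub t)
    have h2 := h1.mul (hasDerivAt_exp_smul_const (𝕂 := ℝ) A s)
    refine h2.congr_deriv ?_
    have h3 : Commute (NormedSpace.exp (s • A)) B := (hAB.smul_left s).exp_left
    rw [neg_one_smul, neg_mul, mul_assoc _ B, ← h3.eq, mul_sub]
    noncomm_ring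
  have hE' : ∀ s, HasDerivAt (fun s => E s f)
      ((NormedSpace.exp ((t - s) • B) * NormedSpace.exp (s • A) * (A - B)) f) s := fun s =>
    ((ContinuousLinearMap.apply ℂ X f).restrictScalars ℝ).hasFDerivAt.comp_hasDerivAt s (hE s)
  have h := norm_image_sub_le_of_norm_deriv_le_segment' (a := 0) (b := t) (C := ‖A f - B f‖)
    (fun s _ => (hE' s).hasDerivWithinAt) (fun s hs => ?_) t ⟨ht, le_rfl⟩
  · simpa [E] using h
  · change ‖NormedSpace.exp ((t - s) • B) (NormedSpace.exp (s • A) (A f - B f))‖ ≤ _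
    have h1 := (NormedSpace.exp ((t - s) • B)).le_of_opNorm_le (hB _ (by linarith [hs.2]))
      (NormedSpace.exp (s • A) (A f - B f))
    have h2 := (NormedSpace.exp (s • A)).le_of_opNorm_le (hA _ hs.1) (A f - B f)
    linarith

lemma exists_tendsto_of_dense {B : ℕ → X →L[ℂ] X} (hB : ∀ n, ‖B n‖ ≤ 1) {D : Set X}
    (hD : Dense D) (hconv : ∀ f ∈ D, CauchySeq fun n => B n f) (f : X) :
    ∃ l, Tendsto (fun n => B n f) atTop (𝓝 l) := by
  refine cauchySeq_tendsto_of_complete (Metric.cauchySeq_iff.2 fun ε hε => ?_)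
  obtain ⟨y, hy, hy'⟩ := hD.exists_dist_lt f (show 0 < ε / 3 by linarith)
  obtain ⟨n₀, hn₀⟩ := Metric.cauchySeq_iff.1 (hconv y hy) (ε / 3) (by linarith)
  have h1 : ∀ n, dist (B n f) (B n y) ≤ dist f y := fun n => by
    rw [dist_eq_norm, dist_eq_norm, ← map_sub]
    simpa using (B n).le_of_opNorm_le (hB n) (f - y)
  refine ⟨n₀, fun m hm n hn => ?_⟩
  have h2 := dist_triangle4 (B m f) (B m y) (B n y) (B n f)
  have h3 := h1 n
  rw [dist_comm] at h3
  linarith [h1 m, hn₀ m hm n hn]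

/-- **Hille–Yosida**, contractive case: a densely defined operator given by its resolvent. -/
theorem hille_yosida (R : ℝ → X →L[ℂ] X) (hR : ∀ μ, 0 < μ → ‖R μ‖ ≤ μ⁻¹)
    (hres : ∀ μ ν, 0 < μ → 0 < ν → R μ - R ν = (ν - μ) • (R μ * R ν))
    (hdense : Dense {f | ∃ g, R 1 (f - g) = f}) :
    ∃ T : C0Semigroup X, T.IsContractive ∧ (∀ f g, T.Gen f g ↔ R 1 (f - g) = f) ∧
      ∀ (t : ℝ≥0) f, Tendsto
        (fun n : ℕ => (C0Semigroup.ofBounded (yosida R (n + 1))).op t f) atTop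
        (𝓝 (T.op t f)) := by
  have hcomm : ∀ μ ν, 0 < μ → 0 < ν → Commute (R μ) (R ν) := by
    intro μ ν hμ hν
    rcases eq_or_ne μ ν with rfl | h
    · exact Commute.refl _
    have h1 := hres μ ν hμ hν
    have h2 := hres ν μ hν hμ
    -- Exchanging `μ` and `ν` in the resolvent identity only changes the sign of its left side,
    -- hence the two products agree.
    have h3 : (ν - μ) • (R μ * R ν) = (ν - μ) • (R ν * R μ) := by
      rw [← h1, ← neg_sub μ ν, neg_smul, ← h2]; abel
    exact smul_right_injective _ (sub_ne_zero.2 h.symm) h3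
  have hpos : ∀ n : ℕ, (0 : ℝ) < n + 1 := fun n => by positivity
  have hycomm : ∀ μ ν, 0 < μ → 0 < ν → Commute (R μ) (yosida R ν) := fun μ ν hμ hν =>
    ((hcomm μ ν hμ hν).smul_right _).sub_right ((Commute.one_right _).smul_right _)
  have hyy : ∀ μ ν, 0 < μ → 0 < ν → Commute (yosida R μ) (yosida R ν) := fun μ ν hμ hν =>
    ((hycomm μ ν hμ hν).smul_left _).sub_left ((Commute.one_left _).smul_left _)
  have hbound : ∀ ν : ℝ, 0 < ν → ∀ f, ‖ν • R ν f‖ ≤ ‖f‖ := by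
    intro ν hν f
    rw [norm_smul, Real.norm_of_nonneg hν.le]
    calc ν * ‖R ν f‖ ≤ ν * (ν⁻¹ * ‖f‖) := by gcongr; exact (R ν).le_of_opNorm_le (hR ν hν) f
      _ = ‖f‖ := by field_simp
  -- For `f` in the domain with image `g`, this is `νR(ν)f - f = R(ν)g`, of norm at most `‖g‖/ν`. It
  -- gives `νR(ν) → 1` on a dense set and then convergence of the Yosida approximations on the
  -- domain.
  have hid : ∀ ν : ℝ, 0 < ν → ∀ f g, R 1 (f - g) = f → ν • R ν f - f = R ν g := by
    intro ν hν f g hfg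
    have h1 := DFunLike.congr_fun (hres ν 1 hν one_pos) (f - g)
    change R ν (f - g) - R 1 (f - g) = (1 - ν) • R ν (R 1 (f - g)) at h1
    rw [hfg, map_sub, sub_smul, one_smul] at h1
    linear_combination (norm := module) h1
  have hlim0 : ∀ f, Tendsto (fun n : ℕ => ((n : ℝ) + 1) • R (n + 1) f) atTop (𝓝 f) := by
    have h0 : Tendsto (fun n : ℕ => ((n : ℝ) + 1)⁻¹) atTop (𝓝 0) :=
      tendsto_inv_atTop_zero.comp (tendsto_atTop_add_const_right _ _ tendsto_natCast_atTop_atTop)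
    intro f
    rw [Metric.tendsto_atTop]
    intro ε hε
    obtain ⟨y, ⟨g, hg⟩, hy⟩ := hdense.exists_dist_lt f (show 0 < ε / 3 by linarith)
    have h1 : Tendsto (fun n : ℕ => ((n : ℝ) + 1)⁻¹ * ‖g‖) atTop (𝓝 0) := by
      simpa using h0.mul_const ‖g‖
    obtain ⟨n₀, hn₀⟩ := eventually_atTop.1 (h1.eventually_lt_const (show 0 < ε / 3 by linarith))
    refine ⟨n₀, fun n hn => ?_⟩
    rw [dist_eq_norm] at hy ⊢
    have h2 : ((n : ℝ) + 1) • R (n + 1) f - f = ((n : ℝ) + 1) • R (n + 1) (f - y)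
        + (((n : ℝ) + 1) • R (n + 1) y - y) - (f - y) := by
      rw [map_sub, smul_sub]; abel
    rw [h2, hid _ (hpos n) _ _ hg]
    have h3 := hbound _ (hpos n) (f - y)
    have h4 := (R ((n : ℝ) + 1)).le_of_opNorm_le (hR _ (hpos n)) g
    have h5 := norm_sub_le (((n : ℝ) + 1) • R (n + 1) (f - y) + R (n + 1) g) (f - y)
    have h6 := norm_add_le (((n : ℝ) + 1) • R (n + 1) (f - y)) (R (n + 1) g)
    linarith [hn₀ n hn]
  have hyos : ∀ f g, R 1 (f - g) = f →
      Tendsto (fun n : ℕ => yosida R (n + 1) f) atTop (𝓝 g) := by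
    intro f g hfg
    refine (hlim0 g).congr fun n => ?_
    rw [← hid _ (hpos n) _ _ hfg, smul_sub, smul_smul, yosida]
    simp [pow_two]
  have hexp : ∀ (n : ℕ) (t : ℝ), 0 ≤ t → ‖NormedSpace.exp (t • yosida R (n + 1))‖ ≤ 1 :=
    fun n t ht => norm_exp_smul_yosida_le (hpos n) ht (hR _ (hpos n))
  have hconv : ∀ (t : ℝ≥0) (f : X), ∃ l,
      Tendsto (fun n : ℕ => NormedSpace.exp ((t : ℝ) • yosida R (n + 1)) f) atTop (𝓝 l) := by
    intro t
    refine exists_tendsto_of_dense (fun n => hexp n t t.2) hdense ?_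
    rintro f ⟨g, hg⟩
    rw [Metric.cauchySeq_iff]
    intro ε hε
    obtain ⟨n₀, hn₀⟩ := Metric.cauchySeq_iff.1 (hyos f g hg).cauchySeq (ε / (t + 1))
      (by positivity)
    refine ⟨n₀, fun m hm n hn => ?_⟩
    have h1 := norm_exp_sub_exp_apply_le (hyy _ _ (hpos m) (hpos n)) (hexp m) (hexp n) t.2 f
    have h2 := hn₀ m hm n hn
    rw [dist_eq_norm] at h2 ⊢
    refine h1.trans_lt ?_
    rw [lt_div_iff₀ (by positivity)] at h2
    refine lt_of_le_of_lt ?_ h2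
    have : (t : ℝ) ≤ t + 1 := by linarith
    exact mul_le_mul_of_nonneg_left this (norm_nonneg _)
  choose L hL using hconv
  obtain ⟨T, hT, hTL, hTgen⟩ := C0Semigroup.exists_limit
    (fun n : ℕ => C0Semigroup.ofBounded (yosida R (n + 1))) (fun n t => hexp n t t.2) L hL
    {a | R 1 (a.1 - a.2) = a.1}
    (by
      refine hdense.mono ?_
      rintro f ⟨g, hg⟩
      exact ⟨(f, g), hg, rfl⟩)
    (fun a ha => ⟨_, hyos _ _ ha, Eventually.of_forall fun n =>
      C0Semigroup.ofBounded_gen _ _⟩)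
  have hTlim : ∀ (t : ℝ≥0) f, Tendsto
      (fun n : ℕ => NormedSpace.exp ((t : ℝ) • yosida R (n + 1)) f) atTop (𝓝 (T.op t f)) :=
    fun t f => by rw [hTL]; exact hL t f
  refine ⟨T, hT, fun f g => ⟨fun h => ?_, fun h => hTgen (f, g) h⟩, hTlim⟩
  -- The remaining implication says that the generator is not larger than the given operator. As `R
  -- 1` commutes with the semigroup, the generator sends `R 1 f` to `R 1 g`; it also sends it to `R
  -- 1 f - f`, and the two values must agree.
  have hTR : ∀ t f, T.op t (R 1 f) = R 1 (T.op t f) := by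
    intro t f
    refine tendsto_nhds_unique (hTlim t (R 1 f)) ?_
    refine (((R 1).continuous.tendsto _).comp (hTlim t f)).congr fun n => ?_
    have : Commute (R 1) (NormedSpace.exp ((t : ℝ) • yosida R (n + 1))) :=
      ((hycomm _ _ one_pos (hpos n)).smul_right _).exp_right
    exact congrArg (fun B : X →L[ℂ] X => B f) this.eq
  have h1 : T.Gen (R 1 f) (R 1 g) := by
    refine (((R 1).continuous.tendsto _).comp h).congr fun t => ?_
    simp only [Function.comp_apply]
    rw [ContinuousLinearMap.map_smul_of_tower, map_sub, hTR]
  have h2 : T.Gen (R 1 f) (R 1 f - f) := hTgen (R 1 f, R 1 f - f) (by simp)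
  rw [map_sub, h1.unique h2]
  abel

end HilleYosida

/-! ### Positivity, consistency, multiplication and monotone convergence in `L^p` -/

section LpTools

variable {Ω : Type*} [MeasurableSpace Ω] {μ : Measure Ω}

/-- Norm convergence gives almost everywhere convergence along a subsequence. -/
lemma isClosed_setOf_ae_nonneg {p : ℝ≥0∞} [Fact (1 ≤ p)] :
    IsClosed {f : Lp ℂ p μ | ∀ᵐ x ∂μ, 0 ≤ f x} := by
  rw [← isSeqClosed_iff_isClosed]
  intro u f hu huf
  obtain ⟨ns, -, hns⟩ := (tendstoInMeasure_of_tendsto_Lp huf).exists_seq_tendsto_ae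
  have hu' : ∀ᵐ x ∂μ, ∀ n, 0 ≤ u n x := ae_all_iff.2 hu
  filter_upwards [hns, hu'] with x hx hx'
  exact ge_of_tendsto' hx fun i => hx' _

lemma ae_nonneg_of_tendsto {p : ℝ≥0∞} [Fact (1 ≤ p)] {u : ℕ → Lp ℂ p μ} {f : Lp ℂ p μ}
    (hf : Tendsto u atTop (𝓝 f)) (hu : ∀ n, ∀ᵐ x ∂μ, 0 ≤ u n x) : ∀ᵐ x ∂μ, 0 ≤ f x :=
  isClosed_setOf_ae_nonneg.mem_of_tendsto hf (Eventually.of_forall hu)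

/-- Convergence in measure is common to all exponents and has an almost everywhere unique limit. -/
lemma ae_eq_of_tendsto {p q : ℝ≥0∞} [Fact (1 ≤ p)] [Fact (1 ≤ q)] {u : ℕ → Lp ℂ p μ}
    {v : ℕ → Lp ℂ q μ} {f : Lp ℂ p μ} {g : Lp ℂ q μ} (hf : Tendsto u atTop (𝓝 f))
    (hg : Tendsto v atTop (𝓝 g)) (huv : ∀ n, u n =ᵐ[μ] v n) : f =ᵐ[μ] g := by
  refine tendstoInMeasure_ae_unique (tendstoInMeasure_of_tendsto_Lp hf) ?_
  refine (tendstoInMeasure_of_tendsto_Lp hg).congr (fun n => (huv n).symm) ae_eq_rfl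

/-- Positivity of an operator on `L^p`. -/
def IsPositiveOp {p : ℝ≥0∞} [Fact (1 ≤ p)] (A : Lp ℂ p μ →L[ℂ] Lp ℂ p μ) : Prop :=
  ∀ f : Lp ℂ p μ, (∀ᵐ x ∂μ, 0 ≤ f x) → ∀ᵐ x ∂μ, 0 ≤ A f x

/-- Consistency of an operator on `L^p` and one on `L^q`. -/
def AreConsistent {p q : ℝ≥0∞} [Fact (1 ≤ p)] [Fact (1 ≤ q)]
    (A : Lp ℂ p μ →L[ℂ] Lp ℂ p μ) (B : Lp ℂ q μ →L[ℂ] Lp ℂ q μ) : Prop :=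
  ∀ (f : Lp ℂ p μ) (g : Lp ℂ q μ), f =ᵐ[μ] g → A f =ᵐ[μ] B g

section Positive

variable {p : ℝ≥0∞}

lemma ae_nonneg_zero : ∀ᵐ x ∂μ, 0 ≤ (0 : Lp ℂ p μ) x := by
  filter_upwards [Lp.coeFn_zero ℂ p μ] with x hx
  rw [hx]; rfl

lemma ae_nonneg_add {f g : Lp ℂ p μ} (hf : ∀ᵐ x ∂μ, 0 ≤ f x) (hg : ∀ᵐ x ∂μ, 0 ≤ g x) :
    ∀ᵐ x ∂μ, 0 ≤ (f + g) x := by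
  filter_upwards [hf, hg, Lp.coeFn_add f g] with x h1 h2 h3
  rw [h3]; exact add_nonneg h1 h2

lemma ae_nonneg_smul {f : Lp ℂ p μ} (hf : ∀ᵐ x ∂μ, 0 ≤ f x) {r : ℝ} (hr : 0 ≤ r) :
    ∀ᵐ x ∂μ, 0 ≤ ((r : ℂ) • f) x := by
  filter_upwards [hf, Lp.coeFn_smul (r : ℂ) f] with x h1 h2
  rw [h2]; exact mul_nonneg (by exact_mod_cast hr) h1

lemma ae_le_iff_ae_nonneg_sub {f g : Lp ℂ p μ} :
    (∀ᵐ x ∂μ, f x ≤ g x) ↔ ∀ᵐ x ∂μ, 0 ≤ (g - f) x := by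
  refine eventually_congr ?_
  filter_upwards [Lp.coeFn_sub g f] with x hx
  rw [hx, Pi.sub_apply, sub_nonneg]

variable [Fact (1 ≤ p)]

lemma isPositiveOp_zero : IsPositiveOp (0 : Lp ℂ p μ →L[ℂ] Lp ℂ p μ) :=
  fun _ _ => ae_nonneg_zero

lemma isPositiveOp_one : IsPositiveOp (1 : Lp ℂ p μ →L[ℂ] Lp ℂ p μ) := fun _ hf => hf

lemma IsPositiveOp.add {A B : Lp ℂ p μ →L[ℂ] Lp ℂ p μ} (hA : IsPositiveOp A)
    (hB : IsPositiveOp B) : IsPositiveOp (A + B) :=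
  fun f hf => ae_nonneg_add (hA f hf) (hB f hf)

lemma IsPositiveOp.smul {A : Lp ℂ p μ →L[ℂ] Lp ℂ p μ} (hA : IsPositiveOp A) {r : ℝ}
    (hr : 0 ≤ r) : IsPositiveOp ((r : ℂ) • A) :=
  fun f hf => ae_nonneg_smul (hA f hf) hr

lemma IsPositiveOp.mul {A B : Lp ℂ p μ →L[ℂ] Lp ℂ p μ} (hA : IsPositiveOp A)
    (hB : IsPositiveOp B) : IsPositiveOp (A * B) :=
  fun f hf => hA _ (hB f hf)

lemma IsPositiveOp.pow {A : Lp ℂ p μ →L[ℂ] Lp ℂ p μ} (hA : IsPositiveOp A) (k : ℕ) :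
    IsPositiveOp (A ^ k) := by
  induction k with
  | zero => exact isPositiveOp_one
  | succ k ih => rw [pow_succ]; exact ih.mul hA

/-- Telescoping `B^{k+1} - A^{k+1} = B^k(B - A) + (B^k - A^k)A` leaves only products of positive
operators, without any commutation. -/
lemma IsPositiveOp.pow_sub_pow {A B : Lp ℂ p μ →L[ℂ] Lp ℂ p μ} (hA : IsPositiveOp A)
    (hAB : IsPositiveOp (B - A)) (k : ℕ) : IsPositiveOp (B ^ k - A ^ k) := by
  have hB : IsPositiveOp B := by simpa using hAB.add hA
  induction k with
  | zero => simpa using isPositiveOp_zero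
  | succ k ih =>
    have : B ^ (k + 1) - A ^ (k + 1) = B ^ k * (B - A) + (B ^ k - A ^ k) * A := by
      rw [pow_succ, pow_succ]; noncomm_ring
    rw [this]
    exact ((hB.pow k).mul hAB).add (ih.mul hA)

lemma IsPositiveOp.of_tendsto {A : ℕ → Lp ℂ p μ →L[ℂ] Lp ℂ p μ} {B : Lp ℂ p μ →L[ℂ] Lp ℂ p μ}
    (hA : ∀ n, IsPositiveOp (A n)) (h : ∀ f, Tendsto (fun n => A n f) atTop (𝓝 (B f))) :
    IsPositiveOp B :=
  fun f hf => ae_nonneg_of_tendsto (h f) fun n => hA n f hf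

lemma hasSum_exp_apply (A : Lp ℂ p μ →L[ℂ] Lp ℂ p μ) (f : Lp ℂ p μ) :
    Tendsto (fun n => (∑ k ∈ Finset.range n, (((k.factorial : ℝ)⁻¹ : ℝ) : ℂ) • A ^ k) f) atTop
      (𝓝 (NormedSpace.exp A f)) := by
  have h := (NormedSpace.exp_series_hasSum_exp' (𝕂 := ℂ) A).tendsto_sum_nat
  simp only [Complex.ofReal_inv, Complex.ofReal_natCast]
  exact ((ContinuousLinearMap.apply ℂ (Lp ℂ p μ) f).continuous.tendsto _).comp h

lemma IsPositiveOp.sum {ι : Type*} {s : Finset ι} {A : ι → Lp ℂ p μ →L[ℂ] Lp ℂ p μ}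
    (hA : ∀ i ∈ s, IsPositiveOp (A i)) : IsPositiveOp (∑ i ∈ s, A i) :=
  Finset.sum_induction _ _ (fun _ _ => IsPositiveOp.add) isPositiveOp_zero hA

lemma IsPositiveOp.exp {A : Lp ℂ p μ →L[ℂ] Lp ℂ p μ} (hA : IsPositiveOp A) :
    IsPositiveOp (NormedSpace.exp A) :=
  .of_tendsto (fun _ => .sum fun k _ => (hA.pow k).smul (by positivity)) (hasSum_exp_apply A)

lemma IsPositiveOp.exp_sub_exp {A B : Lp ℂ p μ →L[ℂ] Lp ℂ p μ} (hA : IsPositiveOp A)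
    (hAB : IsPositiveOp (B - A)) : IsPositiveOp (NormedSpace.exp B - NormedSpace.exp A) := by
  refine .of_tendsto (A := fun n => ∑ k ∈ Finset.range n, (((k.factorial : ℝ)⁻¹ : ℝ) : ℂ) • (B ^ k - A ^ k))
    (fun _ => .sum fun k _ => (hA.pow_sub_pow hAB k).smul (by positivity)) fun f => ?_
  refine ((hasSum_exp_apply B f).sub (hasSum_exp_apply A f)).congr fun n => ?_
  simp only [smul_sub, Finset.sum_sub_distrib]
  rfl

lemma isPositiveOp_ofBounded_yosida {R : ℝ → Lp ℂ p μ →L[ℂ] Lp ℂ p μ} {ν : ℝ}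
    (hR : IsPositiveOp (R ν)) (t : ℝ≥0) :
    IsPositiveOp ((C0Semigroup.ofBounded (yosida R ν)).op t) := by
  rw [ofBounded_yosida_op]
  exact (hR.smul (by positivity)).exp.smul (Real.exp_pos _).le

lemma isPositiveOp_ofBounded_yosida_sub {R R' : ℝ → Lp ℂ p μ →L[ℂ] Lp ℂ p μ} {ν : ℝ}
    (hR : IsPositiveOp (R ν)) (hR' : IsPositiveOp (R' ν - R ν)) (t : ℝ≥0) :
    IsPositiveOp ((C0Semigroup.ofBounded (yosida R' ν)).op t
      - (C0Semigroup.ofBounded (yosida R ν)).op t) := by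
  rw [ofBounded_yosida_op, ofBounded_yosida_op, ← smul_sub]
  refine ((hR.smul (by positivity)).exp_sub_exp ?_).smul (Real.exp_pos _).le
  rw [← smul_sub]
  exact hR'.smul (by positivity)

end Positive

section Consistent

variable {p q : ℝ≥0∞} [Fact (1 ≤ p)] [Fact (1 ≤ q)]

lemma areConsistent_one :
    AreConsistent (1 : Lp ℂ p μ →L[ℂ] Lp ℂ p μ) (1 : Lp ℂ q μ →L[ℂ] Lp ℂ q μ) :=
  fun _ _ h => h

lemma areConsistent_zero :
    AreConsistent (0 : Lp ℂ p μ →L[ℂ] Lp ℂ p μ) (0 : Lp ℂ q μ →L[ℂ] Lp ℂ q μ) :=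
  fun _ _ _ => (Lp.coeFn_zero ℂ p μ).trans (Lp.coeFn_zero ℂ q μ).symm

variable {A A' : Lp ℂ p μ →L[ℂ] Lp ℂ p μ} {B B' : Lp ℂ q μ →L[ℂ] Lp ℂ q μ}

lemma AreConsistent.add (h : AreConsistent A B) (h' : AreConsistent A' B') :
    AreConsistent (A + A') (B + B') := fun f g hfg =>
  (Lp.coeFn_add _ _).trans (((h f g hfg).add (h' f g hfg)).trans (Lp.coeFn_add _ _).symm)

lemma AreConsistent.smul (h : AreConsistent A B) (r : ℂ) : AreConsistent (r • A) (r • B) :=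
  fun f g hfg =>
    (Lp.coeFn_smul r _).trans (((h f g hfg).const_smul r).trans (Lp.coeFn_smul r _).symm)

lemma AreConsistent.sub (h : AreConsistent A B) (h' : AreConsistent A' B') :
    AreConsistent (A - A') (B - B') := fun f g hfg =>
  (Lp.coeFn_sub _ _).trans (((h f g hfg).sub (h' f g hfg)).trans (Lp.coeFn_sub _ _).symm)

lemma AreConsistent.mul (h : AreConsistent A B) (h' : AreConsistent A' B') :
    AreConsistent (A * A') (B * B') := fun f g hfg => h _ _ (h' f g hfg)

lemma AreConsistent.pow (h : AreConsistent A B) (k : ℕ) : AreConsistent (A ^ k) (B ^ k) := by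
  induction k with
  | zero => exact areConsistent_one
  | succ k ih => rw [pow_succ, pow_succ]; exact ih.mul h

lemma AreConsistent.exp (h : AreConsistent A B) :
    AreConsistent (NormedSpace.exp A) (NormedSpace.exp B) := by
  intro f g hfg
  refine ae_eq_of_tendsto (hasSum_exp_apply A f) (hasSum_exp_apply B g) fun n => ?_
  suffices H : AreConsistent (∑ k ∈ Finset.range n, (((k.factorial : ℝ)⁻¹ : ℝ) : ℂ) • A ^ k)
      (∑ k ∈ Finset.range n, (((k.factorial : ℝ)⁻¹ : ℝ) : ℂ) • B ^ k) from H f g hfg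
  induction n with
  | zero => simpa using areConsistent_zero
  | succ n ih =>
    rw [Finset.sum_range_succ, Finset.sum_range_succ]
    exact ih.add ((h.pow n).smul _)

lemma AreConsistent.ofBounded_yosida {R : ℝ → Lp ℂ p μ →L[ℂ] Lp ℂ p μ}
    {R' : ℝ → Lp ℂ q μ →L[ℂ] Lp ℂ q μ} {ν : ℝ} (h : AreConsistent (R ν) (R' ν)) (t : ℝ≥0) :
    AreConsistent ((C0Semigroup.ofBounded (yosida R ν)).op t)
      ((C0Semigroup.ofBounded (yosida R' ν)).op t) := by
  rw [ofBounded_yosida_op, ofBounded_yosida_op]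
  exact (h.smul _).exp.smul _

end Consistent

section Multiplication

variable {p : ℝ≥0∞} [Fact (1 ≤ p)]

lemma memLp_mul_of_bound {θ : Ω → ℝ} (hθ : AEStronglyMeasurable θ μ) {C : ℝ}
    (hC : ∀ᵐ x ∂μ, |θ x| ≤ C) {q : ℝ≥0∞} {f : Ω → ℂ} (hf : MemLp f q μ) :
    MemLp (fun x => (θ x : ℂ) * f x) q μ := by
  refine hf.of_le_mul (c := C)
    ((Complex.continuous_ofReal.comp_aestronglyMeasurable hθ).mul hf.1) ?_
  filter_upwards [hC] with x hx
  rw [norm_mul, Complex.norm_real]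
  exact mul_le_mul_of_nonneg_right hx (norm_nonneg _)

/-- Multiplication by a bounded real function as an operator on `L^p`. -/
noncomputable def mulOp (p : ℝ≥0∞) [Fact (1 ≤ p)] (θ : Ω → ℝ) (hθ : AEStronglyMeasurable θ μ)
    (C : ℝ) (hC : ∀ᵐ x ∂μ, |θ x| ≤ C) : Lp ℂ p μ →L[ℂ] Lp ℂ p μ :=
  LinearMap.mkContinuous
    { toFun := fun f => (memLp_mul_of_bound hθ hC (Lp.memLp f)).toLp
      map_add' := fun f g => by
        ext1
        filter_upwards [(memLp_mul_of_bound hθ hC (Lp.memLp (f + g))).coeFn_toLp,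
          (memLp_mul_of_bound hθ hC (Lp.memLp f)).coeFn_toLp,
          (memLp_mul_of_bound hθ hC (Lp.memLp g)).coeFn_toLp, Lp.coeFn_add f g,
          Lp.coeFn_add (memLp_mul_of_bound hθ hC (Lp.memLp f)).toLp
            (memLp_mul_of_bound hθ hC (Lp.memLp g)).toLp] with x h1 h2 h3 h4 h5
        rw [h1, h5, Pi.add_apply, h2, h3, h4, Pi.add_apply, mul_add]
      map_smul' := fun c f => by
        ext1
        filter_upwards [(memLp_mul_of_bound hθ hC (Lp.memLp (c • f))).coeFn_toLp,
          (memLp_mul_of_bound hθ hC (Lp.memLp f)).coeFn_toLp, Lp.coeFn_smul c f,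
          Lp.coeFn_smul c (memLp_mul_of_bound hθ hC (Lp.memLp f)).toLp] with x h1 h2 h3 h4
        rw [h1, RingHom.id_apply, h4, Pi.smul_apply, h2, h3, Pi.smul_apply, smul_eq_mul,
          smul_eq_mul, mul_left_comm] } C
    (fun f => by
      refine Lp.norm_le_mul_norm_of_ae_le_mul ?_
      filter_upwards [(memLp_mul_of_bound hθ hC (Lp.memLp f)).coeFn_toLp, hC] with x h1 h2
      change ‖(memLp_mul_of_bound hθ hC (Lp.memLp f)).toLp _ x‖ ≤ _
      rw [h1, norm_mul, Complex.norm_real]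
      exact mul_le_mul_of_nonneg_right h2 (norm_nonneg _))

lemma mulOp_coeFn {θ : Ω → ℝ} (hθ : AEStronglyMeasurable θ μ) {C : ℝ}
    (hC : ∀ᵐ x ∂μ, |θ x| ≤ C) (f : Lp ℂ p μ) :
    mulOp p θ hθ C hC f =ᵐ[μ] fun x => (θ x : ℂ) * f x :=
  (memLp_mul_of_bound hθ hC (Lp.memLp f)).coeFn_toLp

lemma mulOp_areConsistent {q : ℝ≥0∞} [Fact (1 ≤ q)] {θ : Ω → ℝ}
    (hθ : AEStronglyMeasurable θ μ) {C : ℝ} (hC : ∀ᵐ x ∂μ, |θ x| ≤ C) :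
    AreConsistent (mulOp p θ hθ C hC) (mulOp q θ hθ C hC) := by
  intro f g hfg
  filter_upwards [mulOp_coeFn hθ hC f, mulOp_coeFn hθ hC g, hfg] with x h1 h2 h3
  rw [h1, h2, h3]

end Multiplication

lemma tendsto_toLp_of_dominated {p : ℝ≥0∞} [Fact (1 ≤ p)] (hp : p ≠ ⊤) {F : ℕ → Lp ℂ p μ}
    {f : Lp ℂ p μ} (hF : ∀ n, ∀ᵐ x ∂μ, ‖F n x‖ ≤ ‖f x‖)
    (hlim : ∀ᵐ x ∂μ, Tendsto (fun n => F n x) atTop (𝓝 (f x))) : Tendsto F atTop (𝓝 f) := by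
  rw [Lp.tendsto_Lp_iff_tendsto_eLpNorm']
  have hp0 : p ≠ 0 := (zero_lt_one.trans_le (Fact.out : 1 ≤ p)).ne'
  have hpr : 0 < p.toReal := ENNReal.toReal_pos hp0 hp
  simp_rw [eLpNorm_eq_lintegral_rpow_enorm_toReal hp0 hp]
  have h : Tendsto (fun n => ∫⁻ x, ‖(⇑(F n) - ⇑f) x‖ₑ ^ p.toReal ∂μ) atTop (𝓝 (∫⁻ _, 0 ∂μ)) := by
    refine tendsto_lintegral_of_dominated_convergence' (fun x => (2 * ‖f x‖ₑ) ^ p.toReal)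
      (fun n => (((Lp.aestronglyMeasurable _).sub
        (Lp.aestronglyMeasurable _)).enorm.pow_const _)) (fun n => ?_) ?_ ?_
    · filter_upwards [hF n] with x hx
      refine ENNReal.rpow_le_rpow ?_ hpr.le
      rw [Pi.sub_apply, two_mul]
      refine (enorm_sub_le).trans (add_le_add ?_ le_rfl)
      exact enorm_le_iff_norm_le.2 hx
    · have h2 := (Lp.memLp f).eLpNorm_lt_top
      simp_rw [ENNReal.mul_rpow_of_nonneg _ _ hpr.le]
      rw [lintegral_const_mul'' _ ((Lp.aestronglyMeasurable f).enorm.pow_const _)]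
      refine ENNReal.mul_ne_top (by simp) ?_
      exact (lintegral_rpow_enorm_lt_top_of_eLpNorm_lt_top hp0 hp h2).ne
    · filter_upwards [hlim] with x hx
      have h3 : Tendsto (fun n => ‖(⇑(F n) - ⇑f) x‖ₑ) atTop (𝓝 0) := by
        have := (hx.sub_const (f x)).enorm
        simpa using this
      have h4 := h3.ennrpow_const p.toReal
      rwa [ENNReal.zero_rpow_of_pos hpr] at h4
  simp only [lintegral_zero] at h
  have h5 := h.ennrpow_const (1 / p.toReal)
  rwa [ENNReal.zero_rpow_of_pos (by positivity)] at h5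

/-- Positive and negative parts of real and imaginary part. -/
lemma exists_nonneg_decomposition {p : ℝ≥0∞} (f : Lp ℂ p μ) :
    ∃ f₁ f₂ f₃ f₄ : Lp ℂ p μ, (∀ᵐ x ∂μ, 0 ≤ f₁ x) ∧ (∀ᵐ x ∂μ, 0 ≤ f₂ x) ∧
      (∀ᵐ x ∂μ, 0 ≤ f₃ x) ∧ (∀ᵐ x ∂μ, 0 ≤ f₄ x) ∧
      f = f₁ - f₂ + Complex.I • (f₃ - f₄) := by
  have key : ∀ φ : ℂ → ℝ, Continuous φ → (∀ z, |φ z| ≤ ‖z‖) →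
      MemLp (fun x => ((max (φ (f x)) 0 : ℝ) : ℂ)) p μ := by
    intro φ hφ hb
    refine (Lp.memLp f).of_le ?_ (Eventually.of_forall fun x => ?_)
    · have : Continuous fun z : ℂ => ((max (φ z) 0 : ℝ) : ℂ) := by fun_prop
      exact this.comp_aestronglyMeasurable (Lp.aestronglyMeasurable f)
    · rw [Complex.norm_real, Real.norm_of_nonneg (le_max_right _ _)]
      exact max_le ((le_abs_self _).trans (hb _)) (norm_nonneg _)
  have h1 := key Complex.re Complex.continuous_re Complex.abs_re_le_norm
  have h2 := key (fun z => -z.re) Complex.continuous_re.neg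
    (fun z => by rw [abs_neg]; exact Complex.abs_re_le_norm z)
  have h3 := key Complex.im Complex.continuous_im Complex.abs_im_le_norm
  have h4 := key (fun z => -z.im) Complex.continuous_im.neg
    (fun z => by rw [abs_neg]; exact Complex.abs_im_le_norm z)
  refine ⟨h1.toLp, h2.toLp, h3.toLp, h4.toLp, ?_, ?_, ?_, ?_, ?_⟩
  · filter_upwards [h1.coeFn_toLp] with x hx
    rw [hx]; exact_mod_cast le_max_right _ _
  · filter_upwards [h2.coeFn_toLp] with x hx
    rw [hx]; exact_mod_cast le_max_right _ _
  · filter_upwards [h3.coeFn_toLp] with x hx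
    rw [hx]; exact_mod_cast le_max_right _ _
  · filter_upwards [h4.coeFn_toLp] with x hx
    rw [hx]; exact_mod_cast le_max_right _ _
  · ext1
    filter_upwards [h1.coeFn_toLp, h2.coeFn_toLp, h3.coeFn_toLp, h4.coeFn_toLp,
      Lp.coeFn_add (h1.toLp - h2.toLp) (Complex.I • (h3.toLp - h4.toLp)),
      Lp.coeFn_sub h1.toLp h2.toLp, Lp.coeFn_sub h3.toLp h4.toLp,
      Lp.coeFn_smul Complex.I (h3.toLp - h4.toLp)] with x e1 e2 e3 e4 e5 e6 e7 e8
    have hmax : ∀ r : ℝ, max r 0 - max (-r) 0 = r := fun r => by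
      rcases le_total r 0 with h | h
      · rw [max_eq_right h, max_eq_left (by linarith)]; ring
      · rw [max_eq_left h, max_eq_right (by linarith)]; ring
    rw [e5, Pi.add_apply, e6, e8, Pi.sub_apply, Pi.smul_apply, e7, Pi.sub_apply, e1, e2, e3, e4,
      ← Complex.ofReal_sub, ← Complex.ofReal_sub, hmax, hmax, smul_eq_mul, mul_comm,
      Complex.re_add_im]

/-- For nonnegative values `|f + g| = |f| + |g|`, and `t ↦ t^p` is superadditive on `[0, ∞)` for `p
≥ 1`. -/
lemma norm_rpow_add_le_of_nonneg {p : ℝ≥0∞} [Fact (1 ≤ p)] (hp : p ≠ ⊤) {f g : Lp ℂ p μ}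
    (hf : ∀ᵐ x ∂μ, 0 ≤ f x) (hg : ∀ᵐ x ∂μ, 0 ≤ g x) :
    ‖f‖ ^ p.toReal + ‖g‖ ^ p.toReal ≤ ‖f + g‖ ^ p.toReal := by
  have hp0 : p ≠ 0 := (zero_lt_one.trans_le (Fact.out : 1 ≤ p)).ne'
  have hpr : 0 < p.toReal := ENNReal.toReal_pos hp0 hp
  have hp1 : 1 ≤ p.toReal := by
    rw [← ENNReal.toReal_one]
    exact ENNReal.toReal_mono hp Fact.out
  have key : ∀ h : Lp ℂ p μ, ‖h‖ₑ ^ p.toReal = ∫⁻ x, ‖h x‖ₑ ^ p.toReal ∂μ := fun h => by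
    rw [Lp.enorm_def, eLpNorm_eq_lintegral_rpow_enorm_toReal hp0 hp, ← ENNReal.rpow_mul,
      one_div_mul_cancel hpr.ne', ENNReal.rpow_one]
  have h1 : ‖f‖ₑ ^ p.toReal + ‖g‖ₑ ^ p.toReal ≤ ‖f + g‖ₑ ^ p.toReal := by
    rw [key, key, key, ← lintegral_add_left' ((Lp.aestronglyMeasurable f).enorm.pow_const _)]
    refine lintegral_mono_ae ?_
    filter_upwards [hf, hg, Lp.coeFn_add f g] with x h1 h2 h3
    rw [h3, Pi.add_apply]
    refine (ENNReal.add_rpow_le_rpow_add _ _ hp1).trans (ENNReal.rpow_le_rpow ?_ hpr.le)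
    rw [← ofReal_norm, ← ofReal_norm, ← ofReal_norm,
      ← ENNReal.ofReal_add (norm_nonneg _) (norm_nonneg _)]
    refine ENNReal.ofReal_le_ofReal (le_of_eq ?_)
    have hn : ∀ z : ℂ, 0 ≤ z → ‖z‖ = z.re := fun z hz => by
      rw [← Complex.re_eq_norm.2 hz]
    rw [hn _ h1, hn _ h2, hn _ (add_nonneg h1 h2), Complex.add_re]
  have key2 : ∀ h : Lp ℂ p μ, ‖h‖ₑ ^ p.toReal = ENNReal.ofReal (‖h‖ ^ p.toReal) := fun h => by
    rw [← ENNReal.ofReal_rpow_of_nonneg (norm_nonneg _) hpr.le, ofReal_norm]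
  rwa [key2, key2, key2, ← ENNReal.ofReal_add (by positivity) (by positivity),
    ENNReal.ofReal_le_ofReal_iff (by positivity)] at h1

/-- Increasing norm bounded sequences in `L^p` converge. -/
lemma exists_tendsto_of_monotone_of_bounded {p : ℝ≥0∞} [Fact (1 ≤ p)] (hp : p ≠ ⊤)
    {F : ℕ → Lp ℂ p μ} (h0 : ∀ n, ∀ᵐ x ∂μ, 0 ≤ F n x) (hF : ∀ n, ∀ᵐ x ∂μ, F n x ≤ F (n + 1) x)
    {C : ℝ} (hC : ∀ n, ‖F n‖ ≤ C) : ∃ f, Tendsto F atTop (𝓝 f) := by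
  have hp0 : p ≠ 0 := (zero_lt_one.trans_le (Fact.out : 1 ≤ p)).ne'
  have hpr : 0 < p.toReal := ENNReal.toReal_pos hp0 hp
  have hmono : ∀ m n, m ≤ n → ∀ᵐ x ∂μ, F m x ≤ F n x := by
    intro m n hmn
    induction n, hmn using Nat.le_induction with
    | base => exact Eventually.of_forall fun _ => le_rfl
    | succ n _ ih => filter_upwards [ih, hF n] with x h1 h2 using h1.trans h2
  -- Superadditivity for `F n = (F n - F m) + F m`. It reduces the Cauchy property to convergence of
  -- the bounded increasing real sequence `‖F n‖^p`.
  have hdiff : ∀ m n, m ≤ n →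
      ‖F n - F m‖ ^ p.toReal ≤ ‖F n‖ ^ p.toReal - ‖F m‖ ^ p.toReal := by
    intro m n hmn
    have h := norm_rpow_add_le_of_nonneg hp (ae_le_iff_ae_nonneg_sub.1 (hmono m n hmn)) (h0 m)
    rw [sub_add_cancel] at h
    linarith
  have hconv : ∃ l, Tendsto (fun n => ‖F n‖ ^ p.toReal) atTop (𝓝 l) := by
    refine ⟨_, tendsto_atTop_ciSup (f := fun n => ‖F n‖ ^ p.toReal) ?_ ?_⟩
    · intro m n hmn
      have := hdiff m n hmn
      have h2 : 0 ≤ ‖F n - F m‖ ^ p.toReal := by positivity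
      simp only
      linarith
    · refine ⟨C ^ p.toReal, ?_⟩
      rintro _ ⟨n, rfl⟩
      exact Real.rpow_le_rpow (norm_nonneg _) (hC n) hpr.le
  obtain ⟨l, hl⟩ := hconv
  refine cauchySeq_tendsto_of_complete (Metric.cauchySeq_iff'.2 fun ε hε => ?_)
  obtain ⟨n₀, hn₀⟩ := Metric.cauchySeq_iff'.1 hl.cauchySeq (ε ^ p.toReal) (by positivity)
  refine ⟨n₀, fun n hn => ?_⟩
  rw [dist_eq_norm]
  have h1 := (le_abs_self _).trans_lt (hn₀ n hn)
  exact (Real.rpow_lt_rpow_iff (norm_nonneg _) hε.le hpr).1 ((hdiff n₀ n hn).trans_lt h1)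

end LpTools

/-! ### Transfer between `L²` and `L^p` for `2 ≤ p < ∞` -/

section Extension

variable {N : ℕ} {p : ℝ≥0∞} [Fact (1 ≤ p)]

/-- Restrict `g` to the ball of radius `k`: on a set of finite measure `L^p ⊆ L²` because `p ≥ 2`,
and the restrictions converge by domination. Truncation also preserves nonnegativity, which is what
lets positivity transfer. -/
lemma exists_truncation (hp2 : 2 ≤ p) (hp : p ≠ ⊤) (g : LpRN N p) :
    ∃ (f : ℕ → LpRN N 2) (h : ℕ → LpRN N p), (∀ k, f k =ᵐ[volume] h k) ∧
      Tendsto h atTop (𝓝 g) ∧ ((∀ᵐ x, 0 ≤ g x) → ∀ k, ∀ᵐ x, 0 ≤ h k x) := by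
  let s : ℕ → Set (EuclideanSpace ℝ (Fin N)) := fun k => Metric.ball 0 k
  have hs : ∀ k, MeasurableSet (s k) := fun k => measurableSet_ball
  have h1 : ∀ k, MemLp ((s k).indicator g) p volume := fun k => (Lp.memLp g).indicator (hs k)
  have h2 : ∀ k, MemLp ((s k).indicator g) 2 volume := fun k => by
    rw [memLp_indicator_iff_restrict (hs k)]
    have : IsFiniteMeasure (volume.restrict (s k)) :=
      ⟨by rw [Measure.restrict_apply_univ]; exact measure_ball_lt_top⟩
    exact ((Lp.memLp g).restrict (s k)).mono_exponent hp2
  refine ⟨fun k => (h2 k).toLp, fun k => (h1 k).toLp,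
    fun k => (h2 k).coeFn_toLp.trans (h1 k).coeFn_toLp.symm, ?_, ?_⟩
  · refine tendsto_toLp_of_dominated hp (fun k => ?_) ?_
    · filter_upwards [(h1 k).coeFn_toLp] with x hx
      rw [hx]
      exact norm_indicator_le_norm_self _ _
    · have hall : ∀ᵐ x, ∀ k, (h1 k).toLp _ x = (s k).indicator g x :=
        ae_all_iff.2 fun k => (h1 k).coeFn_toLp
      filter_upwards [hall] with x hx
      refine tendsto_const_nhds.congr' ?_
      obtain ⟨k₀, hk₀⟩ := exists_nat_gt ‖x‖
      filter_upwards [eventually_ge_atTop k₀] with k hk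
      rw [hx, Set.indicator_of_mem]
      have : (k₀ : ℝ) ≤ k := by exact_mod_cast hk
      simp only [s, mem_ball_zero_iff]
      linarith
  · intro hg k
    filter_upwards [(h1 k).coeFn_toLp, hg] with x hx hx'
    rw [hx]
    by_cases hxs : x ∈ s k
    · rwa [Set.indicator_of_mem hxs]
    · rw [Set.indicator_of_notMem hxs]

lemma denseRange_of_consistent (hp2 : 2 ≤ p) (hp : p ≠ ⊤) :
    Dense {g : LpRN N p | ∃ f : LpRN N 2, f =ᵐ[volume] g} := by
  intro g
  obtain ⟨f, h, hfh, hlim, -⟩ := exists_truncation hp2 hp g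
  exact mem_closure_of_tendsto hlim (Eventually.of_forall fun k => ⟨f k, hfh k⟩)

/-- Functions common to `L²` and `L^p` are dense in `L^p`, so a bounded extension is unique.
Operator identities proved on `L²` are moved to `L^p` through this. -/
lemma eq_of_consistent (hp2 : 2 ≤ p) (hp : p ≠ ⊤) {A : LpRN N 2 →L[ℂ] LpRN N 2}
    {B B' : LpRN N p →L[ℂ] LpRN N p} (h : AreConsistent A B) (h' : AreConsistent A B') :
    B = B' := by
  refine ContinuousLinearMap.coeFn_injective
    (Continuous.ext_on (denseRange_of_consistent hp2 hp) B.continuous B'.continuous ?_)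
  rintro g ⟨f, hfg⟩
  ext1
  exact (h f g hfg).symm.trans (h' f g hfg)

lemma IsPositiveOp.of_consistent (hp2 : 2 ≤ p) (hp : p ≠ ⊤) {A : LpRN N 2 →L[ℂ] LpRN N 2}
    {B : LpRN N p →L[ℂ] LpRN N p} (hA : IsPositiveOp A) (h : AreConsistent A B) :
    IsPositiveOp B := by
  intro g hg
  obtain ⟨f, k, hfk, hlim, hpos⟩ := exists_truncation hp2 hp g
  refine ae_nonneg_of_tendsto ((B.continuous.tendsto g).comp hlim) fun n => ?_
  have h1 : ∀ᵐ x, 0 ≤ f n x := by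
    filter_upwards [hfk n, hpos hg n] with x h1 h2
    rwa [h1]
  filter_upwards [h _ _ (hfk n), hA _ h1] with x h2 h3
  rw [Function.comp_apply, ← h2]
  exact h3

/-- Extension to `L^p` of an operator on `L²` that is bounded for the `L^p` norm. -/
theorem exists_consistent_extension (hp2 : 2 ≤ p) (hp : p ≠ ⊤) (A : LpRN N 2 →L[ℂ] LpRN N 2)
    {C : ℝ} (hC : 0 ≤ C) (hA : ∀ f : LpRN N 2, MemLp f p volume →
      eLpNorm (A f) p volume ≤ ENNReal.ofReal C * eLpNorm f p volume) :
    ∃ B : LpRN N p →L[ℂ] LpRN N p, ‖B‖ ≤ C ∧ AreConsistent A B := by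
  have hmem : ∀ f : LpRN N 2, MemLp f p volume → MemLp (A f) p volume := fun f hf =>
    ⟨Lp.aestronglyMeasurable _,
      (hA f hf).trans_lt (ENNReal.mul_lt_top ENNReal.ofReal_lt_top hf.eLpNorm_lt_top)⟩
  -- `V` is `L² ∩ L^p` inside `L²` and `J` its embedding into `L^p`. The hypothesis bounds `J ∘ A'`
  -- by the norm of `J f`, so it extends along the dense range of `J`.
  let V : Submodule ℂ (LpRN N 2) :=
    { carrier := {f | MemLp f p volume}
      add_mem' := fun {f g} hf hg => (memLp_congr_ae (Lp.coeFn_add f g)).2 (hf.add hg)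
      zero_mem' := (memLp_congr_ae (Lp.coeFn_zero ℂ 2 volume)).2 MemLp.zero'
      smul_mem' := fun c f hf => (memLp_congr_ae (Lp.coeFn_smul c f)).2 (hf.const_smul c) }
  have hV : ∀ f : V, MemLp (f : LpRN N 2) p volume := fun f => f.2
  let J : V →ₗ[ℂ] LpRN N p :=
    { toFun := fun f => (hV f).toLp
      map_add' := fun f g => by
        ext1
        filter_upwards [(hV (f + g)).coeFn_toLp, (hV f).coeFn_toLp, (hV g).coeFn_toLp,
          Lp.coeFn_add (hV f).toLp (hV g).toLp, Lp.coeFn_add (f : LpRN N 2) g]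
          with x h1 h2 h3 h4 h5
        rw [h1, h4, Pi.add_apply, h2, h3, Submodule.coe_add, h5, Pi.add_apply]
      map_smul' := fun c f => by
        ext1
        filter_upwards [(hV (c • f)).coeFn_toLp, (hV f).coeFn_toLp,
          Lp.coeFn_smul c (hV f).toLp, Lp.coeFn_smul c (f : LpRN N 2)] with x h1 h2 h3 h4
        rw [h1, RingHom.id_apply, h3, Pi.smul_apply, h2, Submodule.coe_smul, h4, Pi.smul_apply] }
  have hJ : ∀ f : V, J f =ᵐ[volume] (f : LpRN N 2) := fun f => (hV f).coeFn_toLp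
  let A' : V →ₗ[ℂ] V := (A : LpRN N 2 →ₗ[ℂ] LpRN N 2).restrict hmem
  have hnorm : ∀ f : V, ‖(J ∘ₗ A') f‖ ≤ C * ‖J f‖ := by
    intro f
    change ‖J (A' f)‖ ≤ _
    rw [Lp.norm_def, Lp.norm_def, eLpNorm_congr_ae (hJ f), eLpNorm_congr_ae (hJ (A' f)),
      ← ENNReal.toReal_ofReal hC, ← ENNReal.toReal_mul]
    exact ENNReal.toReal_mono
      (ENNReal.mul_ne_top ENNReal.ofReal_ne_top (hV f).eLpNorm_ne_top) (hA f (hV f))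
  have hdense : DenseRange J := by
    refine (denseRange_of_consistent hp2 hp).mono ?_
    rintro g ⟨f, hfg⟩
    have hf : MemLp f p volume := (memLp_congr_ae hfg).2 (Lp.memLp g)
    refine ⟨⟨f, hf⟩, ?_⟩
    ext1
    exact (hJ ⟨f, hf⟩).trans hfg
  refine ⟨(J ∘ₗ A').extendOfNorm J, ContinuousLinearMap.opNorm_le_bound _ hC fun x =>
    LinearMap.norm_extendOfNorm_apply_le hdense C hnorm x, ?_⟩
  intro f g hfg
  have hf : MemLp f p volume := (memLp_congr_ae hfg).2 (Lp.memLp g)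
  have hg : g = J ⟨f, hf⟩ := by
    ext1
    exact (hfg.symm.trans (hJ ⟨f, hf⟩).symm)
  rw [hg, LinearMap.extendOfNorm_eq hdense ⟨C, hnorm⟩]
  exact (hJ (A' ⟨f, hf⟩)).symm

end Extension

/-! ### Density of test functions supported away from the origin -/

section Density

variable {N : ℕ} {p : ℝ≥0∞} [Fact (1 ≤ p)]

/-- A smooth function vanishing near the origin and equal to `1` away from it. -/
lemma exists_smooth_cutoff (N : ℕ) : ∃ ψ : ℕ → EuclideanSpace ℝ (Fin N) → ℝ,
    (∀ k, ContDiff ℝ ∞ (ψ k)) ∧ (∀ k x, 0 ≤ ψ k x ∧ ψ k x ≤ 1) ∧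
    (∀ k, ψ k =ᶠ[𝓝 0] 0) ∧ ∀ x, x ≠ 0 → ∀ᶠ k in atTop, ψ k x = 1 := by
  let B : ∀ k : ℕ, ContDiffBump (0 : EuclideanSpace ℝ (Fin N)) := fun k =>
    ⟨1 / (k + 1), 2 / (k + 1), by positivity, by gcongr; norm_num⟩
  refine ⟨fun k x => 1 - B k x, fun k => contDiff_const.sub (B k).contDiff,
    fun k x => ⟨by linarith [(B k).le_one (x := x)], by linarith [(B k).nonneg (x := x)]⟩,
    fun k => ?_, fun x hx => ?_⟩
  · filter_upwards [(B k).eventuallyEq_one] with x hx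
    simp [hx]
  · have h0 : Tendsto (fun k : ℕ => 2 / ((k : ℝ) + 1)) atTop (𝓝 0) :=
      tendsto_const_nhds.div_atTop
        (tendsto_atTop_add_const_right _ _ tendsto_natCast_atTop_atTop)
    filter_upwards [h0.eventually_lt_const (norm_pos_iff.2 hx)] with k hk
    have : B k x = 0 := (B k).zero_of_le_dist (by simpa [B] using hk.le)
    simp [this]

lemma IsTestAwayFromZero.memLp {u : EuclideanSpace ℝ (Fin N) → ℂ} (hu : IsTestAwayFromZero u)
    (q : ℝ≥0∞) : MemLp u q volume :=
  hu.1.continuous.memLp_of_hasCompactSupport hu.2.1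

/-- Cutting off near the origin costs nothing in the limit: the cutoffs tend to `1` off the origin,
which is a null set when `N > 0`. -/
lemma dense_isTestAwayFromZero (hN : 0 < N) (hp : p ≠ ⊤) :
    Dense {f : LpRN N p | ∃ u, IsTestAwayFromZero u ∧ f =ᵐ[volume] u} := by
  have hd := Lp.dense_hasCompactSupport_contDiff (E := EuclideanSpace ℝ (Fin N)) (F := ℂ)
    (μ := volume) hp
  rw [← dense_closure]
  refine hd.mono ?_
  rintro g ⟨φ, hgφ, hφc, hφ⟩
  obtain ⟨ψ, hψ, hψb, hψ0, hψ1⟩ := exists_smooth_cutoff N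
  have htest : ∀ k, IsTestAwayFromZero (fun x => ψ k x • φ x) := fun k => by
    refine ⟨(hψ k).smul hφ, HasCompactSupport.smul_left (f := ψ k) hφc, ?_⟩
    rw [notMem_tsupport_iff_eventuallyEq]
    filter_upwards [hψ0 k] with x hx
    simp [hx]
  refine mem_closure_of_tendsto (b := atTop) (f := fun k => ((htest k).memLp p).toLp) ?_
    (Eventually.of_forall fun k => ⟨_, htest k, ((htest k).memLp p).coeFn_toLp⟩)
  refine tendsto_toLp_of_dominated hp (fun k => ?_) ?_
  · filter_upwards [((htest k).memLp p).coeFn_toLp, hgφ] with x h1 h2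
    rw [h1, h2, norm_smul, Real.norm_of_nonneg (hψb k x).1]
    exact mul_le_of_le_one_left (norm_nonneg _) (hψb k x).2
  · have hall : ∀ᵐ x, ∀ k, ((htest k).memLp p).toLp _ x = ψ k x • φ x :=
      ae_all_iff.2 fun k => ((htest k).memLp p).coeFn_toLp
    have : Nontrivial (EuclideanSpace ℝ (Fin N)) := by
      have : Nonempty (Fin N) := ⟨⟨0, hN⟩⟩
      infer_instance
    have hne : ∀ᵐ x : EuclideanSpace ℝ (Fin N), x ≠ 0 := by
      simp [ae_iff]
    filter_upwards [hall, hgφ, hne] with x h1 h2 h3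
    refine tendsto_const_nhds.congr' ?_
    filter_upwards [hψ1 x h3] with k hk
    rw [h1, hk, one_smul, h2]

end Density

/-! ### Translations as a strongly continuous unitary group on `L²` -/

section Translation

variable {N : ℕ}

local notation "𝔼" => EuclideanSpace ℝ (Fin N)

/-- The translation `u ↦ u (· + a)` on `L²`. -/
noncomputable def translateLp (a : EuclideanSpace ℝ (Fin N)) : LpRN N 2 →ₗᵢ[ℂ] LpRN N 2 :=
  Lp.compMeasurePreservingₗᵢ ℂ (fun x => x + a) (measurePreserving_add_right volume a)

lemma translateLp_coeFn (a : 𝔼) (u : LpRN N 2) : translateLp a u =ᵐ[volume] fun x => u (x + a) :=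
  Lp.coeFn_compMeasurePreserving u (measurePreserving_add_right volume a)

lemma translateLp_translateLp (a b : 𝔼) (u : LpRN N 2) :
    translateLp a (translateLp b u) = translateLp (a + b) u := by
  ext1
  have h1 := (measurePreserving_add_right (volume : Measure 𝔼) a).quasiMeasurePreserving.ae_eq_comp
    (translateLp_coeFn b u)
  filter_upwards [translateLp_coeFn a (translateLp b u), translateLp_coeFn (a + b) u, h1] with x h2 h3 h4
  rw [h2, h3, ← add_assoc]
  exact h4

lemma translateLp_zero (u : LpRN N 2) : translateLp (0 : 𝔼) u = u := by
  ext1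
  filter_upwards [translateLp_coeFn 0 u] with x hx
  rw [hx, add_zero]

lemma continuous_translateLp (e : 𝔼) (u : LpRN N 2) :
    Continuous fun t : ℝ => translateLp (t • e) u := by
  let g : C(ℝ, C(𝔼, 𝔼)) := (ContinuousMap.mk (fun a : ℝ × 𝔼 => a.2 + a.1 • e) (by fun_prop)).curry
  exact (continuous_const (y := u)).compMeasurePreservingLp g.continuous
    (fun t => measurePreserving_add_right volume (t • e)) (by simp)

lemma inner_translateLp_left (a : 𝔼) (u v : LpRN N 2) :
    inner ℂ (translateLp a u) v = inner ℂ u (translateLp (-a) v) := by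
  conv_lhs => rw [← translateLp_zero v, ← add_neg_cancel a, ← translateLp_translateLp]
  exact (translateLp a).inner_map_map u (translateLp (-a) v)

end Translation

/-! ### Weak gradients through difference quotients -/

section WeakGradient

variable {N : ℕ}

local notation "𝔼" => EuclideanSpace ℝ (Fin N)

lemma integrable_smul_of_hasCompactSupport {φ : 𝔼 → ℝ} (hφ : Continuous φ)
    (hc : HasCompactSupport φ) (u : LpRN N 2) : Integrable fun x => φ x • u x := by
  have h1 : MemLp φ 2 (volume : Measure 𝔼) := hφ.memLp_of_hasCompactSupport hc
  exact memLp_one_iff_integrable.1 ((Lp.memLp u).smul h1)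

/-- The class in `L²` of a continuous real function with compact support. -/
noncomputable def testLp (φ : 𝔼 → ℝ) (hφ : Continuous φ) (hc : HasCompactSupport φ) : LpRN N 2 :=
  ((Complex.continuous_ofReal.comp hφ).memLp_of_hasCompactSupport
    (p := 2) (μ := volume) (hc.comp_left Complex.ofReal_zero)).toLp

lemma testLp_coeFn {φ : 𝔼 → ℝ} (hφ : Continuous φ) (hc : HasCompactSupport φ) :
    testLp φ hφ hc =ᵐ[volume] fun x => (φ x : ℂ) :=
  MemLp.coeFn_toLp _

lemma inner_testLp {φ : 𝔼 → ℝ} (hφ : Continuous φ) (hc : HasCompactSupport φ) (u : LpRN N 2) :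
    inner ℂ (testLp φ hφ hc) u = ∫ x, φ x • u x := by
  rw [L2.inner_def]
  refine integral_congr_ae ?_
  filter_upwards [testLp_coeFn hφ hc] with x hx
  rw [hx, RCLike.inner_apply, Complex.conj_ofReal, mul_comm, Complex.real_smul]

lemma hasCompactSupport_sub {φ : 𝔼 → ℝ} (hc : HasCompactSupport φ) (a : 𝔼) :
    HasCompactSupport fun x => φ (x - a) := by
  have := hc.comp_homeomorph (Homeomorph.subRight a)
  exact this

lemma translateLp_neg_testLp {φ : 𝔼 → ℝ} (hφ : Continuous φ) (hc : HasCompactSupport φ) (a : 𝔼) :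
    translateLp (-a) (testLp φ hφ hc) =
      testLp (fun x => φ (x - a)) (by fun_prop) (hasCompactSupport_sub hc a) := by
  ext1
  have h1 := (measurePreserving_add_right (volume : Measure 𝔼) (-a)).quasiMeasurePreserving.ae_eq_comp
    (testLp_coeFn hφ hc)
  filter_upwards [translateLp_coeFn (-a) (testLp φ hφ hc), h1,
    testLp_coeFn (φ := fun x => φ (x - a)) (by fun_prop) (hasCompactSupport_sub hc a)]
    with x h2 h3 h4
  rw [h2, h4, sub_eq_add_neg]
  exact h3

lemma hasCompactSupport_fderiv_apply {φ : 𝔼 → ℝ} (hc : HasCompactSupport φ) (e : 𝔼) :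
    HasCompactSupport fun x => fderiv ℝ φ x e :=
  hc.fderiv_apply ℝ e

lemma continuous_fderiv_apply {φ : 𝔼 → ℝ} (hφ : ContDiff ℝ ∞ φ) (e : 𝔼) :
    Continuous fun x => fderiv ℝ φ x e :=
  (hφ.continuous_fderiv (by simp)).clm_apply continuous_const

lemma fderiv_comp_sub_apply (φ : 𝔼 → ℝ) (a e x : 𝔼) :
    fderiv ℝ (fun y => φ (y - a)) x e = fderiv ℝ φ (x - a) e := by
  simp [sub_eq_add_neg, fderiv_comp_add_right]

lemma hasDerivAt_integral_translate {φ : 𝔼 → ℝ} (hφ : ContDiff ℝ ∞ φ) (hc : HasCompactSupport φ)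
    (e : 𝔼) (u : LpRN N 2) (t : ℝ) :
    HasDerivAt (fun t : ℝ => ∫ x, φ (x - t • e) • u x)
      (-∫ x, fderiv ℝ φ (x - t • e) e • u x) t := by
  obtain ⟨C, hC⟩ := (continuous_fderiv_apply hφ e).bounded_above_of_compact_support
    (hasCompactSupport_fderiv_apply hc e)
  obtain ⟨r, hr⟩ := (hasCompactSupport_fderiv_apply hc e).isCompact.isBounded.subset_closedBall 0
  -- `K` contains the supports of all translates with `|s - t| < 1`. On this set of finite measure
  -- `u` is integrable, which supplies the dominating function.
  let K : Set 𝔼 := Metric.closedBall 0 (r + (|t| + 1) * ‖e‖)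
  have hmeas : ∀ s : ℝ, AEStronglyMeasurable (fun x => φ (x - s • e) • u x) volume := fun s =>
    ((hφ.continuous.comp (by fun_prop : Continuous fun x : 𝔼 =>
      x - s • e)).aestronglyMeasurable).smul (Lp.aestronglyMeasurable u)
  have hint : Integrable (K.indicator fun x => C * ‖u x‖) volume := by
    rw [integrable_indicator_iff measurableSet_closedBall]
    have : IsFiniteMeasure (volume.restrict K) :=
      ⟨by rw [Measure.restrict_apply_univ]; exact measure_closedBall_lt_top⟩
    exact (((Lp.memLp u).restrict K).integrable (by norm_num)).norm.const_mul C
  have h := hasDerivAt_integral_of_dominated_loc_of_deriv_le (μ := (volume : Measure 𝔼))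
    (F := fun (s : ℝ) x => φ (x - s • e) • u x)
    (F' := fun (s : ℝ) x => -(fderiv ℝ φ (x - s • e) e • u x))
    (x₀ := t) (s := Metric.ball t 1) (bound := K.indicator fun x => C * ‖u x‖)
    (Metric.ball_mem_nhds t one_pos) (Eventually.of_forall hmeas)
    (integrable_smul_of_hasCompactSupport (hφ.continuous.comp (by fun_prop))
      (hasCompactSupport_sub hc _) u)
    ((((continuous_fderiv_apply hφ e).comp (by fun_prop : Continuous fun x : 𝔼 =>
      x - t • e)).aestronglyMeasurable).smul (Lp.aestronglyMeasurable u)).neg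
    (Eventually.of_forall fun x s hs => ?_) hint (Eventually.of_forall fun x s hs => ?_)
  · rw [← integral_neg]
    exact h.2
  · rw [norm_neg, norm_smul]
    by_cases hx : x ∈ K
    · rw [Set.indicator_of_mem hx]
      exact mul_le_mul_of_nonneg_right (hC _) (norm_nonneg _)
    · rw [Set.indicator_of_notMem hx]
      have : fderiv ℝ φ (x - s • e) e = 0 := by
        by_contra h0
        have h1 : x - s • e ∈ Metric.closedBall (0 : 𝔼) r := hr (subset_closure h0)
        apply hx
        simp only [K, mem_closedBall_zero_iff] at h1 ⊢
        have h2 : ‖x‖ ≤ ‖x - s • e‖ + ‖s • e‖ := by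
          simpa using norm_add_le (x - s • e) (s • e)
        have h3 : |s| ≤ |t| + 1 := by
          have h4 := (abs_sub_abs_le_abs_sub s t)
          rw [Metric.mem_ball, Real.dist_eq] at hs
          linarith
        rw [norm_smul, Real.norm_eq_abs] at h2
        have := mul_le_mul_of_nonneg_right h3 (norm_nonneg e)
        linarith
      simp [this]
  · have h1 : HasDerivAt (fun s : ℝ => x - s • e) (-e) s := by
      simpa using ((hasDerivAt_id s).smul_const e).const_sub x
    have h2 := ((hφ.differentiable (by simp)) (x - s • e)).hasFDerivAt.comp_hasDerivAt s h1
    have h3 := h2.smul_const (u x)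
    simpa using h3

/-- The translation is moved onto the smooth test function, where differentiation is classical; the
definition of the weak gradient is then applied to the translated test function. -/
lemma IsWeakGradient.hasDerivAt_inner {u : LpRN N 2} {G : Fin N → LpRN N 2}
    (h : IsWeakGradient u G) (i : Fin N) {φ : 𝔼 → ℝ} (hφ : ContDiff ℝ ∞ φ)
    (hc : HasCompactSupport φ) (t : ℝ) :
    HasDerivAt
      (fun t : ℝ => inner ℂ (testLp φ hφ.continuous hc)
        (translateLp (t • EuclideanSpace.single i 1) u))
      (inner ℂ (testLp φ hφ.continuous hc) (translateLp (t • EuclideanSpace.single i 1) (G i))) t := by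
  set e : 𝔼 := EuclideanSpace.single i 1
  have key : ∀ (v : LpRN N 2) (s : ℝ), inner ℂ (testLp φ hφ.continuous hc) (translateLp (s • e) v)
      = ∫ x, φ (x - s • e) • v x := by
    intro v s
    have := inner_translateLp_left (-(s • e)) (testLp φ hφ.continuous hc) v
    rw [neg_neg] at this
    rw [← this, translateLp_neg_testLp, inner_testLp]
  simp_rw [key]
  have h1 := hasDerivAt_integral_translate hφ hc e u t
  have h2 := h i (fun x => φ (x - t • e)) (hφ.comp (by fun_prop)) (hasCompactSupport_sub hc _)
  simp_rw [fderiv_comp_sub_apply] at h2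
  rwa [h2, neg_neg] at h1

/-- A bound against all real test functions bounds the norm. -/
lemma norm_le_of_forall_inner_testLp_le {z : LpRN N 2} {M : ℝ} (hM : 0 ≤ M)
    (h : ∀ (φ : 𝔼 → ℝ) (hφ : ContDiff ℝ ∞ φ) (hc : HasCompactSupport φ),
      ‖inner ℂ (testLp φ hφ.continuous hc) z‖ ≤ M * ‖testLp φ hφ.continuous hc‖) :
    ‖z‖ ≤ 2 * M := by
  have hd := Lp.dense_hasCompactSupport_contDiff (E := 𝔼) (F := ℂ) (μ := volume) (p := 2) (by simp)
  have hclosed : IsClosed {g : LpRN N 2 | ‖inner ℂ g z‖ ≤ 2 * M * ‖g‖} :=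
    isClosed_le (by fun_prop) (by fun_prop)
  have hall : ∀ g : LpRN N 2, ‖inner ℂ g z‖ ≤ 2 * M * ‖g‖ := by
    intro g
    refine (hclosed.closure_subset_iff.2 ?_) (hd g)
    rintro f ⟨φ, hfφ, hφc, hφ⟩
    have hre : ContDiff ℝ ∞ fun x => (φ x).re := Complex.reCLM.contDiff.comp hφ
    have him : ContDiff ℝ ∞ fun x => (φ x).im := Complex.imCLM.contDiff.comp hφ
    have hrec : HasCompactSupport fun x => (φ x).re := hφc.comp_left Complex.zero_re
    have himc : HasCompactSupport fun x => (φ x).im := hφc.comp_left Complex.zero_im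
    have hf : f = testLp _ hre.continuous hrec + Complex.I • testLp _ him.continuous himc := by
      ext1
      filter_upwards [hfφ, testLp_coeFn hre.continuous hrec, testLp_coeFn him.continuous himc,
        Lp.coeFn_add (testLp _ hre.continuous hrec) (Complex.I • testLp _ him.continuous himc),
        Lp.coeFn_smul Complex.I (testLp _ him.continuous himc)] with x h1 h2 h3 h4 h5
      rw [h1, h4, Pi.add_apply, h5, Pi.smul_apply, h2, h3, smul_eq_mul, mul_comm,
        Complex.re_add_im]
    have hnre : ‖testLp _ hre.continuous hrec‖ ≤ ‖f‖ := by
      refine Lp.norm_le_norm_of_ae_le ?_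
      filter_upwards [hfφ, testLp_coeFn hre.continuous hrec] with x h1 h2
      rw [h1, h2, Complex.norm_real]
      exact Complex.abs_re_le_norm _
    have hnim : ‖testLp _ him.continuous himc‖ ≤ ‖f‖ := by
      refine Lp.norm_le_norm_of_ae_le ?_
      filter_upwards [hfφ, testLp_coeFn him.continuous himc] with x h1 h2
      rw [h1, h2, Complex.norm_real]
      exact Complex.abs_im_le_norm _
    have h1 := h _ hre hrec
    have h2 := h _ him himc
    have h3 : ‖inner ℂ f z‖ ≤ ‖inner ℂ (testLp _ hre.continuous hrec) z‖
        + ‖inner ℂ (testLp _ him.continuous himc) z‖ := by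
      conv_lhs => rw [hf]
      rw [inner_add_left, inner_smul_left]
      refine (norm_add_le _ _).trans ?_
      simp
    have h4 := mul_le_mul_of_nonneg_left hnre hM
    have h5 := mul_le_mul_of_nonneg_left hnim hM
    change ‖inner ℂ f z‖ ≤ 2 * M * ‖f‖
    linarith
  have h1 := hall z
  rw [inner_self_eq_norm_sq_to_K, norm_pow, RCLike.norm_ofReal, abs_norm] at h1
  by_contra h2
  push Not at h2
  nlinarith [norm_nonneg z]

/-- Difference quotients of an `H¹` function converge to the weak derivative. -/
theorem IsWeakGradient.tendsto_quotient {u : LpRN N 2} {G : Fin N → LpRN N 2}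
    (h : IsWeakGradient u G) (i : Fin N) :
    Tendsto (fun t : ℝ => ((t⁻¹ : ℝ) : ℂ) •
      (translateLp (t • EuclideanSpace.single i 1) u - u)) (𝓝[>] 0) (𝓝 (G i)) := by
  set e : 𝔼 := EuclideanSpace.single i 1
  rw [Metric.tendsto_nhds]
  intro ε hε
  have h0 : Tendsto (fun s : ℝ => translateLp (s • e) (G i)) (𝓝 0) (𝓝 (G i)) := by
    have := (continuous_translateLp e (G i)).tendsto 0
    rwa [zero_smul, translateLp_zero] at this
  obtain ⟨δ, hδ, hδ'⟩ := Metric.eventually_nhds_iff.1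
    (Metric.tendsto_nhds.1 h0 (ε / 4) (by linarith))
  filter_upwards [Ioo_mem_nhdsGT hδ] with t ht
  -- For each test function, `s ↦ ⟨φ', τ_s u⟩ - s⟨φ', G i⟩` has derivative at most `‖φ'‖ ε/4` on
  -- `[0, t]`, with `t` chosen independently of the test function. Duality converts this into a norm
  -- bound; the factor `2` pays for testing with real functions only.
  have key : ‖translateLp (t • e) u - u - (t : ℂ) • G i‖ ≤ 2 * (ε / 4 * t) := by
    refine norm_le_of_forall_inner_testLp_le (mul_nonneg (by linarith) ht.1.le) fun φ hφ hc => ?_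
    set φ' := testLp φ hφ.continuous hc
    have hd : ∀ s : ℝ, HasDerivAt
        (fun s : ℝ => inner ℂ φ' (translateLp (s • e) u) - (s : ℂ) * inner ℂ φ' (G i))
        (inner ℂ φ' (translateLp (s • e) (G i)) - inner ℂ φ' (G i)) s := fun s => by
      have h1 := (h.hasDerivAt_inner i hφ hc s)
      have h2 : HasDerivAt (fun s : ℝ => (s : ℂ) * inner ℂ φ' (G i)) (inner ℂ φ' (G i)) s := by
        simpa using (Complex.ofRealCLM.hasDerivAt (x := s)).mul_const (inner ℂ φ' (G i))
      exact h1.sub h2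
    have h1 := norm_image_sub_le_of_norm_deriv_le_segment' (a := 0) (b := t)
      (C := ‖φ'‖ * (ε / 4)) (fun s _ => (hd s).hasDerivWithinAt) (fun s hs => ?_) t
      ⟨ht.1.le, le_rfl⟩
    · simp only [zero_smul, translateLp_zero, Complex.ofReal_zero, zero_mul, sub_zero] at h1
      rw [inner_sub_right, inner_sub_right, inner_smul_right, sub_right_comm]
      exact h1.trans (le_of_eq (by ring))
    · rw [← inner_sub_right]
      refine (norm_inner_le_norm _ _).trans ?_
      refine mul_le_mul_of_nonneg_left ?_ (norm_nonneg _)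
      rw [← dist_eq_norm]
      refine (hδ' ?_).le
      rw [Real.dist_eq, sub_zero, abs_of_nonneg hs.1]
      exact hs.2.trans ht.2
  have ht0 : (t : ℂ) ≠ 0 := by exact_mod_cast ht.1.ne'
  have h2 : ((t⁻¹ : ℝ) : ℂ) • (translateLp (t • e) u - u) - G i
      = ((t⁻¹ : ℝ) : ℂ) • (translateLp (t • e) u - u - (t : ℂ) • G i) := by
    rw [smul_sub _ (translateLp (t • e) u - u), smul_smul, Complex.ofReal_inv,
      inv_mul_cancel₀ ht0, one_smul]
  rw [dist_eq_norm, h2, norm_smul, Complex.norm_real, norm_inv, Real.norm_of_nonneg ht.1.le,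
    inv_mul_lt_iff₀ ht.1]
  nlinarith [ht.1]

/-- The pairing of a translate with a test function is differentiable at `0`, so weak convergence of
the quotients along a single sequence `t k ↓ 0` in each direction already identifies the derivative.
-/
lemma IsWeakGradient.of_tendsto {v : LpRN N 2} {H : Fin N → LpRN N 2}
    (h : ∀ i, ∃ t : ℕ → ℝ, Tendsto t atTop (𝓝[>] 0) ∧
      ∀ (φ : 𝔼 → ℝ) (hφ : ContDiff ℝ ∞ φ) (hc : HasCompactSupport φ),
      Tendsto (fun k => inner ℂ (testLp φ hφ.continuous hc) ((((t k)⁻¹ : ℝ) : ℂ) •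
        (translateLp (t k • EuclideanSpace.single i 1) v - v))) atTop
        (𝓝 (inner ℂ (testLp φ hφ.continuous hc) (H i)))) : IsWeakGradient v H := by
  intro i φ hφ hc
  obtain ⟨t, ht, hlim⟩ := h i
  set e : 𝔼 := EuclideanSpace.single i 1
  have h1 := (hasDerivAt_integral_translate hφ hc e v 0).hasDerivWithinAt (s := Set.Ioi 0)
  rw [hasDerivWithinAt_iff_tendsto_slope' (by simp)] at h1
  have h2 := h1.comp ht
  have h3 : -∫ x, fderiv ℝ φ (x - (0 : ℝ) • e) e • v x
      = inner ℂ (testLp φ hφ.continuous hc) (H i) := by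
    refine tendsto_nhds_unique h2 ((hlim φ hφ hc).congr fun k => ?_)
    have h4 := inner_translateLp_left (-(t k • e)) (testLp φ hφ.continuous hc) v
    rw [neg_neg, translateLp_neg_testLp, inner_testLp] at h4
    rw [inner_smul_right, inner_sub_right, ← h4, inner_testLp, Function.comp_apply,
      slope_def_module, sub_zero, zero_smul]
    simp
  rw [inner_testLp] at h3
  simp only [zero_smul, sub_zero] at h3
  rw [← h3, neg_neg]

/-- Integration by parts for two `H¹` functions. -/
theorem IsWeakGradient.inner_eq_neg {u v : LpRN N 2} {G H : Fin N → LpRN N 2}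
    (hu : IsWeakGradient u G) (hv : IsWeakGradient v H) (i : Fin N) :
    inner ℂ (G i) v = -inner ℂ u (H i) := by
  set e : 𝔼 := EuclideanSpace.single i 1
  have h1 := (hu.tendsto_quotient i).inner (𝕜 := ℂ) (tendsto_const_nhds (x := v))
  have h0 : Tendsto (fun s : ℝ => translateLp (s • e) u) (𝓝[>] 0) (𝓝 u) := by
    have := (continuous_translateLp e u).tendsto 0
    rw [zero_smul, translateLp_zero] at this
    exact this.mono_left nhdsWithin_le_nhds
  have h2 := (h0.inner (𝕜 := ℂ) (hv.tendsto_quotient i)).neg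
  refine tendsto_nhds_unique h1 (h2.congr fun t => ?_)
  -- Translations are unitary, so the quotient of `u` paired with `v` is minus the translate of `u`
  -- paired with the quotient of `v`.
  have h3 : inner ℂ (translateLp (t • e) u) (translateLp (t • e) v) = inner ℂ u v :=
    (translateLp (t • e)).inner_map_map u v
  rw [inner_smul_left, inner_smul_right, inner_sub_left, inner_sub_right, h3,
    Complex.conj_ofReal]
  ring

/-- Chain rule for a Lipschitz differentiable function of the real part. -/
theorem IsWeakGradient.comp_re {u : LpRN N 2} {G : Fin N → LpRN N 2} (h : IsWeakGradient u G)
    {F F' : ℝ → ℝ} (hF : ∀ s, HasDerivAt F (F' s) s) {L : ℝ} (hL : ∀ s, |F' s| ≤ L)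
    {v : LpRN N 2} (hv : v =ᵐ[volume] fun x => ((F (u x).re : ℝ) : ℂ))
    {H : Fin N → LpRN N 2}
    (hH : ∀ i, H i =ᵐ[volume] fun x => ((F' (u x).re * (G i x).re : ℝ) : ℂ)) :
    IsWeakGradient v H := by
  refine IsWeakGradient.of_tendsto fun i => ?_
  set e : 𝔼 := EuclideanSpace.single i 1
  have hL0 : 0 ≤ L := (abs_nonneg _).trans (hL 0)
  have hlip : ∀ a b, |F a - F b| ≤ L * |a - b| := fun a b => by
    have := Convex.norm_image_sub_le_of_norm_hasDerivWithin_le (f := F) (f' := F') (C := L)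
      (fun x _ => (hF x).hasDerivWithinAt) (fun x _ => hL x) convex_univ (Set.mem_univ b)
      (Set.mem_univ a)
    simpa using this
  let q : ℝ → LpRN N 2 := fun t => ((t⁻¹ : ℝ) : ℂ) • (translateLp (t • e) u - u)
  let D : ℝ → LpRN N 2 := fun t => ((t⁻¹ : ℝ) : ℂ) • (translateLp (t • e) v - v)
  have hq : Tendsto q (𝓝[>] 0) (𝓝 (G i)) := h.tendsto_quotient i
  have hcoe : ∀ (w : LpRN N 2) (t : ℝ),
      (((t⁻¹ : ℝ) : ℂ) • (translateLp (t • e) w - w) : LpRN N 2) =ᵐ[volume]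
        fun x => ((t⁻¹ : ℝ) : ℂ) * (w (x + t • e) - w x) := fun w t => by
    filter_upwards [Lp.coeFn_smul ((t⁻¹ : ℝ) : ℂ) (translateLp (t • e) w - w),
      Lp.coeFn_sub (translateLp (t • e) w) w, translateLp_coeFn (t • e) w] with x h1 h2 h3
    rw [h1, Pi.smul_apply, h2, Pi.sub_apply, h3, smul_eq_mul]
  have hDcoe : ∀ t, D t =ᵐ[volume] fun x =>
      ((t⁻¹ * (F (u (x + t • e)).re - F (u x).re) : ℝ) : ℂ) := fun t => by
    have h1 := (measurePreserving_add_right (volume : Measure 𝔼)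
      (t • e)).quasiMeasurePreserving.ae_eq_comp hv
    filter_upwards [hcoe v t, h1, hv] with x h2 h3 h4
    simp only [Function.comp_apply] at h3
    rw [h2, h3, h4]
    push_cast
    ring
  -- Along this sequence the quotients of `u` converge almost everywhere. The pointwise chain rule
  -- then needs only differentiability of `F`, not continuity of `F'`.
  obtain ⟨t, ht, hae⟩ := (tendstoInMeasure_of_tendsto_Lp hq).exists_seq_tendsto_ae'
  refine ⟨t, ht, fun φ hφ hc => ?_⟩
  have ht0 : Tendsto t atTop (𝓝 0) := ht.mono_right nhdsWithin_le_nhds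
  have htpos : ∀ᶠ k in atTop, 0 < t k := (tendsto_nhdsWithin_iff.1 ht).2
  have hall : ∀ᵐ x, ∀ k, D (t k) x =
      ((((t k)⁻¹ * (F (u (x + t k • e)).re - F (u x).re)) : ℝ) : ℂ) ∧
      q (t k) x = (((t k)⁻¹ : ℝ) : ℂ) * (u (x + t k • e) - u x) :=
    ae_all_iff.2 fun k => (hDcoe (t k)).and (hcoe u (t k))
  have hDq : ∀ᵐ x, ∀ k, ‖D (t k) x‖ ≤ L * ‖q (t k) x‖ := by
    filter_upwards [hall] with x hx k
    obtain ⟨h1, h2⟩ := hx k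
    rw [h1, h2, norm_mul, Complex.norm_real, Complex.norm_real, norm_mul]
    have h3 := hlip (u (x + t k • e)).re (u x).re
    have h4 : |(u (x + t k • e)).re - (u x).re| ≤ ‖u (x + t k • e) - u x‖ := by
      rw [← Complex.sub_re]; exact Complex.abs_re_le_norm _
    rw [mul_left_comm]
    refine mul_le_mul_of_nonneg_left ?_ (norm_nonneg _)
    exact h3.trans (mul_le_mul_of_nonneg_left h4 hL0)
  have hDH : ∀ᵐ x, Tendsto (fun k => D (t k) x) atTop (𝓝 (H i x)) := by
    filter_upwards [hall, hae, hH i] with x h1 h2 h3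
    have hre : Tendsto (fun k => (t k)⁻¹ • ((u (x + t k • e)).re - (u x).re)) atTop
        (𝓝 (G i x).re) := by
      have := (Complex.continuous_re.tendsto _).comp h2
      refine this.congr fun k => ?_
      rw [Function.comp_apply, (h1 k).2, Complex.re_ofReal_mul, Complex.sub_re, smul_eq_mul]
    have hd0 : Tendsto (fun k => (u (x + t k • e)).re - (u x).re) atTop (𝓝 0) := by
      have h4 := ht0.smul hre
      rw [zero_smul] at h4
      refine h4.congr' ?_
      filter_upwards [htpos] with k hk
      rw [smul_smul, mul_inv_cancel₀ hk.ne', one_smul]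
    have h5 := (hF (u x).re).hasFDerivAt.hasFDerivWithinAt (s := Set.univ) |>.lim hd0
      (Eventually.of_forall fun _ => Set.mem_univ _) hre
    have h6 := (Complex.continuous_ofReal.tendsto _).comp h5
    rw [h3]
    convert h6 using 2
    · rename_i k
      rw [(h1 k).1, Function.comp_apply, smul_eq_mul, add_sub_cancel]
    · simp [mul_comm]
  have hHG : ∀ᵐ x, ‖H i x‖ ≤ L * ‖G i x‖ := by
    filter_upwards [hH i] with x hx
    rw [hx, Complex.norm_real, norm_mul]
    exact mul_le_mul (hL _) (Complex.abs_re_le_norm _) (norm_nonneg _) hL0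
  set φ' := testLp φ hφ.continuous hc
  rw [tendsto_iff_norm_sub_tendsto_zero]
  -- The quotients `D` of `v` satisfy `|D| ≤ L|q|`, where `q` varies with `k`, so dominated
  -- convergence is not available for `D - H` directly. Instead `|D - H| ≤ min(|D - H|, 2L|G|) + L|q
  -- - G|`: the first term is dominated by a fixed function, the second tends to zero in `L²`.
  let a : ℕ → 𝔼 → ℝ := fun k x => ‖φ' x‖ * min ‖D (t k) x - H i x‖ (2 * L * ‖G i x‖)
  have hint2 : ∀ w w' : LpRN N 2, Integrable (fun x => ‖w x‖ * ‖w' x‖) := fun w w' => by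
    have := memLp_one_iff_integrable.1 ((Lp.memLp w').norm.smul (Lp.memLp w).norm)
    exact this
  have hameas : ∀ k, AEStronglyMeasurable (a k) volume := fun k =>
    (Lp.aestronglyMeasurable φ').norm.mul
      ((((Lp.aestronglyMeasurable (D (t k))).sub (Lp.aestronglyMeasurable (H i))).norm).inf
        ((Lp.aestronglyMeasurable (G i)).norm.const_mul (2 * L)))
  have habound : ∀ k, ∀ᵐ x, ‖a k x‖ ≤ 2 * L * (‖φ' x‖ * ‖G i x‖) := fun k =>
    Eventually.of_forall fun x => by
      have h1 : 0 ≤ min ‖D (t k) x - H i x‖ (2 * L * ‖G i x‖) :=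
        le_min (norm_nonneg _) (by positivity)
      rw [Real.norm_of_nonneg (mul_nonneg (norm_nonneg _) h1)]
      calc a k x ≤ ‖φ' x‖ * (2 * L * ‖G i x‖) :=
            mul_le_mul_of_nonneg_left (min_le_right _ _) (norm_nonneg _)
        _ = _ := by ring
  have ha0 : Tendsto (fun k => ∫ x, a k x) atTop (𝓝 0) := by
    have h1 : Tendsto (fun k => ∫ x, a k x) atTop (𝓝 (∫ _ : 𝔼, (0 : ℝ))) := by
      refine tendsto_integral_of_dominated_convergence
        (fun x => 2 * L * (‖φ' x‖ * ‖G i x‖)) hameas ((hint2 φ' (G i)).const_mul _) habound ?_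
      filter_upwards [hDH] with x hx
      have h2 : Tendsto (fun k => ‖D (t k) x - H i x‖) atTop (𝓝 0) :=
        tendsto_iff_norm_sub_tendsto_zero.1 hx
      have h3 : Tendsto (fun k => ‖φ' x‖ * ‖D (t k) x - H i x‖) atTop (𝓝 0) := by
        simpa using h2.const_mul ‖φ' x‖
      refine squeeze_zero (fun k => mul_nonneg (norm_nonneg _)
        (le_min (norm_nonneg _) (by positivity))) (fun k => ?_) h3
      exact mul_le_mul_of_nonneg_left (min_le_left _ _) (norm_nonneg _)
    simpa using h1
  have hq0 : Tendsto (fun k => L * (‖φ'‖ * ‖q (t k) - G i‖)) atTop (𝓝 0) := by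
    have h1 : Tendsto (fun k => ‖q (t k) - G i‖) atTop (𝓝 0) :=
      tendsto_iff_norm_sub_tendsto_zero.1 (hq.comp ht)
    simpa using (h1.const_mul ‖φ'‖).const_mul L
  have hsum := ha0.add hq0
  rw [add_zero] at hsum
  refine squeeze_zero (fun _ => norm_nonneg _) (fun k => ?_) hsum
  change ‖inner ℂ φ' (D (t k)) - inner ℂ φ' (H i)‖ ≤ _
  rw [← inner_sub_right, L2.inner_def]
  have hCS : ∫ x, ‖φ' x‖ * ‖(q (t k) - G i : LpRN N 2) x‖ ≤ ‖φ'‖ * ‖q (t k) - G i‖ := by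
    have h1 : MemLp (fun x => (‖φ' x‖ : ℝ)) 2 (volume : Measure 𝔼) := (Lp.memLp φ').norm
    have h2 : MemLp (fun x => (‖(q (t k) - G i : LpRN N 2) x‖ : ℝ)) 2 (volume : Measure 𝔼) :=
      (Lp.memLp _).norm
    have h3 := real_inner_le_norm h1.toLp h2.toLp
    rw [L2.inner_def] at h3
    rw [Lp.norm_toLp, Lp.norm_toLp, eLpNorm_norm, eLpNorm_norm, ← Lp.norm_def, ← Lp.norm_def] at h3
    refine le_trans (le_of_eq (integral_congr_ae ?_)) h3
    filter_upwards [h1.coeFn_toLp, h2.coeFn_toLp] with x e1 e2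
    rw [e1, e2]
    simp [mul_comm]
  calc _ ≤ ∫ x, ‖inner ℂ (φ' x) ((D (t k) - H i : LpRN N 2) x)‖ := norm_integral_le_integral_norm _
    _ ≤ ∫ x, (a k x + L * (‖φ' x‖ * ‖(q (t k) - G i : LpRN N 2) x‖)) := by
      refine integral_mono_ae (L2.integrable_inner φ' _).norm ?_ ?_
      · exact ((((hint2 φ' (G i)).const_mul (2 * L)).mono' (hameas k) (habound k))).add
          ((hint2 φ' _).const_mul L)
      · filter_upwards [Lp.coeFn_sub (D (t k)) (H i), Lp.coeFn_sub (q (t k)) (G i), hDq, hHG]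
          with x h1 h2 h3 h4
        have h5 : ‖D (t k) x - H i x‖ ≤ min ‖D (t k) x - H i x‖ (2 * L * ‖G i x‖)
            + L * ‖q (t k) x - G i x‖ := by
          have h7 := norm_sub_le (D (t k) x) (H i x)
          have h8 : ‖q (t k) x‖ ≤ ‖G i x‖ + ‖q (t k) x - G i x‖ := by
            simpa using norm_add_le (G i x) (q (t k) x - G i x)
          have h9 := mul_le_mul_of_nonneg_left h8 hL0
          have h10 := h3 k
          have h11 : 0 ≤ L * ‖q (t k) x - G i x‖ := by positivity
          rcases min_choice ‖D (t k) x - H i x‖ (2 * L * ‖G i x‖) with h12 | h12 <;> rw [h12] <;>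
            linarith
        have h6 : ‖inner ℂ (φ' x) ((D (t k) - H i : LpRN N 2) x)‖
            ≤ ‖φ' x‖ * ‖D (t k) x - H i x‖ := by
          rw [h1]; exact norm_inner_le_norm _ _
        refine h6.trans ?_
        rw [h2, Pi.sub_apply]
        calc _ ≤ ‖φ' x‖ * (min ‖D (t k) x - H i x‖ (2 * L * ‖G i x‖)
              + L * ‖q (t k) x - G i x‖) := mul_le_mul_of_nonneg_left h5 (norm_nonneg _)
          _ = _ := by simp only [a]; ring
    _ = (∫ x, a k x) + L * ∫ x, ‖φ' x‖ * ‖(q (t k) - G i : LpRN N 2) x‖ := by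
      rw [integral_add (((hint2 φ' (G i)).const_mul (2 * L)).mono' (hameas k) (habound k))
        ((hint2 φ' _).const_mul L), integral_const_mul]
    _ ≤ _ := by gcongr

/-- Product of an `H¹` function with a smooth function. -/
theorem IsWeakGradient.smul_contDiff {u : LpRN N 2} {G : Fin N → LpRN N 2}
    (h : IsWeakGradient u G) {ψ : 𝔼 → ℝ} (hψ : ContDiff ℝ ∞ ψ)
    {v : LpRN N 2} (hv : v =ᵐ[volume] fun x => ψ x • u x) {H : Fin N → LpRN N 2}
    (hH : ∀ i, H i =ᵐ[volume] fun x =>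
      ψ x • G i x + fderiv ℝ ψ x (EuclideanSpace.single i 1) • u x) :
    IsWeakGradient v H := by
  intro i φ hφ hc
  set e : 𝔼 := EuclideanSpace.single i 1
  have h1 := h i (fun x => φ x * ψ x) (hφ.mul hψ) hc.mul_right
  have hd : ∀ x, fderiv ℝ (fun x => φ x * ψ x) x e
      = φ x * fderiv ℝ ψ x e + ψ x * fderiv ℝ φ x e := fun x => by
    rw [fderiv_fun_mul (hφ.differentiable (by simp) x) (hψ.differentiable (by simp) x)]
    simp
  have e1 : (fun x => fderiv ℝ φ x e • v x) =ᵐ[volume] fun x =>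
      fderiv ℝ (fun x => φ x * ψ x) x e • u x - (φ x * fderiv ℝ ψ x e) • u x := by
    filter_upwards [hv] with x hx
    rw [hx, hd, ← sub_smul, smul_smul]
    congr 1
    ring
  have e2 : (fun x => φ x • H i x) =ᵐ[volume] fun x =>
      (φ x * ψ x) • G i x + (φ x * fderiv ℝ ψ x e) • u x := by
    filter_upwards [hH i] with x hx
    rw [hx, smul_add, smul_smul, smul_smul]
  have i1 : Integrable fun x => (φ x * fderiv ℝ ψ x e) • u x :=
    integrable_smul_of_hasCompactSupport
      (hφ.continuous.mul (continuous_fderiv_apply hψ e)) hc.mul_right u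
  have i2 : Integrable fun x => (φ x * ψ x) • G i x :=
    integrable_smul_of_hasCompactSupport (hφ.continuous.mul hψ.continuous) hc.mul_right _
  have i3 : Integrable fun x => fderiv ℝ (fun x => φ x * ψ x) x e • u x :=
    integrable_smul_of_hasCompactSupport (continuous_fderiv_apply (hφ.mul hψ) e)
      (hasCompactSupport_fderiv_apply hc.mul_right e) u
  rw [integral_congr_ae e1, integral_congr_ae e2, integral_sub i3 i1, integral_add i2 i1, h1]
  ring

end WeakGradient

/-! ### Radial integration by parts and Hardy's inequality -/

section Hardy

variable {N : ℕ}

local notation "𝔼" => EuclideanSpace ℝ (Fin N)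

lemma integrable_mul_mul {f g : 𝔼 → ℂ} (hf : MemLp f 2 volume) (hg : MemLp g 2 volume) :
    Integrable fun x => ‖f x‖ * ‖g x‖ :=
  memLp_one_iff_integrable.1 (hg.norm.smul hf.norm)

lemma integral_add_add {f g h : 𝔼 → ℝ} (hf : Integrable f) (hg : Integrable g)
    (hh : Integrable h) :
    ∫ x, (f x + g x + h x) = (∫ x, f x) + (∫ x, g x) + ∫ x, h x := by
  have : Integrable fun x => f x + g x := hf.add hg
  rw [integral_add this hh, integral_add hf hg]

lemma integrable_norm_sq {f : 𝔼 → ℂ} (hf : MemLp f 2 volume) :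
    Integrable fun x => ‖f x‖ ^ 2 := by
  simpa [sq] using integrable_mul_mul hf hf

lemma aestronglyMeasurable_re_conj_mul (u v : LpRN N 2) :
    AEStronglyMeasurable (fun x => (conj (u x) * v x).re) volume :=
  Complex.continuous_re.comp_aestronglyMeasurable
    ((Complex.continuous_conj.comp_aestronglyMeasurable (Lp.aestronglyMeasurable u)).mul
      (Lp.aestronglyMeasurable v))

lemma abs_re_conj_mul_le (z w : ℂ) : |(conj z * w).re| ≤ ‖z‖ * ‖w‖ := by
  refine (Complex.abs_re_le_norm _).trans (le_of_eq ?_)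
  rw [norm_mul, Complex.norm_conj]

lemma integrable_bounded_mul_re {ψ : 𝔼 → ℝ} (hψ : AEStronglyMeasurable ψ volume) {C : ℝ}
    (hC : ∀ x, |ψ x| ≤ C) (u v : LpRN N 2) :
    Integrable fun x => ψ x * (conj (u x) * v x).re := by
  refine ((integrable_mul_mul (Lp.memLp u) (Lp.memLp v)).const_mul C).mono'
    (hψ.mul (aestronglyMeasurable_re_conj_mul u v)) (Eventually.of_forall fun x => ?_)
  rw [norm_mul]
  exact mul_le_mul (hC x) (abs_re_conj_mul_le _ _) (norm_nonneg _)
    ((abs_nonneg _).trans (hC x))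

lemma re_inner_eq_integral (u v : LpRN N 2) :
    (inner ℂ u v).re = ∫ x, (conj (u x) * v x).re := by
  rw [L2.inner_def]
  have h := integral_re (L2.integrable_inner (𝕜 := ℂ) u v)
  simp only [RCLike.re_to_complex] at h
  rw [← h]
  refine integral_congr_ae (Eventually.of_forall fun x => ?_)
  simp only [RCLike.inner_apply, mul_comm]

/-- Integrate by parts with `u` and `ψu`: the term `ψ Re(ū ∂ᵢu)` appears on both sides, which is the
origin of the factor `2`. -/
lemma IsWeakGradient.two_mul_integral_mul_re {u : LpRN N 2} {G : Fin N → LpRN N 2}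
    (h : IsWeakGradient u G) {ψ : 𝔼 → ℝ} (hψ : ContDiff ℝ ∞ ψ) {C : ℝ} (hC : ∀ x, |ψ x| ≤ C)
    (hC' : ∀ x j, |fderiv ℝ ψ x (EuclideanSpace.single j 1)| ≤ C) (i : Fin N) :
    2 * ∫ x, ψ x * (conj (u x) * G i x).re
      = -∫ x, fderiv ℝ ψ x (EuclideanSpace.single i 1) * ‖u x‖ ^ 2 := by
  have hψm : AEStronglyMeasurable ψ (volume : Measure 𝔼) := hψ.continuous.aestronglyMeasurable
  have hdm : ∀ j, AEStronglyMeasurable (fun x => fderiv ℝ ψ x (EuclideanSpace.single j 1))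
      (volume : Measure 𝔼) := fun j => (continuous_fderiv_apply hψ _).aestronglyMeasurable
  let v : LpRN N 2 := mulOp 2 ψ hψm C (Eventually.of_forall hC) u
  let H : Fin N → LpRN N 2 := fun j => mulOp 2 ψ hψm C (Eventually.of_forall hC) (G j)
    + mulOp 2 _ (hdm j) C (Eventually.of_forall fun x => hC' x j) u
  have hv : v =ᵐ[volume] fun x => ψ x • u x := by
    filter_upwards [mulOp_coeFn hψm (Eventually.of_forall hC) u] with x hx
    rw [hx, Complex.real_smul]
  have hH : ∀ j, H j =ᵐ[volume] fun x =>
      ψ x • G j x + fderiv ℝ ψ x (EuclideanSpace.single j 1) • u x := fun j => by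
    filter_upwards [mulOp_coeFn hψm (Eventually.of_forall hC) (G j),
      mulOp_coeFn (hdm j) (Eventually.of_forall fun x => hC' x j) u,
      Lp.coeFn_add (mulOp 2 ψ hψm C (Eventually.of_forall hC) (G j))
        (mulOp 2 _ (hdm j) C (Eventually.of_forall fun x => hC' x j) u)] with x h1 h2 h3
    rw [h3, Pi.add_apply, h1, h2, Complex.real_smul, Complex.real_smul]
  have hibp := h.inner_eq_neg (h.smul_contDiff hψ hv hH) i
  have hre := congrArg Complex.re hibp
  rw [Complex.neg_re, re_inner_eq_integral, re_inner_eq_integral] at hre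
  have e1 : ∫ x, (conj (G i x) * v x).re = ∫ x, ψ x * (conj (u x) * G i x).re := by
    refine integral_congr_ae ?_
    filter_upwards [hv] with x hx
    rw [hx]
    simp
    ring
  have e2 : ∫ x, (conj (u x) * H i x).re = ∫ x, (ψ x * (conj (u x) * G i x).re
      + fderiv ℝ ψ x (EuclideanSpace.single i 1) * ‖u x‖ ^ 2) := by
    refine integral_congr_ae ?_
    filter_upwards [hH i] with x hx
    rw [hx, ← Complex.normSq_eq_norm_sq, Complex.normSq_apply]
    simp
    ring
  have i1 := integrable_bounded_mul_re hψm hC u (G i)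
  have i2 : Integrable fun x => fderiv ℝ ψ x (EuclideanSpace.single i 1) * ‖u x‖ ^ 2 := by
    refine ((integrable_norm_sq (Lp.memLp u)).const_mul C).mono'
      ((hdm i).mul ((Lp.aestronglyMeasurable u).norm.pow 2)) (Eventually.of_forall fun x => ?_)
    rw [norm_mul, Real.norm_eq_abs, Real.norm_of_nonneg (by positivity : 0 ≤ ‖u x‖ ^ 2)]
    exact mul_le_mul_of_nonneg_right (hC' x i) (by positivity)
  rw [e1, e2, integral_add i1 i2] at hre
  linarith

lemma abs_apply_le_norm (x : 𝔼) (i : Fin N) : |x i| ≤ ‖x‖ := by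
  simpa using PiLp.norm_apply_le x i

lemma sum_sq_eq_norm_sq (x : 𝔼) : ∑ i, x i ^ 2 = ‖x‖ ^ 2 := by
  rw [EuclideanSpace.norm_sq_eq]
  simp

/-- Integration by parts along a radial vector field `ζ x`. -/
lemma IsWeakGradient.integral_radial {u : LpRN N 2} {G : Fin N → LpRN N 2}
    (h : IsWeakGradient u G) {ζ κ : 𝔼 → ℝ} (hζ : ContDiff ℝ ∞ ζ)
    (hκ : ∀ x i, fderiv ℝ ζ x (EuclideanSpace.single i 1) = κ x * x i) {C : ℝ}
    (h1 : ∀ x, |ζ x| ≤ C) (h2 : ∀ x, |ζ x| * ‖x‖ ≤ C) (h3 : ∀ x, |κ x| * ‖x‖ ^ 2 ≤ C) :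
    2 * ∫ x, ζ x * ∑ i, x i * (conj (u x) * G i x).re
      = -∫ x, (N * ζ x + κ x * ‖x‖ ^ 2) * ‖u x‖ ^ 2 := by
  have hcoord : ∀ i : Fin N, ContDiff ℝ ∞ fun x : 𝔼 => x i := fun i => by fun_prop
  have hψ : ∀ i : Fin N, ContDiff ℝ ∞ fun x : 𝔼 => x i * ζ x := fun i => (hcoord i).mul hζ
  have hd : ∀ (i j : Fin N) (x : 𝔼), fderiv ℝ (fun x : 𝔼 => x i * ζ x) x
      (EuclideanSpace.single j 1) = x i * (κ x * x j) + ζ x * (if i = j then 1 else 0) := by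
    intro i j x
    rw [fderiv_fun_mul ((hcoord i).differentiable (by simp) x) (hζ.differentiable (by simp) x)]
    have : fderiv ℝ (fun x : 𝔼 => x i) x = EuclideanSpace.proj i :=
      (EuclideanSpace.proj (𝕜 := ℝ) i).fderiv
    simp [this, hκ]
  have hb1 : ∀ i (x : 𝔼), |x i * ζ x| ≤ 2 * C := fun i x => by
    rw [abs_mul, mul_comm]
    have := mul_le_mul_of_nonneg_left (abs_apply_le_norm x i) (abs_nonneg (ζ x))
    have h4 := h2 x
    have h5 : 0 ≤ |ζ x| * ‖x‖ := by positivity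
    linarith
  have hb2 : ∀ i (x : 𝔼) j, |fderiv ℝ (fun x : 𝔼 => x i * ζ x) x
      (EuclideanSpace.single j 1)| ≤ 2 * C := fun i x j => by
    rw [hd]
    refine (abs_add_le _ _).trans ?_
    have e1 : |x i * (κ x * x j)| ≤ C := by
      rw [abs_mul, abs_mul]
      calc |x i| * (|κ x| * |x j|) ≤ ‖x‖ * (|κ x| * ‖x‖) := by
            gcongr <;> exact abs_apply_le_norm _ _
        _ = |κ x| * ‖x‖ ^ 2 := by ring
        _ ≤ C := h3 x
    have e2 : |ζ x * (if i = j then 1 else 0)| ≤ C := by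
      split_ifs
      · simpa using h1 x
      · simpa using (abs_nonneg _).trans (h1 x)
    linarith
  have hi := fun i => h.two_mul_integral_mul_re (hψ i) (hb1 i) (hb2 i) i
  have hint := fun i => integrable_bounded_mul_re
    (hψ i).continuous.aestronglyMeasurable (hb1 i) u (G i)
  have hint2 : ∀ i : Fin N, Integrable fun x => fderiv ℝ (fun x : 𝔼 => x i * ζ x) x
      (EuclideanSpace.single i 1) * ‖u x‖ ^ 2 := fun i => by
    refine ((integrable_norm_sq (Lp.memLp u)).const_mul (2 * C)).mono'
      ((continuous_fderiv_apply (hψ i) _).aestronglyMeasurable.mul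
        ((Lp.aestronglyMeasurable u).norm.pow 2)) (Eventually.of_forall fun x => ?_)
    rw [norm_mul, Real.norm_eq_abs, Real.norm_of_nonneg (by positivity : 0 ≤ ‖u x‖ ^ 2)]
    exact mul_le_mul_of_nonneg_right (hb2 i x i) (by positivity)
  have e1 : ∫ x, ζ x * ∑ i, x i * (conj (u x) * G i x).re
      = ∑ i, ∫ x, (x i * ζ x) * (conj (u x) * G i x).re := by
    rw [← integral_finsetSum _ fun i _ => hint i]
    refine integral_congr_ae (Eventually.of_forall fun x => ?_)
    simp only [Finset.mul_sum]
    exact Finset.sum_congr rfl fun i _ => by ring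
  have e2 : ∫ x, (N * ζ x + κ x * ‖x‖ ^ 2) * ‖u x‖ ^ 2
      = ∑ i : Fin N, ∫ x, fderiv ℝ (fun x : 𝔼 => x i * ζ x) x
      (EuclideanSpace.single i 1) * ‖u x‖ ^ 2 := by
    rw [← integral_finsetSum _ fun i _ => hint2 i]
    refine integral_congr_ae (Eventually.of_forall fun x => ?_)
    simp only [hd, if_true, mul_one, ← Finset.sum_mul, Finset.sum_add_distrib,
      Finset.sum_const, Finset.card_univ, Fintype.card_fin, nsmul_eq_mul]
    have : ∑ i, x i * (κ x * x i) = κ x * ‖x‖ ^ 2 := by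
      rw [← sum_sq_eq_norm_sq, Finset.mul_sum]
      exact Finset.sum_congr rfl fun i _ => by ring
    rw [this]
    ring
  rw [e1, e2, Finset.mul_sum, ← Finset.sum_neg_distrib]
  exact Finset.sum_congr rfl fun i _ => hi i

lemma hasFDerivAt_comp_norm_sq {g : ℝ → ℝ} {g' : ℝ} {x : 𝔼} (hg : HasDerivAt g g' (‖x‖ ^ 2))
    (i : Fin N) :
    fderiv ℝ (fun x : 𝔼 => g (‖x‖ ^ 2)) x (EuclideanSpace.single i 1) = 2 * g' * x i := by
  have h1 : HasFDerivAt (fun x : 𝔼 => ‖x‖ ^ 2) (2 • innerSL ℝ x) x :=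
    (hasStrictFDerivAt_norm_sq x).hasFDerivAt
  have h2 := hg.comp_hasFDerivAt x h1
  have h3 : fderiv ℝ (fun x : 𝔼 => g (‖x‖ ^ 2)) x = g' • 2 • innerSL ℝ x := h2.fderiv
  rw [h3]
  simp [EuclideanSpace.inner_single_right]
  ring

/-- With `k = (N-2)/2` and `ζ = 1/(|x|²+ε)`, expand `0 ≤ ∫|∇u + kζx u|²` and integrate the cross
term by parts. Since `N = 2k+2`, the resulting coefficient of `|u|²` exceeds `k²ζ` by
`(k²+2k)ζ(1-ζ|x|²) ≥ 0`. -/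
lemma IsWeakGradient.hardy_regularized {u : LpRN N 2} {G : Fin N → LpRN N 2}
    (h : IsWeakGradient u G) (hN : 2 ≤ N) {ε : ℝ} (hε : 0 < ε) :
    (((N : ℝ) - 2) / 2) ^ 2 * ∫ x : 𝔼, (‖x‖ ^ 2 + ε)⁻¹ * ‖u x‖ ^ 2 ≤ ∫ x, ∑ i, ‖G i x‖ ^ 2 := by
  set k : ℝ := ((N : ℝ) - 2) / 2
  have hk : 0 ≤ k := by
    have : (2 : ℝ) ≤ N := by exact_mod_cast hN
    simp only [k]; linarith
  have hpos : ∀ x : 𝔼, 0 < ‖x‖ ^ 2 + ε := fun x => by positivity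
  let ζ : 𝔼 → ℝ := fun x => (‖x‖ ^ 2 + ε)⁻¹
  let κ : 𝔼 → ℝ := fun x => -2 * (ζ x) ^ 2
  have hζpos : ∀ x, 0 < ζ x := fun x => inv_pos.2 (hpos x)
  have hζ1 : ∀ x, ζ x * ‖x‖ ^ 2 ≤ 1 := fun x => by
    simp only [ζ]
    rw [inv_mul_le_iff₀ (hpos x)]
    linarith
  have hζε : ∀ x, ζ x ≤ ε⁻¹ := fun x => by
    simp only [ζ]
    gcongr
    nlinarith [norm_nonneg x]
  have hζ : ContDiff ℝ ∞ ζ := by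
    have : ContDiff ℝ ∞ fun x : 𝔼 => ‖x‖ ^ 2 + ε := (contDiff_norm_sq ℝ).add contDiff_const
    exact this.inv fun x => (hpos x).ne'
  have hκ : ∀ x i, fderiv ℝ ζ x (EuclideanSpace.single i 1) = κ x * x i := fun x i => by
    have h1 : HasDerivAt (fun r : ℝ => (r + ε)⁻¹) (-1 / (‖x‖ ^ 2 + ε) ^ 2) (‖x‖ ^ 2) :=
      ((hasDerivAt_id _).add_const ε).inv (hpos x).ne'
    have h2 := hasFDerivAt_comp_norm_sq h1 i
    rw [show ζ = fun x : 𝔼 => (‖x‖ ^ 2 + ε)⁻¹ from rfl, h2]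
    simp only [κ, ζ, inv_pow]
    ring
  have h1 : ∀ x, |ζ x| ≤ 2 * (1 + ε⁻¹) := fun x => by
    rw [abs_of_pos (hζpos x)]
    have := inv_pos.2 hε
    linarith [hζε x]
  have h2 : ∀ x, |ζ x| * ‖x‖ ≤ 2 * (1 + ε⁻¹) := fun x => by
    rw [abs_of_pos (hζpos x)]
    have h3 : ‖x‖ ≤ 1 + ‖x‖ ^ 2 := by nlinarith [sq_nonneg (‖x‖ - 1), norm_nonneg x]
    have h4 := mul_le_mul_of_nonneg_left h3 (hζpos x).le
    have := inv_pos.2 hε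
    linarith [hζε x, hζ1 x]
  have h3 : ∀ x, |κ x| * ‖x‖ ^ 2 ≤ 2 * (1 + ε⁻¹) := fun x => by
    simp only [κ]
    rw [abs_mul, abs_of_nonneg (by positivity : 0 ≤ ζ x ^ 2)]
    norm_num
    have := mul_le_mul_of_nonneg_left (hζ1 x) (hζpos x).le
    nlinarith [hζε x]
  have hrad := h.integral_radial hζ hκ h1 h2 h3
  have hζm : AEStronglyMeasurable ζ (volume : Measure 𝔼) := hζ.continuous.aestronglyMeasurable
  have hu2 := integrable_norm_sq (Lp.memLp u)
  have iG : Integrable fun x => ∑ i, ‖G i x‖ ^ 2 :=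
    integrable_finsetSum _ fun i _ => integrable_norm_sq (Lp.memLp (G i))
  have iR : Integrable fun x => ζ x * ∑ i, x i * (conj (u x) * G i x).re := by
    have : ∀ i : Fin N, Integrable fun x => (ζ x * x i) * (conj (u x) * G i x).re := fun i =>
      integrable_bounded_mul_re (ψ := fun x => ζ x * x i) (C := 2 * (1 + ε⁻¹))
        (hζ.continuous.mul (by fun_prop : Continuous fun x : 𝔼 => x i)).aestronglyMeasurable
        (fun x => by
          rw [abs_mul]
          exact (mul_le_mul_of_nonneg_left (abs_apply_le_norm x i) (abs_nonneg _)).trans (h2 x))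
        u (G i)
    have h4 := integrable_finsetSum Finset.univ fun i _ => this i
    refine h4.congr (Eventually.of_forall fun x => ?_)
    simp only [Finset.mul_sum, mul_assoc]
  have iB : ∀ θ : 𝔼 → ℝ, Continuous θ → (∃ C, ∀ x, |θ x| ≤ C) →
      Integrable fun x => θ x * ‖u x‖ ^ 2 := fun θ hθ ⟨C, hC⟩ =>
    hu2.bdd_mul hθ.aestronglyMeasurable (Eventually.of_forall hC)
  have iN : Integrable fun x => (N * ζ x + κ x * ‖x‖ ^ 2) * ‖u x‖ ^ 2 := by
    refine iB _ ?_ ⟨N * (2 * (1 + ε⁻¹)) + 2 * (1 + ε⁻¹), fun x => ?_⟩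
    · have := hζ.continuous
      fun_prop
    · refine (abs_add_le _ _).trans (add_le_add ?_ ?_)
      · rw [abs_mul, Nat.abs_cast]
        exact mul_le_mul_of_nonneg_left (h1 x) (Nat.cast_nonneg _)
      · rw [abs_mul, abs_of_nonneg (by positivity : 0 ≤ ‖x‖ ^ 2)]
        exact h3 x
  have iS : Integrable fun x => (ζ x ^ 2 * ‖x‖ ^ 2) * ‖u x‖ ^ 2 := by
    refine iB _ ?_ ⟨2 * (1 + ε⁻¹), fun x => ?_⟩
    · have := hζ.continuous
      fun_prop
    · rw [abs_of_nonneg (by positivity)]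
      have := h3 x
      simp only [κ] at this
      rw [abs_mul, abs_of_nonneg (by positivity : 0 ≤ ζ x ^ 2)] at this
      norm_num at this
      nlinarith [mul_nonneg (sq_nonneg (ζ x)) (sq_nonneg ‖x‖)]
  have iζ : Integrable fun x => ζ x * ‖u x‖ ^ 2 := iB _ hζ.continuous ⟨_, h1⟩
  have hsq : ∀ x, 0 ≤ ∑ i, ‖G i x‖ ^ 2 + 2 * k * (ζ x * ∑ i, x i * (conj (u x) * G i x).re)
      + k ^ 2 * ((ζ x ^ 2 * ‖x‖ ^ 2) * ‖u x‖ ^ 2) := by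
    intro x
    have e : ∑ i, ‖G i x‖ ^ 2 + 2 * k * (ζ x * ∑ i, x i * (conj (u x) * G i x).re)
      + k ^ 2 * ((ζ x ^ 2 * ‖x‖ ^ 2) * ‖u x‖ ^ 2)
      = ∑ i, ‖G i x + ((k * ζ x * x i : ℝ) : ℂ) * u x‖ ^ 2 := by
      rw [← sum_sq_eq_norm_sq, Finset.mul_sum, Finset.mul_sum, Finset.mul_sum, Finset.sum_mul,
        Finset.mul_sum, ← Finset.sum_add_distrib, ← Finset.sum_add_distrib]
      refine Finset.sum_congr rfl fun i _ => ?_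
      simp only [← Complex.normSq_eq_norm_sq, Complex.normSq_apply, Complex.add_re,
        Complex.add_im, Complex.mul_re, Complex.mul_im, Complex.ofReal_re, Complex.ofReal_im,
        Complex.conj_re, Complex.conj_im]
      ring
    rw [e]
    positivity
  have hint : 0 ≤ ∫ x, (∑ i, ‖G i x‖ ^ 2
      + 2 * k * (ζ x * ∑ i, x i * (conj (u x) * G i x).re)
      + k ^ 2 * ((ζ x ^ 2 * ‖x‖ ^ 2) * ‖u x‖ ^ 2)) := integral_nonneg hsq
  rw [integral_add_add iG (iR.const_mul _) (iS.const_mul _), integral_const_mul,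
    integral_const_mul] at hint
  have hcomp : k ^ 2 * (∫ x, ζ x * ‖u x‖ ^ 2) + k ^ 2 * ∫ x, (ζ x ^ 2 * ‖x‖ ^ 2) * ‖u x‖ ^ 2
      ≤ k * ∫ x, (N * ζ x + κ x * ‖x‖ ^ 2) * ‖u x‖ ^ 2 := by
    rw [← integral_const_mul, ← integral_const_mul, ← integral_const_mul,
      ← integral_add (iζ.const_mul _) (iS.const_mul _)]
    refine integral_mono ((iζ.const_mul _).add (iS.const_mul _)) (iN.const_mul _) fun x => ?_
    have hN2 : (N : ℝ) = 2 * k + 2 := by simp only [k]; ring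
    have hz := mul_le_mul_of_nonneg_left (hζ1 x) (hζpos x).le
    have : k ^ 2 * ζ x + k ^ 2 * (ζ x ^ 2 * ‖x‖ ^ 2) ≤ k * (N * ζ x + κ x * ‖x‖ ^ 2) := by
      simp only [κ]
      rw [hN2]
      nlinarith [mul_nonneg hk (sub_nonneg.2 hz), mul_nonneg (mul_nonneg hk hk) (sub_nonneg.2 hz)]
    calc k ^ 2 * (ζ x * ‖u x‖ ^ 2) + k ^ 2 * (ζ x ^ 2 * ‖x‖ ^ 2 * ‖u x‖ ^ 2)
        = (k ^ 2 * ζ x + k ^ 2 * (ζ x ^ 2 * ‖x‖ ^ 2)) * ‖u x‖ ^ 2 := by ring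
      _ ≤ (k * (N * ζ x + κ x * ‖x‖ ^ 2)) * ‖u x‖ ^ 2 := by gcongr
      _ = _ := by ring
  have hr : 2 * k * ∫ x, ζ x * ∑ i, x i * (conj (u x) * G i x).re
      = -(k * ∫ x, (N * ζ x + κ x * ‖x‖ ^ 2) * ‖u x‖ ^ 2) := by
    rw [mul_comm 2 k, mul_assoc, hrad]; ring
  rw [hr] at hint
  linarith

lemma ae_ne_zero (hN : 0 < N) : ∀ᵐ x : 𝔼, x ≠ 0 := by
  have : Nontrivial 𝔼 := by
    have : Nonempty (Fin N) := ⟨⟨0, hN⟩⟩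
    infer_instance
  simp [ae_iff]

/-- **Hardy's inequality** in `H¹(ℝ^N)`, `N ≥ 3`. -/
theorem IsWeakGradient.hardy {u : LpRN N 2} {G : Fin N → LpRN N 2}
    (h : IsWeakGradient u G) (hN : 3 ≤ N) :
    Integrable (fun x : 𝔼 => (‖x‖ ^ 2)⁻¹ * ‖u x‖ ^ 2) ∧
    (((N : ℝ) - 2) / 2) ^ 2 * ∫ x : 𝔼, (‖x‖ ^ 2)⁻¹ * ‖u x‖ ^ 2 ≤ ∫ x, ∑ i, ‖G i x‖ ^ 2 := by
  set k : ℝ := ((N : ℝ) - 2) / 2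
  have hk : 0 < k := by
    have : (3 : ℝ) ≤ N := by exact_mod_cast hN
    simp only [k]; linarith
  set M := ∫ x, ∑ i, ‖G i x‖ ^ 2
  have hM : 0 ≤ M := integral_nonneg fun x => by positivity
  let f : ℕ → 𝔼 → ℝ := fun n x => (‖x‖ ^ 2 + 1 / ((n : ℝ) + 1))⁻¹ * ‖u x‖ ^ 2
  have hε : ∀ n : ℕ, (0 : ℝ) < 1 / ((n : ℝ) + 1) := fun n => by positivity
  have hf0 : ∀ n x, 0 ≤ f n x := fun n x => by positivity
  have hcont : ∀ n : ℕ, Continuous fun x : 𝔼 => (‖x‖ ^ 2 + 1 / ((n : ℝ) + 1))⁻¹ := fun n =>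
    (by fun_prop : Continuous fun x : 𝔼 => ‖x‖ ^ 2 + 1 / ((n : ℝ) + 1)).inv₀
      fun x => by positivity
  have hfm : ∀ n, AEStronglyMeasurable (f n) volume := fun n =>
    (hcont n).aestronglyMeasurable.mul ((Lp.aestronglyMeasurable u).norm.pow 2)
  have hfi : ∀ n, Integrable (f n) := fun n => by
    refine (integrable_norm_sq (Lp.memLp u)).bdd_mul (c := (n : ℝ) + 1)
      (hcont n).aestronglyMeasurable (Eventually.of_forall fun x => ?_)
    rw [norm_inv, Real.norm_of_nonneg (by positivity)]
    refine inv_le_of_inv_le₀ (by positivity) ?_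
    rw [← one_div]
    nlinarith [sq_nonneg ‖x‖]
  have hfle : ∀ n, ∫⁻ x, ENNReal.ofReal (f n x) ≤ ENNReal.ofReal (M / k ^ 2) := fun n => by
    rw [← ofReal_integral_eq_lintegral_ofReal (hfi n) (Eventually.of_forall (hf0 n))]
    refine ENNReal.ofReal_le_ofReal ?_
    rw [le_div_iff₀ (by positivity), mul_comm]
    exact h.hardy_regularized (by omega) (hε n)
  have hlim : ∀ᵐ x, Tendsto (fun n => f n x) atTop (𝓝 ((‖x‖ ^ 2)⁻¹ * ‖u x‖ ^ 2)) := by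
    filter_upwards [ae_ne_zero (N := N) (by omega)] with x hx
    have h1 : Tendsto (fun n : ℕ => ‖x‖ ^ 2 + 1 / ((n : ℝ) + 1)) atTop (𝓝 (‖x‖ ^ 2 + 0)) :=
      tendsto_const_nhds.add tendsto_one_div_add_atTop_nhds_zero_nat
    rw [add_zero] at h1
    exact (h1.inv₀ (by positivity)).mul_const _
  -- Integrability of `|u|²/|x|²` is not known beforehand; Fatou's lemma delivers it together with
  -- the inequality.
  have hFatou : ∫⁻ x : 𝔼, ENNReal.ofReal ((‖x‖ ^ 2)⁻¹ * ‖u x‖ ^ 2)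
      ≤ ENNReal.ofReal (M / k ^ 2) := by
    calc _ = ∫⁻ x, liminf (fun n => ENNReal.ofReal (f n x)) atTop := by
          refine lintegral_congr_ae ?_
          filter_upwards [hlim] with x hx
          exact ((ENNReal.continuous_ofReal.tendsto _).comp hx).liminf_eq.symm
      _ ≤ liminf (fun n => ∫⁻ x, ENNReal.ofReal (f n x)) atTop :=
          lintegral_liminf_le' fun n => (hfm n).aemeasurable.ennreal_ofReal
      _ ≤ _ := by
          refine liminf_le_of_frequently_le' (Frequently.of_forall hfle)
  have hmeas : AEStronglyMeasurable (fun x : 𝔼 => (‖x‖ ^ 2)⁻¹ * ‖u x‖ ^ 2) volume :=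
    (by fun_prop : Measurable fun x : 𝔼 => (‖x‖ ^ 2)⁻¹).aestronglyMeasurable.mul
      ((Lp.aestronglyMeasurable u).norm.pow 2)
  have hint : Integrable (fun x : 𝔼 => (‖x‖ ^ 2)⁻¹ * ‖u x‖ ^ 2) := by
    refine ⟨hmeas, ?_⟩
    rw [hasFiniteIntegral_iff_ofReal (Eventually.of_forall fun x => by positivity)]
    exact hFatou.trans_lt ENNReal.ofReal_lt_top
  refine ⟨hint, ?_⟩
  rw [← ofReal_integral_eq_lintegral_ofReal hint (Eventually.of_forall fun x => by positivity),
    ENNReal.ofReal_le_ofReal_iff (by positivity), le_div_iff₀ (by positivity)] at hFatou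
  linarith

end Hardy

/-! ### The drift term and the basic quadratic inequality -/

section Drift

variable {N : ℕ} {α β : ℝ}

local notation "𝔼" => EuclideanSpace ℝ (Fin N)

/-- `r^{α-1} = √(r^α)·√(r^{α-2})`, so the drift coefficient, of size `|x|^{α-1}`, is controlled by
the weight on the gradient times the singular weight on the function. -/
lemma rpow_sub_one_le {r : ℝ} (hr : 0 < r) :
    r ^ (α - 2) * r ≤ √(1 + r ^ α) * √(r ^ (α - 2)) := by
  have h1 : r ^ (α - 2) * r = √(r ^ α) * √(r ^ (α - 2)) := by
    rw [← Real.sqrt_mul (Real.rpow_nonneg hr.le _), ← Real.rpow_add hr]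
    rw [show r ^ (α + (α - 2)) = (r ^ (α - 2) * r) ^ 2 by
      rw [mul_pow, ← Real.rpow_natCast, ← Real.rpow_natCast, ← Real.rpow_mul hr.le,
        ← Real.rpow_add hr]
      congr 1
      push_cast
      ring]
    rw [Real.sqrt_sq (by positivity)]
  rw [h1]
  gcongr
  linarith

lemma InFormDomain.integrable_singular {u : LpRN N 2} {G : Fin N → LpRN N 2}
    (h : InFormDomain α β u G) : Integrable fun x : 𝔼 => ‖x‖ ^ (α - 2) * ‖u x‖ ^ 2 := by
  refine (integrable_norm_sq h.singular_memLp).congr (Eventually.of_forall fun x => ?_)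
  simp only
  rw [norm_smul, mul_pow, Real.norm_of_nonneg (Real.sqrt_nonneg _),
    Real.sq_sqrt (Real.rpow_nonneg (norm_nonneg _) _)]

lemma InFormDomain.integrable_growth {u : LpRN N 2} {G : Fin N → LpRN N 2}
    (h : InFormDomain α β u G) : Integrable fun x : 𝔼 => ‖x‖ ^ β * ‖u x‖ ^ 2 := by
  refine (integrable_norm_sq h.growth_memLp).congr (Eventually.of_forall fun x => ?_)
  simp only
  rw [norm_smul, mul_pow, Real.norm_of_nonneg (Real.sqrt_nonneg _),
    Real.sq_sqrt (Real.rpow_nonneg (norm_nonneg _) _)]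

lemma InFormDomain.integrable_gradient {u : LpRN N 2} {G : Fin N → LpRN N 2}
    (h : InFormDomain α β u G) (i : Fin N) :
    Integrable fun x : 𝔼 => (1 + ‖x‖ ^ α) * ‖G i x‖ ^ 2 := by
  refine (integrable_norm_sq (h.gradient_memLp i)).congr (Eventually.of_forall fun x => ?_)
  simp only
  rw [norm_smul, mul_pow, Real.norm_of_nonneg (Real.sqrt_nonneg _),
    Real.sq_sqrt (by positivity)]

lemma InFormDomain.integrable_drift_bound {u v : LpRN N 2} {G H : Fin N → LpRN N 2}
    (hu : InFormDomain α β u G) (hv : InFormDomain α β v H) (i : Fin N) :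
    Integrable fun x : 𝔼 => (√(1 + ‖x‖ ^ α) * √(‖x‖ ^ (α - 2))) * (‖v x‖ * ‖G i x‖) := by
  refine (integrable_mul_mul (hu.gradient_memLp i) hv.singular_memLp).congr
    (Eventually.of_forall fun x => ?_)
  simp only
  rw [norm_smul, norm_smul, Real.norm_of_nonneg (Real.sqrt_nonneg _),
    Real.norm_of_nonneg (Real.sqrt_nonneg _)]
  ring

/-- The drift term of the form, after integration by parts. -/
theorem InFormDomain.integral_drift {u : LpRN N 2} {G : Fin N → LpRN N 2}
    (h : InFormDomain α β u G) (hN : 0 < N) (hα0 : 0 < α) (hα2 : α < 2) :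
    2 * ∫ x : 𝔼, ‖x‖ ^ (α - 2) * ∑ i, x i * (conj (u x) * G i x).re
      = -((α - 2 + N) * ∫ x : 𝔼, ‖x‖ ^ (α - 2) * ‖u x‖ ^ 2) := by
  set γ : ℝ := (α - 2) / 2
  have hγ : γ < 0 := by simp only [γ]; linarith
  let ε : ℕ → ℝ := fun n => 1 / ((n : ℝ) + 1)
  have hε : ∀ n, 0 < ε n := fun n => by positivity
  have hε0 : Tendsto ε atTop (𝓝 0) := tendsto_one_div_add_atTop_nhds_zero_nat
  have hp1 : ∀ n (x : 𝔼), 0 < ‖x‖ ^ 2 + ε n := fun n x => by have := hε n; positivity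
  have hp2 : ∀ n (x : 𝔼), 0 < 1 + ε n * ‖x‖ ^ 2 := fun n x => by have := hε n; positivity
  -- Regularization of `|x|^{α-2}`: the first factor removes the singularity at `0`, and the second
  -- provides the decay that keeps `ζ|x|` bounded even when `α > 1`. Below, `ρ` is such that `∇ζ =
  -- ζρ x`.
  let ζ : ℕ → 𝔼 → ℝ := fun n x => (‖x‖ ^ 2 + ε n) ^ γ * (1 + ε n * ‖x‖ ^ 2)⁻¹
  let ρ : ℕ → 𝔼 → ℝ := fun n x =>
    (α - 2) / (‖x‖ ^ 2 + ε n) - 2 * ε n / (1 + ε n * ‖x‖ ^ 2)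
  have hζpos : ∀ n x, 0 < ζ n x := fun n x =>
    mul_pos (Real.rpow_pos_of_pos (hp1 n x) _) (inv_pos.2 (hp2 n x))
  have hζc : ∀ n, ContDiff ℝ ∞ (ζ n) := fun n => by
    have c1 : ContDiff ℝ ∞ fun x : 𝔼 => ‖x‖ ^ 2 + ε n := (contDiff_norm_sq ℝ).add contDiff_const
    have c2 : ContDiff ℝ ∞ fun x : 𝔼 => 1 + ε n * ‖x‖ ^ 2 :=
      contDiff_const.add (contDiff_const.mul (contDiff_norm_sq ℝ))
    exact (c1.rpow_const_of_ne fun x => (hp1 n x).ne').mul (c2.inv fun x => (hp2 n x).ne')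
  have hκ : ∀ n x i, fderiv ℝ (ζ n) x (EuclideanSpace.single i 1)
      = (ζ n x * ρ n x) * x i := fun n x i => by
    have d1 : HasDerivAt (fun r : ℝ => (r + ε n) ^ γ) (1 * γ * (‖x‖ ^ 2 + ε n) ^ (γ - 1))
        (‖x‖ ^ 2) :=
      ((hasDerivAt_id (‖x‖ ^ 2)).add_const (ε n)).rpow_const (Or.inl (hp1 n x).ne')
    have d2 : HasDerivAt (fun r : ℝ => (1 + ε n * r)⁻¹)
        (-(ε n * 1) / (1 + ε n * ‖x‖ ^ 2) ^ 2) (‖x‖ ^ 2) :=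
      (((hasDerivAt_id (‖x‖ ^ 2)).const_mul (ε n)).const_add 1).inv (hp2 n x).ne'
    have h2 := hasFDerivAt_comp_norm_sq (d1.mul d2) i
    have h3 : fderiv ℝ (ζ n) x (EuclideanSpace.single i 1) = _ := h2
    rw [h3]
    have h4 : (‖x‖ ^ 2 + ε n) ^ (γ - 1) = (‖x‖ ^ 2 + ε n) ^ γ / (‖x‖ ^ 2 + ε n) :=
      Real.rpow_sub_one (hp1 n x).ne' _
    rw [h4]
    have h5 : α - 2 = 2 * γ := by simp only [γ]; ring
    simp only [ζ, ρ]
    rw [h5]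
    have e1 := (hp1 n x).ne'
    have e2 := (hp2 n x).ne'
    generalize (‖x‖ ^ 2 + ε n) ^ γ = P
    generalize ‖x‖ ^ 2 + ε n = Q at e1
    generalize 1 + ε n * ‖x‖ ^ 2 = R at e2
    field_simp
    ring
  have hρ : ∀ n x, |ρ n x| * ‖x‖ ^ 2 ≤ 4 := fun n x => by
    have b1 : |(α - 2) / (‖x‖ ^ 2 + ε n)| * ‖x‖ ^ 2 ≤ 2 := by
      rw [abs_div, abs_of_pos (hp1 n x), div_mul_eq_mul_div, div_le_iff₀ (hp1 n x),
        abs_of_neg (by linarith)]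
      nlinarith [hε n, sq_nonneg ‖x‖]
    have b2 : |2 * ε n / (1 + ε n * ‖x‖ ^ 2)| * ‖x‖ ^ 2 ≤ 2 := by
      rw [abs_div, abs_of_pos (hp2 n x), div_mul_eq_mul_div, div_le_iff₀ (hp2 n x),
        abs_of_pos (by linarith [hε n])]
      nlinarith [hε n, sq_nonneg ‖x‖]
    calc |ρ n x| * ‖x‖ ^ 2 ≤ (|(α - 2) / (‖x‖ ^ 2 + ε n)|
          + |2 * ε n / (1 + ε n * ‖x‖ ^ 2)|) * ‖x‖ ^ 2 := by
          gcongr; exact abs_sub _ _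
      _ ≤ 4 := by rw [add_mul]; linarith
  have hζA : ∀ n x, ζ n x ≤ ε n ^ γ * (1 + ε n * ‖x‖ ^ 2)⁻¹ := fun n x => by
    refine mul_le_mul_of_nonneg_right ?_ (inv_pos.2 (hp2 n x)).le
    exact Real.rpow_le_rpow_of_nonpos (hε n) (by nlinarith [sq_nonneg ‖x‖]) hγ.le
  have hζsing : ∀ n x, x ≠ 0 → ζ n x ≤ ‖x‖ ^ (α - 2) := fun n x hx => by
    have hx' : 0 < ‖x‖ := norm_pos_iff.2 hx
    have e : ‖x‖ ^ (α - 2) = (‖x‖ ^ 2) ^ γ := by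
      rw [← Real.rpow_natCast, ← Real.rpow_mul hx'.le]
      congr 1
      simp only [γ]
      push_cast
      ring
    rw [e]
    have b1 : (‖x‖ ^ 2 + ε n) ^ γ ≤ (‖x‖ ^ 2) ^ γ :=
      Real.rpow_le_rpow_of_nonpos (by positivity) (by linarith [hε n]) hγ.le
    have b2 : (1 + ε n * ‖x‖ ^ 2)⁻¹ ≤ 1 :=
      inv_le_one_of_one_le₀ (by nlinarith [hε n, sq_nonneg ‖x‖])
    calc ζ n x ≤ (‖x‖ ^ 2) ^ γ * 1 :=
          mul_le_mul b1 b2 (inv_pos.2 (hp2 n x)).le (by positivity)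
      _ = _ := mul_one _
  have hrad : ∀ n, 2 * ∫ x, ζ n x * ∑ i, x i * (conj (u x) * G i x).re
      = -∫ x, (N * ζ n x + (ζ n x * ρ n x) * ‖x‖ ^ 2) * ‖u x‖ ^ 2 := fun n => by
    have hA : 0 < ε n ^ γ := Real.rpow_pos_of_pos (hε n) _
    have hi := inv_pos.2 (hε n)
    have hinv1 : ∀ x : 𝔼, (1 + ε n * ‖x‖ ^ 2)⁻¹ ≤ 1 := fun x =>
      inv_le_one_of_one_le₀ (by nlinarith [hε n, sq_nonneg ‖x‖])
    have hζA' : ∀ x, ζ n x ≤ ε n ^ γ := fun x =>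
      (hζA n x).trans (mul_le_of_le_one_right hA.le (hinv1 x))
    refine h.weakGradient.integral_radial (hζc n) (hκ n) (C := ε n ^ γ * (4 + (ε n)⁻¹))
      (fun x => ?_) (fun x => ?_) (fun x => ?_)
    · rw [abs_of_pos (hζpos n x)]
      nlinarith [hζA' x]
    · rw [abs_of_pos (hζpos n x)]
      have b : (1 + ε n * ‖x‖ ^ 2)⁻¹ * ‖x‖ ≤ 1 + (ε n)⁻¹ := by
        rw [inv_mul_le_iff₀ (hp2 n x)]
        have : ε n * (ε n)⁻¹ = 1 := mul_inv_cancel₀ (hε n).ne'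
        nlinarith [sq_nonneg (‖x‖ - 1), hε n, mul_nonneg (hε n).le (sq_nonneg ‖x‖)]
      calc ζ n x * ‖x‖ ≤ ε n ^ γ * (1 + ε n * ‖x‖ ^ 2)⁻¹ * ‖x‖ :=
            mul_le_mul_of_nonneg_right (hζA n x) (norm_nonneg _)
        _ = ε n ^ γ * ((1 + ε n * ‖x‖ ^ 2)⁻¹ * ‖x‖) := by ring
        _ ≤ ε n ^ γ * (4 + (ε n)⁻¹) := by gcongr; linarith
    · rw [abs_mul, abs_of_pos (hζpos n x), mul_assoc]
      calc ζ n x * (|ρ n x| * ‖x‖ ^ 2) ≤ ε n ^ γ * 4 :=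
            mul_le_mul (hζA' x) (hρ n x) (by positivity) hA.le
        _ ≤ _ := by gcongr; linarith
  have hζlim : ∀ x : 𝔼, x ≠ 0 → Tendsto (fun n => ζ n x) atTop (𝓝 (‖x‖ ^ (α - 2))) :=
    fun x hx => by
    have hx' : 0 < ‖x‖ := norm_pos_iff.2 hx
    have e : ‖x‖ ^ (α - 2) = (‖x‖ ^ 2 + 0) ^ γ * (1 + 0 * ‖x‖ ^ 2)⁻¹ := by
      rw [add_zero, zero_mul, add_zero, inv_one, mul_one, ← Real.rpow_natCast,
        ← Real.rpow_mul hx'.le]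
      congr 1
      simp only [γ]
      push_cast
      ring
    rw [e]
    refine Tendsto.mul ?_ ?_
    · exact (tendsto_const_nhds.add hε0).rpow_const (Or.inl (by positivity))
    · exact (tendsto_const_nhds.add (hε0.mul_const _)).inv₀ (by simp)
  have hρlim : ∀ x : 𝔼, x ≠ 0 → Tendsto (fun n => ρ n x * ‖x‖ ^ 2) atTop (𝓝 (α - 2)) :=
    fun x hx => by
    have hx' : 0 < ‖x‖ := norm_pos_iff.2 hx
    have e : α - 2 = ((α - 2) / (‖x‖ ^ 2 + 0) - 2 * 0 / (1 + 0 * ‖x‖ ^ 2)) * ‖x‖ ^ 2 := by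
      field_simp
      ring
    rw [e]
    refine (Tendsto.sub ?_ ?_).mul_const _
    · exact (tendsto_const_nhds).div (tendsto_const_nhds.add hε0) (by positivity)
    · exact (hε0.const_mul 2).div (tendsto_const_nhds.add (hε0.mul_const _)) (by simp)
  have hne := ae_ne_zero hN
  have L1 : Tendsto (fun n => ∫ x, ζ n x * ∑ i, x i * (conj (u x) * G i x).re) atTop
      (𝓝 (∫ x : 𝔼, ‖x‖ ^ (α - 2) * ∑ i, x i * (conj (u x) * G i x).re)) := by
    refine tendsto_integral_of_dominated_convergence
      (fun x => ∑ i, (√(1 + ‖x‖ ^ α) * √(‖x‖ ^ (α - 2))) * (‖u x‖ * ‖G i x‖)) (fun n => ?_)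
      (integrable_finsetSum _ fun i _ => h.integrable_drift_bound h i) (fun n => ?_) ?_
    · refine (hζc n).continuous.aestronglyMeasurable.mul ?_
      refine Finset.aestronglyMeasurable_fun_sum _ fun i _ => ?_
      exact (by fun_prop : Continuous fun x : 𝔼 => x i).aestronglyMeasurable.mul
        (aestronglyMeasurable_re_conj_mul u (G i))
    · filter_upwards [hne] with x hx
      have hx' : 0 < ‖x‖ := norm_pos_iff.2 hx
      rw [Finset.mul_sum]
      refine (norm_sum_le _ _).trans (Finset.sum_le_sum fun i _ => ?_)
      rw [norm_mul (ζ n x), norm_mul (x i), Real.norm_of_nonneg (hζpos n x).le, ← mul_assoc]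
      have b1 : ζ n x * ‖x i‖ ≤ √(1 + ‖x‖ ^ α) * √(‖x‖ ^ (α - 2)) :=
        (mul_le_mul (hζsing n x hx) (abs_apply_le_norm x i) (abs_nonneg _)
          (by positivity)).trans (rpow_sub_one_le hx')
      exact mul_le_mul b1 (abs_re_conj_mul_le _ _) (norm_nonneg _) (by positivity)
    · filter_upwards [hne] with x hx
      exact (hζlim x hx).mul_const _
  have L2 : Tendsto (fun n => ∫ x, (N * ζ n x + (ζ n x * ρ n x) * ‖x‖ ^ 2) * ‖u x‖ ^ 2) atTop
      (𝓝 (∫ x : 𝔼, (α - 2 + N) * (‖x‖ ^ (α - 2) * ‖u x‖ ^ 2))) := by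
    refine tendsto_integral_of_dominated_convergence
      (fun x => (N + 4) * (‖x‖ ^ (α - 2) * ‖u x‖ ^ 2)) (fun n => ?_)
      (h.integrable_singular.const_mul _) (fun n => ?_) ?_
    · have hρm : Measurable (ρ n) := by
        simp only [ρ]
        fun_prop
      have hζm := (hζc n).continuous.measurable
      have hm : Measurable fun x : 𝔼 => N * ζ n x + (ζ n x * ρ n x) * ‖x‖ ^ 2 := by fun_prop
      exact hm.aestronglyMeasurable.mul ((Lp.aestronglyMeasurable u).norm.pow 2)
    · filter_upwards [hne] with x hx
      suffices key : |N * ζ n x + ζ n x * ρ n x * ‖x‖ ^ 2| ≤ (N + 4) * ‖x‖ ^ (α - 2) by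
        rw [norm_mul, Real.norm_of_nonneg (sq_nonneg ‖u x‖)]
        exact (mul_le_mul_of_nonneg_right key (sq_nonneg _)).trans (le_of_eq (by ring))
      have b1 := hζsing n x hx
      have b2 : |ζ n x * ρ n x * ‖x‖ ^ 2| ≤ ζ n x * 4 := by
        rw [abs_mul, abs_mul, abs_of_pos (hζpos n x), abs_of_nonneg (sq_nonneg ‖x‖), mul_assoc]
        exact mul_le_mul_of_nonneg_left (hρ n x) (hζpos n x).le
      have b3 : |N * ζ n x| = N * ζ n x :=
        abs_of_nonneg (mul_nonneg (Nat.cast_nonneg _) (hζpos n x).le)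
      calc _ ≤ |N * ζ n x| + |ζ n x * ρ n x * ‖x‖ ^ 2| := abs_add_le _ _
        _ ≤ (N + 4) * ζ n x := by rw [b3]; linarith
        _ ≤ _ := by gcongr
    · filter_upwards [hne] with x hx
      have l1 := ((hζlim x hx).const_mul (N : ℝ)).add ((hζlim x hx).mul (hρlim x hx))
      have l2 := l1.mul_const (‖u x‖ ^ 2)
      convert l2 using 2
      · rename_i n
        ring
      · ring
  rw [integral_const_mul] at L2
  refine tendsto_nhds_unique ((L1.const_mul 2).congr hrad) L2.neg

/-- The quadratic form inequality on which coercivity and `L^p`-dissipativity rest. -/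
theorem InFormDomain.core_inequality {u : LpRN N 2} {G : Fin N → LpRN N 2}
    (h : InFormDomain α β u G) (hN : 3 ≤ N) (hα0 : 0 < α) (hα2 : α < 2) {b c lam : ℝ}
    (hpos : ∀ x : 𝔼, x ≠ 0 → 0 < (((N : ℝ) - 2) / 2) ^ 2 / (2 * ‖x‖ ^ 2)
        + (c - 1 - (α - b) / 2 * (α - 2 + N)) * ‖x‖ ^ (α - 2) + lam) :
    (∫ x, ∑ i, ‖G i x‖ ^ 2) / 2 + ∫ x : 𝔼, ‖x‖ ^ (α - 2) * ‖u x‖ ^ 2 ≤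
      (∫ x, ∑ i, ‖G i x‖ ^ 2)
        + (α - b) * (∫ x : 𝔼, ‖x‖ ^ (α - 2) * ∑ i, x i * (conj (u x) * G i x).re)
        + c * (∫ x : 𝔼, ‖x‖ ^ (α - 2) * ‖u x‖ ^ 2) + lam * ∫ x, ‖u x‖ ^ 2 := by
  obtain ⟨hi, hh⟩ := h.weakGradient.hardy hN
  have hd := h.integral_drift (by omega) hα0 hα2
  have hs := h.integrable_singular
  have hu2 := integrable_norm_sq (Lp.memLp u)
  set k : ℝ := ((N : ℝ) - 2) / 2
  -- The pointwise hypothesis is multiplied by `|u|²` and integrated. Half of the gradient integral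
  -- will pay for the Hardy term, and the `-1` in the coefficient leaves the spare singular
  -- integral.
  have h0 : 0 ≤ ∫ x : 𝔼, (k ^ 2 / 2 * ((‖x‖ ^ 2)⁻¹ * ‖u x‖ ^ 2)
      + (c - 1 - (α - b) / 2 * (α - 2 + N)) * (‖x‖ ^ (α - 2) * ‖u x‖ ^ 2)
      + lam * ‖u x‖ ^ 2) := by
    refine integral_nonneg_of_ae ?_
    filter_upwards [ae_ne_zero (N := N) (by omega)] with x hx
    have h1 := mul_nonneg (hpos x hx).le (sq_nonneg ‖u x‖)
    refine h1.trans (le_of_eq ?_)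
    have : ‖x‖ ≠ 0 := norm_ne_zero_iff.2 hx
    field_simp
  rw [integral_add_add (hi.const_mul _) (hs.const_mul _) (hu2.const_mul _),
    integral_const_mul, integral_const_mul, integral_const_mul] at h0
  have hd' : (α - b) * ∫ x : 𝔼, ‖x‖ ^ (α - 2) * ∑ i, x i * (conj (u x) * G i x).re
      = -((α - b) / 2 * (α - 2 + N) * ∫ x : 𝔼, ‖x‖ ^ (α - 2) * ‖u x‖ ^ 2) := by
    have := congrArg (fun z => (α - b) / 2 * z) hd
    simp only at this
    linarith
  rw [hd']
  nlinarith

end Drift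

/-! ### The form, its coercivity and the linear structure of its domain -/

section FormDomain

variable {N : ℕ} {α β : ℝ}

local notation "𝔼" => EuclideanSpace ℝ (Fin N)

lemma integrable_mul_conj {f g : 𝔼 → ℂ} (hf : MemLp f 2 volume) (hg : MemLp g 2 volume) :
    Integrable fun x => f x * conj (g x) := by
  refine (integrable_mul_mul hf hg).mono' (hf.1.mul
    (Complex.continuous_conj.comp_aestronglyMeasurable hg.1)) (Eventually.of_forall fun x => ?_)
  rw [norm_mul, Complex.norm_conj]

/-- The integrand of the form without the potential `c|x|^{α-2}`. -/
noncomputable def sesqIntegrand (α β b lam : ℝ) (u : LpRN N 2) (G : Fin N → LpRN N 2)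
    (v : LpRN N 2) (H : Fin N → LpRN N 2) (x : 𝔼) : ℂ :=
  ((1 + ‖x‖ ^ α : ℝ) : ℂ) * ∑ i, G i x * conj (H i x)
    + (((α - b) * ‖x‖ ^ (α - 2) : ℝ) : ℂ) * (∑ i, (x i : ℂ) * G i x) * conj (v x)
    + ((‖x‖ ^ β : ℝ) : ℂ) * u x * conj (v x) + (lam : ℂ) * u x * conj (v x)

lemma sesqForm_zero_eq (b lam : ℝ) (u : LpRN N 2) (G : Fin N → LpRN N 2)
    (v : LpRN N 2) (H : Fin N → LpRN N 2) :
    sesqForm α β b 0 lam u G v H = ∫ x, sesqIntegrand α β b lam u G v H x := by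
  simp [sesqForm, sesqIntegrand]

lemma InFormDomain.integrable_sesqIntegrand {u v : LpRN N 2} {G H : Fin N → LpRN N 2}
    (hu : InFormDomain α β u G) (hv : InFormDomain α β v H) (hN : 0 < N) (b lam : ℝ) :
    Integrable (sesqIntegrand α β b lam u G v H) := by
  have h1 : Integrable fun x : 𝔼 => ((1 + ‖x‖ ^ α : ℝ) : ℂ) * ∑ i, G i x * conj (H i x) := by
    have := integrable_finsetSum Finset.univ fun i _ =>
      integrable_mul_conj (hu.gradient_memLp i) (hv.gradient_memLp i)
    refine this.congr (Eventually.of_forall fun x => ?_)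
    simp only [Finset.mul_sum, Complex.real_smul, map_mul, Complex.conj_ofReal]
    refine Finset.sum_congr rfl fun i _ => ?_
    have : ((1 + ‖x‖ ^ α : ℝ) : ℂ) = (√(1 + ‖x‖ ^ α) : ℂ) * √(1 + ‖x‖ ^ α) := by
      rw [← Complex.ofReal_mul, Real.mul_self_sqrt (by positivity)]
    rw [this]
    ring
  have h2 : Integrable fun x : 𝔼 =>
      (((α - b) * ‖x‖ ^ (α - 2) : ℝ) : ℂ) * (∑ i, (x i : ℂ) * G i x) * conj (v x) := by
    have h3 : ∀ i : Fin N, Integrable fun x : 𝔼 =>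
        ((‖x‖ ^ (α - 2) * x i : ℝ) : ℂ) * (G i x * conj (v x)) := fun i => by
      refine (hu.integrable_drift_bound hv i).mono' ?_ ?_
      · have hm : Measurable fun x : 𝔼 => ((‖x‖ ^ (α - 2) * x i : ℝ) : ℂ) := by fun_prop
        exact hm.aestronglyMeasurable.mul ((Lp.aestronglyMeasurable (G i)).mul
          (Complex.continuous_conj.comp_aestronglyMeasurable (Lp.aestronglyMeasurable v)))
      · filter_upwards [ae_ne_zero hN] with x hx
        rw [norm_mul, norm_mul, Complex.norm_conj, mul_comm ‖G i x‖, Complex.norm_real, norm_mul,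
          Real.norm_of_nonneg (Real.rpow_nonneg (norm_nonneg _) _)]
        refine mul_le_mul_of_nonneg_right ?_ (by positivity)
        exact (mul_le_mul_of_nonneg_left (abs_apply_le_norm x i)
          (Real.rpow_nonneg (norm_nonneg _) _)).trans (rpow_sub_one_le (norm_pos_iff.2 hx))
    refine ((integrable_finsetSum Finset.univ fun i _ => h3 i).const_mul ((α - b : ℝ) : ℂ)).congr
      (Eventually.of_forall fun x => ?_)
    simp only [Finset.mul_sum, Finset.sum_mul, Complex.ofReal_mul]
    exact Finset.sum_congr rfl fun i _ => by ring
  have h3 : Integrable fun x : 𝔼 => ((‖x‖ ^ β : ℝ) : ℂ) * u x * conj (v x) := by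
    refine (integrable_mul_conj hu.growth_memLp hv.growth_memLp).congr
      (Eventually.of_forall fun x => ?_)
    simp only [Complex.real_smul, map_mul, Complex.conj_ofReal]
    have : ((‖x‖ ^ β : ℝ) : ℂ) = (√(‖x‖ ^ β) : ℂ) * √(‖x‖ ^ β) := by
      rw [← Complex.ofReal_mul, Real.mul_self_sqrt (Real.rpow_nonneg (norm_nonneg _) _)]
    rw [this]
    ring
  have h4 : Integrable fun x : 𝔼 => (lam : ℂ) * u x * conj (v x) := by
    simpa only [mul_assoc] using
      (integrable_mul_conj (Lp.memLp u) (Lp.memLp v)).const_mul (lam : ℂ)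
  exact ((h1.add h2).add h3).add h4

lemma InFormDomain.re_sesqForm {u v : LpRN N 2} {G H : Fin N → LpRN N 2}
    (hu : InFormDomain α β u G) (hv : InFormDomain α β v H) (hN : 0 < N) (b lam : ℝ) :
    (sesqForm α β b 0 lam u G v H).re = ∫ x, (sesqIntegrand α β b lam u G v H x).re := by
  rw [sesqForm_zero_eq]
  exact (integral_re (hu.integrable_sesqIntegrand hv hN b lam)).symm

/-- The integrand of the quadratic form which is nonnegative by Hardy's inequality. -/
noncomputable def coreIntegrand (α b c lam : ℝ) (u : LpRN N 2) (G : Fin N → LpRN N 2) (x : 𝔼) : ℝ :=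
  (∑ i, ‖G i x‖ ^ 2) / 2 + (α - b) * (‖x‖ ^ (α - 2) * ∑ i, x i * (conj (u x) * G i x).re)
    + (c - 1) * (‖x‖ ^ (α - 2) * ‖u x‖ ^ 2) + lam * ‖u x‖ ^ 2

/-- `InFormDomain.core_inequality` with all terms on one side. Keeping the integrand visible allows
later integrands to be compared with it pointwise, including that of a truncated power of the
solution. -/
theorem InFormDomain.coreIntegrand_nonneg {u : LpRN N 2} {G : Fin N → LpRN N 2}
    (h : InFormDomain α β u G) (hN : 3 ≤ N) (hα0 : 0 < α) (hα2 : α < 2) {b c lam : ℝ}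
    (hpos : ∀ x : 𝔼, x ≠ 0 → 0 < (((N : ℝ) - 2) / 2) ^ 2 / (2 * ‖x‖ ^ 2)
        + (c - 1 - (α - b) / 2 * (α - 2 + N)) * ‖x‖ ^ (α - 2) + lam) :
    Integrable (coreIntegrand α b c lam u G) ∧ 0 ≤ ∫ x, coreIntegrand α b c lam u G x := by
  have hcore := h.core_inequality hN hα0 hα2 hpos
  have iG : Integrable fun x => (∑ i, ‖G i x‖ ^ 2) / 2 :=
    (integrable_finsetSum _ fun i _ => integrable_norm_sq (Lp.memLp (G i))).div_const _
  have iD : Integrable fun x : 𝔼 => (α - b) * (‖x‖ ^ (α - 2)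
      * ∑ i, x i * (conj (u x) * G i x).re) := by
    have h1 : Integrable fun x : 𝔼 => ‖x‖ ^ (α - 2)
      * ∑ i, x i * (conj (u x) * G i x).re := by
      refine (integrable_finsetSum Finset.univ fun i _ => h.integrable_drift_bound h i).mono' ?_ ?_
      · have hm : Measurable fun x : 𝔼 => ‖x‖ ^ (α - 2) := by fun_prop
        refine hm.aestronglyMeasurable.mul (Finset.aestronglyMeasurable_fun_sum _ fun i _ => ?_)
        exact (by fun_prop : Continuous fun x : 𝔼 => x i).aestronglyMeasurable.mul
          (aestronglyMeasurable_re_conj_mul u (G i))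
      · filter_upwards [ae_ne_zero (N := N) (by omega)] with x hx
        rw [Finset.mul_sum]
        refine (norm_sum_le _ _).trans (Finset.sum_le_sum fun i _ => ?_)
        rw [norm_mul, norm_mul (x i), ← mul_assoc,
          Real.norm_of_nonneg (Real.rpow_nonneg (norm_nonneg _) _)]
        refine mul_le_mul ?_ (abs_re_conj_mul_le _ _) (norm_nonneg _) (by positivity)
        exact (mul_le_mul_of_nonneg_left (abs_apply_le_norm x i)
          (Real.rpow_nonneg (norm_nonneg _) _)).trans (rpow_sub_one_le (norm_pos_iff.2 hx))
    exact h1.const_mul _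
  have iS := h.integrable_singular.const_mul (c - 1)
  have iU := (integrable_norm_sq (Lp.memLp u)).const_mul lam
  have i2 : Integrable fun x : 𝔼 => (∑ i, ‖G i x‖ ^ 2) / 2
      + (α - b) * (‖x‖ ^ (α - 2) * ∑ i, x i * (conj (u x) * G i x).re)
      + (c - 1) * (‖x‖ ^ (α - 2) * ‖u x‖ ^ 2) := (iG.add iD).add iS
  refine ⟨i2.add iU, ?_⟩
  unfold coreIntegrand
  rw [integral_add i2 iU, integral_add_add iG iD iS, integral_div, integral_const_mul,
    integral_const_mul, integral_const_mul]
  linarith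

/-- Coercivity of the form perturbed by a potential which dominates `c|x|^{α-2}`. -/
theorem InFormDomain.coercive {u : LpRN N 2} {G : Fin N → LpRN N 2}
    (h : InFormDomain α β u G) (hN : 3 ≤ N) (hα0 : 0 < α) (hα2 : α < 2) {b c lam : ℝ}
    (hpos : ∀ x : 𝔼, x ≠ 0 → 0 < (((N : ℝ) - 2) / 2) ^ 2 / (2 * ‖x‖ ^ 2)
        + (c - 1 - (α - b) / 2 * (α - 2 + N)) * ‖x‖ ^ (α - 2) + lam)
    {V : 𝔼 → ℝ} (hV : AEStronglyMeasurable V volume) {C : ℝ} (hC : ∀ᵐ x, |V x| ≤ C)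
    (hVc : ∀ᵐ x : 𝔼, c * ‖x‖ ^ (α - 2) ≤ V x) :
    ((∫ x : 𝔼, ∑ i, (1 + ‖x‖ ^ α) * ‖G i x‖ ^ 2)
        + ∫ x : 𝔼, (‖x‖ ^ (α - 2) + ‖x‖ ^ β) * ‖u x‖ ^ 2) / 2
      ≤ (sesqForm α β b 0 lam u G u G).re + ∫ x, V x * ‖u x‖ ^ 2 := by
  obtain ⟨hi, h0⟩ := h.coreIntegrand_nonneg hN hα0 hα2 hpos
  have i1 : Integrable fun x : 𝔼 => ∑ i, (1 + ‖x‖ ^ α) * ‖G i x‖ ^ 2 :=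
    integrable_finsetSum _ fun i _ => h.integrable_gradient i
  have i2 : Integrable fun x : 𝔼 => (‖x‖ ^ (α - 2) + ‖x‖ ^ β) * ‖u x‖ ^ 2 := by
    simp only [add_mul]
    exact h.integrable_singular.add h.integrable_growth
  have i3 : Integrable fun x => V x * ‖u x‖ ^ 2 :=
    (integrable_norm_sq (Lp.memLp u)).bdd_mul hV hC
  have i4 : Integrable fun x => (sesqIntegrand α β b lam u G u G x).re :=
    (h.integrable_sesqIntegrand h (by omega) b lam).re
  rw [h.re_sesqForm h (by omega), ← integral_add i1 i2, ← integral_add i4 i3, ← integral_div]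
  have i5 : Integrable fun x : 𝔼 => ((∑ i, (1 + ‖x‖ ^ α) * ‖G i x‖ ^ 2)
      + (‖x‖ ^ (α - 2) + ‖x‖ ^ β) * ‖u x‖ ^ 2) / 2 := (i1.add i2).div_const 2
  have i6 : Integrable fun x : 𝔼 => (sesqIntegrand α β b lam u G u G x).re + V x * ‖u x‖ ^ 2 :=
    i4.add i3
  rw [← sub_nonneg, ← integral_sub i6 i5]
  refine h0.trans (integral_mono_ae hi (i6.sub i5) ?_)
  filter_upwards [hVc] with x hx
  have e1 : (sesqIntegrand α β b lam u G u G x).re = (1 + ‖x‖ ^ α) * ∑ i, ‖G i x‖ ^ 2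
      + (α - b) * (‖x‖ ^ (α - 2) * ∑ i, x i * (conj (u x) * G i x).re)
      + ‖x‖ ^ β * ‖u x‖ ^ 2 + lam * ‖u x‖ ^ 2 := by
    have f1 : ∀ z : ℂ, z * conj z = ((‖z‖ ^ 2 : ℝ) : ℂ) := fun z => by
      rw [Complex.mul_conj, Complex.normSq_eq_norm_sq]
    have f2 : (∑ i, (x i : ℂ) * G i x) * conj (u x)
        = ∑ i, (x i : ℂ) * (conj (u x) * G i x) := by
      rw [Finset.sum_mul]
      exact Finset.sum_congr rfl fun i _ => by ring
    simp only [sesqIntegrand, mul_assoc, f1, f2, ← Complex.ofReal_sum, Complex.add_re,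
      Complex.re_ofReal_mul, Complex.re_sum, Complex.ofReal_re]
  have e2 : ∑ i, (1 + ‖x‖ ^ α) * ‖G i x‖ ^ 2 = (1 + ‖x‖ ^ α) * ∑ i, ‖G i x‖ ^ 2 :=
    (Finset.mul_sum _ _ _).symm
  simp only [coreIntegrand, e1, e2]
  have p1 : 0 ≤ ‖x‖ ^ α * ∑ i, ‖G i x‖ ^ 2 := by positivity
  have p2 : 0 ≤ ‖x‖ ^ β * ‖u x‖ ^ 2 := by positivity
  have p3 : 0 ≤ ‖x‖ ^ (α - 2) * ‖u x‖ ^ 2 := by positivity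
  have p4 : 0 ≤ (V x - c * ‖x‖ ^ (α - 2)) * ‖u x‖ ^ 2 :=
    mul_nonneg (sub_nonneg.2 hx) (by positivity)
  nlinarith

/-- Written with inner products, the condition is visibly linear and closed in the pair consisting
of the function and its gradient. -/
lemma isWeakGradient_iff_inner {u : LpRN N 2} {G : Fin N → LpRN N 2} :
    IsWeakGradient u G ↔ ∀ (i : Fin N) (φ : 𝔼 → ℝ) (hφ : ContDiff ℝ ∞ φ)
      (hc : HasCompactSupport φ),
      inner ℂ (testLp _ (continuous_fderiv_apply hφ (EuclideanSpace.single i 1))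
        (hasCompactSupport_fderiv_apply hc (EuclideanSpace.single i 1))) u
        = -inner ℂ (testLp φ hφ.continuous hc) (G i) := by
  simp only [inner_testLp]
  rfl

lemma IsWeakGradient.add {u v : LpRN N 2} {G H : Fin N → LpRN N 2} (hu : IsWeakGradient u G)
    (hv : IsWeakGradient v H) : IsWeakGradient (u + v) (G + H) := by
  rw [isWeakGradient_iff_inner] at *
  intro i φ hφ hc
  rw [Pi.add_apply, inner_add_right, inner_add_right, hu i φ hφ hc, hv i φ hφ hc]
  ring

lemma IsWeakGradient.smul {u : LpRN N 2} {G : Fin N → LpRN N 2} (hu : IsWeakGradient u G)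
    (a : ℂ) : IsWeakGradient (a • u) (a • G) := by
  rw [isWeakGradient_iff_inner] at *
  intro i φ hφ hc
  rw [Pi.smul_apply, inner_smul_right, inner_smul_right, hu i φ hφ hc]
  ring

lemma isWeakGradient_zero : IsWeakGradient (0 : LpRN N 2) 0 := by
  rw [isWeakGradient_iff_inner]
  intro i φ hφ hc
  simp

lemma InFormDomain.add {u v : LpRN N 2} {G H : Fin N → LpRN N 2} (hu : InFormDomain α β u G)
    (hv : InFormDomain α β v H) : InFormDomain α β (u + v) (G + H) := by
  refine ⟨hu.weakGradient.add hv.weakGradient, fun i => ?_, ?_, ?_⟩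
  · refine ((hu.gradient_memLp i).add (hv.gradient_memLp i)).ae_eq ?_
    filter_upwards [Lp.coeFn_add (G i) (H i)] with x hx
    simp only [Pi.add_apply, hx, smul_add]
  · refine (hu.singular_memLp.add hv.singular_memLp).ae_eq ?_
    filter_upwards [Lp.coeFn_add u v] with x hx
    simp only [Pi.add_apply, hx, smul_add]
  · refine (hu.growth_memLp.add hv.growth_memLp).ae_eq ?_
    filter_upwards [Lp.coeFn_add u v] with x hx
    simp only [Pi.add_apply, hx, smul_add]

lemma InFormDomain.smul {u : LpRN N 2} {G : Fin N → LpRN N 2} (hu : InFormDomain α β u G)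
    (a : ℂ) : InFormDomain α β (a • u) (a • G) := by
  refine ⟨hu.weakGradient.smul a, fun i => ?_, ?_, ?_⟩
  · refine ((hu.gradient_memLp i).const_smul a).ae_eq ?_
    filter_upwards [Lp.coeFn_smul a (G i)] with x hx
    simp only [Pi.smul_apply, hx, smul_comm a]
  · refine (hu.singular_memLp.const_smul a).ae_eq ?_
    filter_upwards [Lp.coeFn_smul a u] with x hx
    simp only [Pi.smul_apply, hx, smul_comm a]
  · refine (hu.growth_memLp.const_smul a).ae_eq ?_
    filter_upwards [Lp.coeFn_smul a u] with x hx
    simp only [Pi.smul_apply, hx, smul_comm a]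

end FormDomain

/-! ### Solvability by Lax–Milgram -/

section LaxMilgram

variable {N : ℕ} {α β : ℝ}

local notation "𝔼" => EuclideanSpace ℝ (Fin N)

/-- The singular weight is at least `1` inside the unit ball and the growth weight outside. Thus the
weighted norm controls the `L²` norm without an extra term. -/
lemma one_le_rpow_add_rpow (hα2 : α < 2) (hβ : 0 < β) {r : ℝ} (hr : 0 < r) :
    1 ≤ r ^ (α - 2) + r ^ β := by
  rcases le_total r 1 with h | h
  · have := Real.one_le_rpow_of_pos_of_le_one_of_nonpos hr h (by linarith : α - 2 ≤ 0)
    have := Real.rpow_nonneg hr.le β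
    linarith
  · have := Real.one_le_rpow h hβ.le
    have := Real.rpow_nonneg hr.le (α - 2)
    linarith

lemma inner_eq_integral_mul_conj (f g : LpRN N 2) : inner ℂ f g = ∫ x, g x * conj (f x) := by
  rw [L2.inner_def]
  rfl

lemma integrable_mul_conj_Lp (f g : LpRN N 2) : Integrable fun x => g x * conj (f x) :=
  integrable_mul_conj (Lp.memLp g) (Lp.memLp f)

lemma norm_sq_eq_integral (f : LpRN N 2) : ‖f‖ ^ 2 = ∫ x, ‖f x‖ ^ 2 := by
  have h := re_inner_eq_integral f f
  rw [← RCLike.re_to_complex, inner_self_eq_norm_sq] at h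
  rw [h]
  refine integral_congr_ae (Eventually.of_forall fun x => ?_)
  simp only
  rw [mul_comm, Complex.mul_conj, Complex.ofReal_re, Complex.normSq_eq_norm_sq]

lemma coeFn_finsetSum_Lp {ι : Type*} (s : Finset ι) (f : ι → LpRN N 2) :
    ∀ᵐ x, (∑ i ∈ s, f i : LpRN N 2) x = ∑ i ∈ s, f i x := by
  classical
  induction s using Finset.induction_on with
  | empty => exact Eventually.of_forall fun x => by simp
  | insert i s hi ih =>
    rw [Finset.sum_insert hi]
    filter_upwards [ih, Lp.coeFn_add (f i) (∑ i ∈ s, f i)] with x h1 h2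
    rw [h2, Pi.add_apply, h1, Finset.sum_insert hi]

/-- The Lax–Milgram theorem for an operator on a Hilbert space and a closed subspace. -/
lemma exists_mem_forall_inner_eq {E : Type*} [NormedAddCommGroup E] [InnerProductSpace ℂ E]
    [CompleteSpace E] (K : Submodule ℂ E) (hK : IsClosed (K : Set E)) (T : E →L[ℂ] E) {δ : ℝ}
    (hδ : 0 < δ) (hT : ∀ z ∈ K, δ * ‖z‖ ^ 2 ≤ (inner ℂ z (T z)).re) (w : E) :
    ∃ z ∈ K, ∀ y ∈ K, inner ℂ y (T z) = inner ℂ y w := by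
  have : CompleteSpace K := hK.completeSpace_coe
  let A : K →L[ℂ] K := K.orthogonalProjectionOnto ∘L T ∘L K.subtypeL
  have hin : ∀ (y : K) (e : E), inner ℂ y (K.orthogonalProjectionOnto e) = inner ℂ (y : E) e :=
    fun y e => Submodule.inner_orthogonalProjectionOnto_eq_of_mem_left y e
  have hA : IsUnit A := by
    refine ContinuousLinearMap.isUnit_of_forall_le_norm_inner_map A (c := NNReal.mk δ hδ.le) hδ
      fun z => ?_
    rw [norm_inner_symm, show A z = K.orthogonalProjectionOnto (T z) from rfl, hin]
    calc ‖z‖ ^ 2 * δ = δ * ‖(z : E)‖ ^ 2 := by rw [mul_comm]; rfl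
      _ ≤ _ := hT z z.2
      _ ≤ _ := Complex.re_le_norm _
  obtain ⟨z, hz⟩ := (ContinuousLinearMap.isUnit_iff_bijective.1 hA).2 (K.orthogonalProjectionOnto w)
  refine ⟨z, z.2, fun y hy => ?_⟩
  have h1 := hin ⟨y, hy⟩ (T z)
  have h2 := hin ⟨y, hy⟩ w
  rw [← hz] at h2
  exact h1.symm.trans h2

/-- The map `u ↦ (τu, σ∇u)` identifies the form domain, with its weighted norm, with a closed
subspace `K` of `N+1` copies of `L²`. Completeness is then free, the form plus `V` becomes `⟨y, T
z⟩` for a bounded `T` on the whole product, and `InFormDomain.coercive` is the lower bound `1/2` on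
`K`. -/
theorem exists_formOperator (hN : 3 ≤ N) (hα0 : 0 < α) (hα2 : α < 2) (hβ : 0 < β) {b c lam : ℝ}
    (hpos : ∀ x : 𝔼, x ≠ 0 → 0 < (((N : ℝ) - 2) / 2) ^ 2 / (2 * ‖x‖ ^ 2)
        + (c - 1 - (α - b) / 2 * (α - 2 + N)) * ‖x‖ ^ (α - 2) + lam)
    {V : 𝔼 → ℝ} (hV : AEStronglyMeasurable V volume) {C : ℝ} (hC : ∀ᵐ x, |V x| ≤ C)
    (hVc : ∀ᵐ x : 𝔼, c * ‖x‖ ^ (α - 2) ≤ V x) (f : LpRN N 2) :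
    ∃ u : LpRN N 2, FormOperator α β b 0 lam u (mulOp 2 V hV C hC u - f) := by
  have hne := ae_ne_zero (N := N) (by omega)
  let τ : 𝔼 → ℝ := fun x => √(‖x‖ ^ (α - 2) + ‖x‖ ^ β)
  let σ : 𝔼 → ℝ := fun x => √(1 + ‖x‖ ^ α)
  have hτ1 : ∀ x : 𝔼, x ≠ 0 → 1 ≤ τ x := fun x hx =>
    Real.one_le_sqrt.2 (one_le_rpow_add_rpow hα2 hβ (norm_pos_iff.2 hx))
  have hτ2 : ∀ x : 𝔼, τ x ^ 2 = ‖x‖ ^ (α - 2) + ‖x‖ ^ β := fun x => Real.sq_sqrt (by positivity)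
  have hσ1 : ∀ x : 𝔼, 1 ≤ σ x := fun x =>
    Real.one_le_sqrt.2 (by linarith [Real.rpow_nonneg (norm_nonneg x) α])
  have hσ2 : ∀ x : 𝔼, σ x ^ 2 = 1 + ‖x‖ ^ α := fun x => Real.sq_sqrt (by positivity)
  have hτm : Measurable τ := by fun_prop
  have hσm : Measurable σ := by fun_prop
  have hτi : ∀ᵐ x : 𝔼, |(τ x)⁻¹| ≤ 1 := by
    filter_upwards [hne] with x hx
    rw [abs_inv, abs_of_nonneg (Real.sqrt_nonneg _)]
    exact inv_le_one_of_one_le₀ (hτ1 x hx)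
  have hσi : ∀ᵐ x : 𝔼, |(σ x)⁻¹| ≤ 1 := Eventually.of_forall fun x => by
    rw [abs_inv, abs_of_nonneg (Real.sqrt_nonneg _)]
    exact inv_le_one_of_one_le₀ (hσ1 x)
  -- The drift coefficient in the rescaled coordinates; it is bounded by `1` thanks to
  -- `rpow_sub_one_le`. Likewise `q` below is bounded because `τ² ≥ |x|^β` and `τ² ≥ 1`.
  let d : Fin N → 𝔼 → ℝ := fun i x => ‖x‖ ^ (α - 2) * x i / (σ x * τ x)
  have hdm : ∀ i, AEStronglyMeasurable (d i) (volume : Measure 𝔼) := fun i =>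
    (by fun_prop : Measurable (d i)).aestronglyMeasurable
  have hd : ∀ i, ∀ᵐ x : 𝔼, |d i x| ≤ 1 := fun i => by
    filter_upwards [hne] with x hx
    have p1 : 0 < σ x * τ x := mul_pos (by linarith [hσ1 x]) (by linarith [hτ1 x hx])
    simp only [d]
    rw [abs_div, abs_of_pos p1, div_le_one p1, abs_mul,
      abs_of_nonneg (Real.rpow_nonneg (norm_nonneg _) _)]
    refine (mul_le_mul_of_nonneg_left (abs_apply_le_norm x i)
      (Real.rpow_nonneg (norm_nonneg _) _)).trans
      ((rpow_sub_one_le (norm_pos_iff.2 hx)).trans ?_)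
    refine mul_le_mul_of_nonneg_left (Real.sqrt_le_sqrt ?_) (Real.sqrt_nonneg _)
    linarith [Real.rpow_nonneg (norm_nonneg x) β]
  let q : 𝔼 → ℝ := fun x => (‖x‖ ^ β + lam + V x) / τ x ^ 2
  have hqm : AEStronglyMeasurable q (volume : Measure 𝔼) := by
    have h1 : Measurable fun x : 𝔼 => ‖x‖ ^ β + lam := by fun_prop
    have h2 : Measurable fun x : 𝔼 => (τ x ^ 2)⁻¹ := by fun_prop
    exact (h1.aestronglyMeasurable.add hV).mul h2.aestronglyMeasurable
  have hq : ∀ᵐ x, |q x| ≤ 1 + |lam| + C := by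
    filter_upwards [hne, hC] with x hx hCx
    have p1 : 1 ≤ τ x ^ 2 := one_le_pow₀ (hτ1 x hx)
    have p0 := Real.rpow_nonneg (norm_nonneg x) (α - 2)
    have p2 := Real.rpow_nonneg (norm_nonneg x) β
    have p3 : 0 ≤ |lam| + C := add_nonneg (abs_nonneg _) ((abs_nonneg _).trans hCx)
    simp only [q]
    rw [abs_div, abs_of_pos (by linarith : 0 < τ x ^ 2), div_le_iff₀ (by linarith)]
    calc |‖x‖ ^ β + lam + V x| ≤ |‖x‖ ^ β + lam| + |V x| := abs_add_le _ _
      _ ≤ |‖x‖ ^ β| + |lam| + |V x| := by gcongr; exact abs_add_le _ _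
      _ ≤ ‖x‖ ^ β + (|lam| + C) := by rw [abs_of_nonneg p2]; linarith
      _ ≤ τ x ^ 2 + (|lam| + C) * τ x ^ 2 := by
          refine add_le_add ?_ (le_mul_of_one_le_right p3 p1)
          rw [hτ2]; linarith
      _ = _ := by ring
  let E := PiLp 2 fun _ : Option (Fin N) => LpRN N 2
  let M := mulOp 2 (fun x => (τ x)⁻¹) hτm.inv.aestronglyMeasurable 1 hτi
  let Z := mulOp 2 (fun x => (σ x)⁻¹) hσm.inv.aestronglyMeasurable 1 hσi
  let pr : Option (Fin N) → E →L[ℂ] LpRN N 2 := fun j => PiLp.proj 2 _ j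
  let J : E →L[ℂ] LpRN N 2 := M ∘L pr none
  let Gr : Fin N → E →L[ℂ] LpRN N 2 := fun i => Z ∘L pr (some i)
  let T : E →L[ℂ] E := (PiLp.continuousLinearEquiv 2 ℂ _).symm.toContinuousLinearMap ∘L
    ContinuousLinearMap.pi fun j => match j with
      | none => ((α - b : ℝ) : ℂ) • (∑ i, mulOp 2 (d i) (hdm i) 1 (hd i) ∘L pr (some i))
          + mulOp 2 q hqm _ hq ∘L pr none
      | some i => pr (some i)
  let K : Submodule ℂ E :=
    { carrier := {z | IsWeakGradient (J z) fun i => Gr i z}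
      add_mem' := fun {y z} hy hz => by
        simp only [Set.mem_ofPred_eq, map_add]
        exact IsWeakGradient.add hy hz
      zero_mem' := by
        simp only [Set.mem_ofPred_eq, map_zero]
        exact isWeakGradient_zero
      smul_mem' := fun a z hz => by
        simp only [Set.mem_ofPred_eq, map_smul]
        exact IsWeakGradient.smul hz a }
  have hKmem : ∀ z, z ∈ K ↔ IsWeakGradient (J z) fun i => Gr i z := fun z => Iff.rfl
  have hK : IsClosed (K : Set E) := by
    have : (K : Set E) = {z | IsWeakGradient (J z) fun i => Gr i z} := rfl
    rw [this]
    simp only [isWeakGradient_iff_inner, Set.ofPred_forall]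
    refine isClosed_iInter fun i => isClosed_iInter fun φ => isClosed_iInter fun hφ =>
      isClosed_iInter fun hc => isClosed_eq ?_ ?_
    · exact continuous_const.inner (J.continuous)
    · exact (continuous_const.inner (Gr i).continuous).neg
  have hJ : ∀ z : E, J z =ᵐ[volume] fun x => ((τ x)⁻¹ : ℝ) * z none x := fun z =>
    mulOp_coeFn hτm.inv.aestronglyMeasurable hτi (z none)
  have hG : ∀ (z : E) i, Gr i z =ᵐ[volume] fun x => ((σ x)⁻¹ : ℝ) * z (some i) x := fun z i =>
    mulOp_coeFn hσm.inv.aestronglyMeasurable hσi (z (some i))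
  have hdom : ∀ z ∈ K, InFormDomain α β (J z) fun i => Gr i z := fun z hz => by
    have key : ∀ γ : ℝ, (∀ x : 𝔼, ‖x‖ ^ γ ≤ ‖x‖ ^ (α - 2) + ‖x‖ ^ β) →
        MemLp (fun x : 𝔼 => √(‖x‖ ^ γ) • J z x) 2 volume := fun γ hγ => by
      have hm : Measurable fun x : 𝔼 => √(‖x‖ ^ γ) := by fun_prop
      refine (Lp.memLp (z none)).of_le
        (hm.aestronglyMeasurable.smul (Lp.aestronglyMeasurable (J z))) ?_
      filter_upwards [hJ z, hne] with x h1 hx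
      have p1 : 0 < τ x := by linarith [hτ1 x hx]
      rw [h1, norm_smul, norm_mul, Complex.norm_real, norm_inv, Real.norm_of_nonneg p1.le,
        Real.norm_of_nonneg (Real.sqrt_nonneg _), ← mul_assoc]
      refine mul_le_of_le_one_left (norm_nonneg _) ?_
      rw [← div_eq_mul_inv, div_le_one p1]
      exact Real.sqrt_le_sqrt (hγ x)
    refine ⟨hz, fun i => ?_, key _ fun x => ?_, key _ fun x => ?_⟩
    · refine (Lp.memLp (z (some i))).ae_eq ?_
      filter_upwards [hG z i] with x h1
      have : (σ x : ℂ) ≠ 0 := by exact_mod_cast (by linarith [hσ1 x] : σ x ≠ 0)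
      rw [h1, Complex.real_smul, Complex.ofReal_inv]
      exact (mul_inv_cancel_left₀ this _).symm
    · linarith [Real.rpow_nonneg (norm_nonneg x) β]
    · linarith [Real.rpow_nonneg (norm_nonneg x) (α - 2)]
  have hT : ∀ y z : E, inner ℂ y (T z) = ∑ i, inner ℂ (y (some i)) (z (some i))
      + inner ℂ (y none) (((α - b : ℝ) : ℂ) • (∑ i, mulOp 2 (d i) (hdm i) 1 (hd i) (z (some i)))
          + mulOp 2 q hqm _ hq (z none)) := fun y z => by
    rw [PiLp.inner_apply, Fintype.sum_option, add_comm]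
    congr 1
    simp [T, pr]
    rfl
  have hform : ∀ y ∈ K, ∀ z ∈ K, inner ℂ y (T z)
      = sesqForm α β b 0 lam (J z) (fun i => Gr i z) (J y) (fun i => Gr i y)
        + ∫ x, (V x : ℂ) * J z x * conj (J y x) := fun y hy z hz => by
    have iS := (hdom z hz).integrable_sesqIntegrand (hdom y hy) (by omega) b lam
    have iV : Integrable fun x => (V x : ℂ) * J z x * conj (J y x) := by
      refine (integrable_mul_conj_Lp (J y) (mulOp 2 V hV C hC (J z))).congr ?_
      filter_upwards [mulOp_coeFn hV hC (J z)] with x hx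
      rw [hx]
    rw [sesqForm_zero_eq, ← integral_add iS iV, hT]
    simp only [inner_eq_integral_mul_conj]
    rw [← integral_finsetSum _ fun i _ => integrable_mul_conj_Lp _ _,
      ← integral_add (integrable_finsetSum _ fun i _ => integrable_mul_conj_Lp _ _) (integrable_mul_conj_Lp _ _)]
    refine integral_congr_ae ?_
    have hsum : ∀ᵐ x, (∑ i, mulOp 2 (d i) (hdm i) 1 (hd i) (z (some i)) : LpRN N 2) x
        = ∑ i, (d i x : ℂ) * z (some i) x := by
      filter_upwards [coeFn_finsetSum_Lp Finset.univ
        fun i => mulOp 2 (d i) (hdm i) 1 (hd i) (z (some i)),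
        ae_all_iff.2 fun i => mulOp_coeFn (hdm i) (hd i) (z (some i))] with x h1 h2
      rw [h1]
      exact Finset.sum_congr rfl fun i _ => h2 i
    have hall : ∀ᵐ x, ∀ i, Gr i z x = ((σ x)⁻¹ : ℝ) * z (some i) x ∧
        Gr i y x = ((σ x)⁻¹ : ℝ) * y (some i) x :=
      ae_all_iff.2 fun i => (hG z i).and (hG y i)
    filter_upwards [hsum, hall, hJ z, hJ y, hne, mulOp_coeFn hqm hq (z none),
      Lp.coeFn_add (((α - b : ℝ) : ℂ) • (∑ i, mulOp 2 (d i) (hdm i) 1 (hd i) (z (some i))))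
        (mulOp 2 q hqm _ hq (z none)),
      Lp.coeFn_smul ((α - b : ℝ) : ℂ) (∑ i, mulOp 2 (d i) (hdm i) 1 (hd i) (z (some i)))]
      with x h1 h2 h3 h4 hx h5 h6 h7
    rw [h6, Pi.add_apply, h7, Pi.smul_apply, h1, h5]
    have q1 : (τ x : ℂ) ≠ 0 := by exact_mod_cast (by linarith [hτ1 x hx] : τ x ≠ 0)
    have q2 : (σ x : ℂ) ≠ 0 := by exact_mod_cast (by linarith [hσ1 x] : σ x ≠ 0)
    simp only [sesqIntegrand, h3, h4, (h2 _).1, (h2 _).2, ← hσ2]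
    have t1 : ((σ x ^ 2 : ℝ) : ℂ) * ∑ i, ((((σ x)⁻¹ : ℝ) : ℂ) * z (some i) x)
        * conj ((((σ x)⁻¹ : ℝ) : ℂ) * y (some i) x) = ∑ i, z (some i) x * conj (y (some i) x) := by
      rw [Finset.mul_sum]
      refine Finset.sum_congr rfl fun i _ => ?_
      rw [map_mul, Complex.conj_ofReal, Complex.ofReal_inv, Complex.ofReal_pow]
      field_simp
    have t2 : ((‖x‖ ^ (α - 2) : ℝ) : ℂ) * (∑ i, (x i : ℂ) * ((((σ x)⁻¹ : ℝ) : ℂ) * z (some i) x))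
        * (((τ x)⁻¹ : ℝ) : ℂ) = ∑ i, (d i x : ℂ) * z (some i) x := by
      rw [Finset.mul_sum, Finset.sum_mul]
      refine Finset.sum_congr rfl fun i _ => ?_
      simp only [d, Complex.ofReal_mul, Complex.ofReal_inv, Complex.ofReal_div]
      field_simp
    have t3 : (q x : ℂ) = (((‖x‖ ^ β : ℝ) : ℂ) + lam + V x) * (((τ x)⁻¹ : ℝ) : ℂ)
        * (((τ x)⁻¹ : ℝ) : ℂ) := by
      simp only [q, Complex.ofReal_inv, Complex.ofReal_div, Complex.ofReal_pow,
        Complex.ofReal_add]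
      field_simp
    rw [t1, ← t2, t3, smul_eq_mul]
    simp only [map_mul, Complex.conj_ofReal]
    push_cast
    ring
  have hnorm : ∀ z ∈ K, ‖z‖ ^ 2 = (∫ x : 𝔼, ∑ i, (1 + ‖x‖ ^ α) * ‖Gr i z x‖ ^ 2)
        + ∫ x : 𝔼, (‖x‖ ^ (α - 2) + ‖x‖ ^ β) * ‖J z x‖ ^ 2 := fun z hz => by
    rw [PiLp.norm_sq_eq_of_L2, Fintype.sum_option, add_comm]
    simp only [norm_sq_eq_integral]
    rw [← integral_finsetSum _ fun i _ => integrable_norm_sq (Lp.memLp _)]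
    congr 1
    · refine integral_congr_ae ?_
      filter_upwards [ae_all_iff.2 (hG z)] with x h2
      refine Finset.sum_congr rfl fun i _ => ?_
      have q2 : σ x ≠ 0 := by linarith [hσ1 x]
      rw [h2, ← hσ2, norm_mul, Complex.norm_real, Real.norm_eq_abs, mul_pow, sq_abs]
      field_simp
    · refine integral_congr_ae ?_
      filter_upwards [hJ z, hne] with x h2 hx
      have q1 : τ x ≠ 0 := by linarith [hτ1 x hx]
      rw [h2, ← hτ2, norm_mul, Complex.norm_real, Real.norm_eq_abs, mul_pow, sq_abs]
      field_simp
  obtain ⟨z, hz, hsol⟩ := exists_mem_forall_inner_eq K hK T (δ := 1 / 2) (by norm_num)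
    (fun z hz => by
      have h1 := (hdom z hz).coercive hN hα0 hα2 hpos hV hC hVc
      rw [hform z hz z hz, hnorm z hz, Complex.add_re]
      refine (le_of_eq ?_).trans (h1.trans (le_of_eq ?_))
      · ring
      · congr 1
        have : ∀ x, (V x : ℂ) * J z x * conj (J z x) = ((V x * ‖J z x‖ ^ 2 : ℝ) : ℂ) := fun x => by
          rw [mul_assoc, Complex.mul_conj, Complex.normSq_eq_norm_sq, Complex.ofReal_mul]
        simp only [this]
        rw [integral_complex_ofReal, Complex.ofReal_re]) (ContinuousLinearMap.adjoint J f)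
  -- Conversely, any element of the form domain comes from the vector `y = (τh, σH)` of `K`, so
  -- testing on `K` is the same as testing on the form domain.
  refine ⟨J z, fun i => Gr i z, hdom z hz, fun h H hh => ?_⟩
  have hyn : MemLp (fun x => τ x • h x) 2 volume := by
    refine (hh.singular_memLp.norm.add hh.growth_memLp.norm).of_le
      (hτm.aestronglyMeasurable.smul (Lp.aestronglyMeasurable h)) (Eventually.of_forall fun x => ?_)
    rw [Pi.add_apply, norm_smul, norm_smul, norm_smul, ← add_mul,
      Real.norm_of_nonneg (Real.sqrt_nonneg _), Real.norm_of_nonneg (Real.sqrt_nonneg _),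
      Real.norm_of_nonneg (Real.sqrt_nonneg _), norm_mul, norm_norm]
    refine mul_le_mul_of_nonneg_right ?_ (norm_nonneg _)
    rw [Real.norm_of_nonneg (by positivity)]
    refine Real.sqrt_le_iff.2 ⟨by positivity, ?_⟩
    have p1 := Real.sq_sqrt (by positivity : 0 ≤ ‖x‖ ^ (α - 2))
    have p2 := Real.sq_sqrt (by positivity : 0 ≤ ‖x‖ ^ β)
    nlinarith [mul_nonneg (Real.sqrt_nonneg (‖x‖ ^ (α - 2))) (Real.sqrt_nonneg (‖x‖ ^ β))]
  let y : E := WithLp.toLp 2 fun j => match j with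
    | none => hyn.toLp
    | some i => (hh.gradient_memLp i).toLp
  have hy1 : J y = h := by
    ext1
    filter_upwards [hJ y, hyn.coeFn_toLp, hne] with x h1 h2 hx
    have q1 : (τ x : ℂ) ≠ 0 := by exact_mod_cast (by linarith [hτ1 x hx] : τ x ≠ 0)
    have : y none x = τ x * h x := h2.trans (Complex.real_smul)
    rw [h1, this, Complex.ofReal_inv, inv_mul_cancel_left₀ q1]
  have hy2 : (fun i => Gr i y) = H := by
    funext i
    ext1
    filter_upwards [hG y i, (hh.gradient_memLp i).coeFn_toLp] with x h1 h2
    have q2 : (σ x : ℂ) ≠ 0 := by exact_mod_cast (by linarith [hσ1 x] : σ x ≠ 0)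
    have : y (some i) x = σ x * H i x := h2.trans (Complex.real_smul)
    rw [h1, this, Complex.ofReal_inv, inv_mul_cancel_left₀ q2]
  have hy : y ∈ K := by
    rw [hKmem, hy1, hy2]
    exact hh.weakGradient
  have e1 := hsol y hy
  rw [hform y hy z hz, ContinuousLinearMap.adjoint_inner_right, hy1, hy2,
    inner_eq_integral_mul_conj] at e1
  rw [eq_sub_of_add_eq e1, ← integral_sub (integrable_mul_conj_Lp _ _) ?_]
  · refine integral_congr_ae ?_
    filter_upwards [Lp.coeFn_sub (mulOp 2 V hV C hC (J z)) f, mulOp_coeFn hV hC (J z)]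
      with x h1 h2
    rw [h1, Pi.sub_apply, h2]
    ring
  · refine (integrable_mul_conj_Lp h (mulOp 2 V hV C hC (J z))).congr ?_
    filter_upwards [mulOp_coeFn hV hC (J z)] with x hx
    rw [hx]

end LaxMilgram

/-! ### Resolvents of the perturbed form operators on `L²` -/

section Resolvent

variable {N : ℕ} {α β b lam : ℝ}

local notation "𝔼" => EuclideanSpace ℝ (Fin N)

lemma FormOperator.add {u v w z : LpRN N 2} (hN : 0 < N) (hu : FormOperator α β b 0 lam u w)
    (hv : FormOperator α β b 0 lam v z) : FormOperator α β b 0 lam (u + v) (w + z) := by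
  obtain ⟨G, hG, hu⟩ := hu
  obtain ⟨H, hH, hv⟩ := hv
  refine ⟨G + H, hG.add hH, fun h K hK => ?_⟩
  have e1 := hu h K hK
  have e2 := hv h K hK
  have i1 : Integrable fun x => -w x * conj (h x) :=
    integrable_mul_conj (Lp.memLp w).neg (Lp.memLp h)
  have i2 : Integrable fun x => -z x * conj (h x) :=
    integrable_mul_conj (Lp.memLp z).neg (Lp.memLp h)
  rw [sesqForm_zero_eq] at e1 e2 ⊢
  have e3 : ∫ x, -(w + z) x * conj (h x) = ∫ x, (-w x * conj (h x) + -z x * conj (h x)) := by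
    refine integral_congr_ae ?_
    filter_upwards [Lp.coeFn_add w z] with x hx
    rw [hx, Pi.add_apply]
    ring
  rw [e3, integral_add i1 i2, ← e1, ← e2, ← integral_add
    (hG.integrable_sesqIntegrand hK hN b lam) (hH.integrable_sesqIntegrand hK hN b lam)]
  refine integral_congr_ae ?_
  filter_upwards [Lp.coeFn_add u v, ae_all_iff.2 fun i => Lp.coeFn_add (G i) (H i)] with x h1 h2
  simp only [sesqIntegrand, Pi.add_apply, h1, h2, mul_add, add_mul, Finset.sum_add_distrib]
  ring

lemma FormOperator.smul {u w : LpRN N 2} (hu : FormOperator α β b 0 lam u w) (a : ℂ) :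
    FormOperator α β b 0 lam (a • u) (a • w) := by
  obtain ⟨G, hG, hu⟩ := hu
  refine ⟨a • G, hG.smul a, fun h K hK => ?_⟩
  have e1 := hu h K hK
  rw [sesqForm_zero_eq] at e1 ⊢
  have e3 : ∫ x, -(a • w) x * conj (h x) = a * ∫ x, -w x * conj (h x) := by
    rw [← integral_const_mul]
    refine integral_congr_ae ?_
    filter_upwards [Lp.coeFn_smul a w] with x hx
    rw [hx, Pi.smul_apply, smul_eq_mul]
    ring
  rw [e3, ← e1, ← integral_const_mul]
  refine integral_congr_ae ?_
  filter_upwards [Lp.coeFn_smul a u, ae_all_iff.2 fun i => Lp.coeFn_smul a (G i)] with x h1 h2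
  simp only [sesqIntegrand, Pi.smul_apply, h1, h2, smul_eq_mul]
  have e4 : ∑ i, a * G i x * conj (K i x) = a * ∑ i, G i x * conj (K i x) := by
    rw [Finset.mul_sum]
    exact Finset.sum_congr rfl fun i _ => by ring
  have e5 : ∑ i, (x i : ℂ) * (a * G i x) = a * ∑ i, (x i : ℂ) * G i x := by
    rw [Finset.mul_sum]
    exact Finset.sum_congr rfl fun i _ => by ring
  rw [e4, e5]
  ring

/-- Dissipativity: `Re ⟨Ã u - V u, u⟩ ≤ 0`. -/
lemma FormOperator.re_inner_le {u w : LpRN N 2} (hu : FormOperator α β b 0 lam u w)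
    (hN : 3 ≤ N) (hα0 : 0 < α) (hα2 : α < 2) {c : ℝ}
    (hpos : ∀ x : 𝔼, x ≠ 0 → 0 < (((N : ℝ) - 2) / 2) ^ 2 / (2 * ‖x‖ ^ 2)
        + (c - 1 - (α - b) / 2 * (α - 2 + N)) * ‖x‖ ^ (α - 2) + lam)
    {V : 𝔼 → ℝ} (hV : AEStronglyMeasurable V volume) {C : ℝ} (hC : ∀ᵐ x, |V x| ≤ C)
    (hVc : ∀ᵐ x : 𝔼, c * ‖x‖ ^ (α - 2) ≤ V x) :
    (inner ℂ u (w - mulOp 2 V hV C hC u)).re ≤ 0 := by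
  obtain ⟨G, hG, hu⟩ := hu
  have h1 := hG.coercive hN hα0 hα2 hpos hV hC hVc
  rw [hu u G hG] at h1
  have h2 : inner ℂ u (mulOp 2 V hV C hC u) = ((∫ x, V x * ‖u x‖ ^ 2 : ℝ) : ℂ) := by
    rw [inner_eq_integral_mul_conj, ← integral_complex_ofReal]
    refine integral_congr_ae ?_
    filter_upwards [mulOp_coeFn hV hC u] with x hx
    rw [hx, mul_assoc, Complex.mul_conj, Complex.normSq_eq_norm_sq, Complex.ofReal_mul]
  have h3 : ∫ x, -w x * conj (u x) = -inner ℂ u w := by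
    rw [inner_eq_integral_mul_conj, ← integral_neg]
    exact integral_congr_ae (Eventually.of_forall fun x => neg_mul _ _)
  rw [h3, Complex.neg_re] at h1
  rw [inner_sub_right, h2, Complex.sub_re, Complex.ofReal_re]
  have p1 : 0 ≤ ∫ x : 𝔼, ∑ i, (1 + ‖x‖ ^ α) * ‖G i x‖ ^ 2 :=
    integral_nonneg fun x => by positivity
  have p2 : 0 ≤ ∫ x : 𝔼, (‖x‖ ^ (α - 2) + ‖x‖ ^ β) * ‖u x‖ ^ 2 :=
    integral_nonneg fun x => by positivity
  linarith

/-- `R μ` is the resolvent `(μ - (Ã - V))⁻¹` for all `μ > 0`. -/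
def IsFormResolvent (α β b lam : ℝ) (M : LpRN N 2 →L[ℂ] LpRN N 2)
    (R : ℝ → LpRN N 2 →L[ℂ] LpRN N 2) : Prop :=
  (∀ μ, 0 < μ → ‖R μ‖ ≤ μ⁻¹) ∧ ∀ μ, 0 < μ → ∀ f u, R μ f = u ↔
    FormOperator α β b 0 lam u (M u + (μ : ℂ) • u - f)

/-- The spectral parameter is absorbed into the potential: `V + μ` is again bounded and lies above
`c|x|^{α-2}`, so solutions exist for every `μ > 0`. Dissipativity gives the bound `1/μ`, and by
linearity uniqueness. -/
theorem exists_isFormResolvent (hN : 3 ≤ N) (hα0 : 0 < α) (hα2 : α < 2) (hβ : 0 < β) {c : ℝ}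
    (hpos : ∀ x : 𝔼, x ≠ 0 → 0 < (((N : ℝ) - 2) / 2) ^ 2 / (2 * ‖x‖ ^ 2)
        + (c - 1 - (α - b) / 2 * (α - 2 + N)) * ‖x‖ ^ (α - 2) + lam)
    {V : 𝔼 → ℝ} (hV : AEStronglyMeasurable V volume) {C : ℝ} (hC : ∀ᵐ x, |V x| ≤ C)
    (hVc : ∀ᵐ x : 𝔼, c * ‖x‖ ^ (α - 2) ≤ V x) :
    ∃ R, IsFormResolvent α β b lam (mulOp 2 V hV C hC) R := by
  set M := mulOp 2 V hV C hC with hM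
  have hbound : ∀ μ : ℝ, 0 < μ → ∀ u f : LpRN N 2,
      FormOperator α β b 0 lam u (M u + (μ : ℂ) • u - f) → ‖u‖ ≤ μ⁻¹ * ‖f‖ := by
    intro μ hμ u f hu
    have h1 := hu.re_inner_le hN hα0 hα2 hpos hV hC hVc
    rw [← hM, show M u + (μ : ℂ) • u - f - M u = (μ : ℂ) • u - f by abel, inner_sub_right,
      inner_smul_right, Complex.sub_re, Complex.re_ofReal_mul, ← RCLike.re_to_complex,
      inner_self_eq_norm_sq] at h1
    have h2 : (inner ℂ u f).re ≤ ‖u‖ * ‖f‖ := (Complex.re_le_norm _).trans (norm_inner_le_norm _ _)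
    rw [le_inv_mul_iff₀ hμ]
    by_contra! hlt
    have h3 : 0 < ‖u‖ := by
      by_contra! h0
      have : ‖u‖ = 0 := le_antisymm h0 (norm_nonneg _)
      rw [this, mul_zero] at hlt
      exact absurd hlt (not_lt.2 (norm_nonneg _))
    have h4 := mul_lt_mul_of_pos_left hlt h3
    nlinarith
  have hex : ∀ μ : ℝ, 0 < μ → ∀ f : LpRN N 2, ∃ u : LpRN N 2,
      FormOperator α β b 0 lam u (M u + (μ : ℂ) • u - f) := by
    intro μ hμ f
    have hV' : AEStronglyMeasurable (fun x => V x + μ) (volume : Measure 𝔼) :=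
      hV.add aestronglyMeasurable_const
    have hC' : ∀ᵐ x, |V x + μ| ≤ C + μ := by
      filter_upwards [hC] with x hx
      refine (abs_add_le _ _).trans ?_
      rw [abs_of_pos hμ]
      linarith
    have hVc' : ∀ᵐ x : 𝔼, c * ‖x‖ ^ (α - 2) ≤ V x + μ := by
      filter_upwards [hVc] with x hx
      linarith
    obtain ⟨u, hu⟩ := exists_formOperator hN hα0 hα2 hβ hpos hV' hC' hVc' f
    refine ⟨u, ?_⟩
    convert hu using 2
    ext1
    filter_upwards [mulOp_coeFn hV' hC' u, mulOp_coeFn hV hC u, Lp.coeFn_smul (μ : ℂ) u,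
      Lp.coeFn_add (M u) ((μ : ℂ) • u)] with x h1 h2 h3 h4
    rw [h4, Pi.add_apply, h1, h3, Pi.smul_apply, smul_eq_mul, h2]
    push_cast
    ring
  have huniq : ∀ μ : ℝ, 0 < μ → ∀ f u v : LpRN N 2,
      FormOperator α β b 0 lam u (M u + (μ : ℂ) • u - f) →
      FormOperator α β b 0 lam v (M v + (μ : ℂ) • v - f) → u = v := by
    intro μ hμ f u v hu hv
    have h1 := hu.add (by omega) (hv.smul (-1))
    have h2 := hbound μ hμ (u + (-1 : ℂ) • v) 0 (by
      convert h1 using 1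
      rw [map_add, map_smul]
      module)
    rw [norm_zero, mul_zero, norm_le_zero_iff, neg_one_smul] at h2
    exact add_neg_eq_zero.1 h2
  have hR : ∀ μ : ℝ, ∃ R : LpRN N 2 →L[ℂ] LpRN N 2, 0 < μ → ‖R‖ ≤ μ⁻¹ ∧ ∀ f u, R f = u ↔
      FormOperator α β b 0 lam u (M u + (μ : ℂ) • u - f) := by
    intro μ
    by_cases hμ : 0 < μ
    · choose r hr using hex μ hμ
      let A : LpRN N 2 →ₗ[ℂ] LpRN N 2 :=
        { toFun := r
          map_add' := fun f g => by
            refine huniq μ hμ _ _ _ (hr (f + g)) ?_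
            convert (hr f).add (by omega) (hr g) using 1
            simp only [map_add, smul_add]
            abel
          map_smul' := fun a f => by
            refine huniq μ hμ _ _ _ (hr (a • f)) ?_
            rw [RingHom.id_apply]
            convert (hr f).smul a using 1
            rw [map_smul]
            module }
      refine ⟨A.mkContinuous μ⁻¹ fun f => hbound μ hμ _ _ (hr f), fun _ => ⟨?_, fun f u => ⟨?_, ?_⟩⟩⟩
      · exact A.mkContinuous_norm_le (inv_pos.2 hμ).le _
      · rintro rfl
        exact hr f
      · intro hu
        exact huniq μ hμ f _ _ (hr f) hu
    -- A default value for `μ ≤ 0`, where nothing is claimed.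
    · exact ⟨0, fun h => absurd h hμ⟩
  choose R hR using hR
  exact ⟨R, fun μ hμ => (hR μ hμ).1, fun μ hμ => (hR μ hμ).2⟩

variable {M : LpRN N 2 →L[ℂ] LpRN N 2} {R : ℝ → LpRN N 2 →L[ℂ] LpRN N 2}

lemma IsFormResolvent.formOperator (h : IsFormResolvent α β b lam M R) {μ : ℝ} (hμ : 0 < μ)
    (f : LpRN N 2) : FormOperator α β b 0 lam (R μ f) (M (R μ f) + (μ : ℂ) • R μ f - f) :=
  (h.2 μ hμ f _).1 rfl

/-- The second resolvent identity. -/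
lemma IsFormResolvent.apply_eq {M' : LpRN N 2 →L[ℂ] LpRN N 2} {R' : ℝ → LpRN N 2 →L[ℂ] LpRN N 2}
    (h : IsFormResolvent α β b lam M R) (h' : IsFormResolvent α β b lam M' R') {μ ν : ℝ}
    (hμ : 0 < μ) (hν : 0 < ν) (f : LpRN N 2) :
    R μ f = R' ν (f + (M' (R μ f) - M (R μ f)) + ((ν - μ : ℝ) : ℂ) • R μ f) := by
  symm
  rw [h'.2 ν hν]
  convert h.formOperator hμ f using 1
  push_cast
  module

lemma IsFormResolvent.resolvent_identity (h : IsFormResolvent α β b lam M R) {μ ν : ℝ}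
    (hμ : 0 < μ) (hν : 0 < ν) (f : LpRN N 2) :
    R μ f - R ν f = ((ν - μ : ℝ) : ℂ) • R μ (R ν f) := by
  have h1 := h.apply_eq h hν hμ f
  rw [sub_self, add_zero, map_add, map_smul] at h1
  rw [sub_eq_iff_eq_add]
  nth_rewrite 2 [h1]
  push_cast
  module

end Resolvent

/-! ### Truncated powers with bounded derivative -/

section TruncatedPower

variable {m ε s : ℝ}

/-- `s⁺ / (1 + ε s⁺)` -/
noncomputable def saturate (ε s : ℝ) : ℝ := max s 0 / (1 + ε * max s 0)

/-- A version of `(s⁺)^{1+m}` with linear growth. -/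
noncomputable def truncPow (m ε s : ℝ) : ℝ := max s 0 * saturate ε s ^ m

/-- The derivative of `truncPow`. -/
noncomputable def truncPowDeriv (m ε s : ℝ) : ℝ :=
  saturate ε s ^ m * (1 + m / (1 + ε * max s 0))

/-- The derivative of `truncPowDeriv` away from the origin. -/
noncomputable def truncPowDeriv₂ (m ε s : ℝ) : ℝ :=
  saturate ε s ^ m * (m / (1 + ε * max s 0))
    * ((1 + m / (1 + ε * max s 0)) / max s 0 - ε / (1 + ε * max s 0))

lemma one_add_mul_max_pos (hε : 0 < ε) (s : ℝ) : 0 < 1 + ε * max s 0 := by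
  have := le_max_right s 0
  positivity

lemma saturate_nonneg (hε : 0 < ε) (s : ℝ) : 0 ≤ saturate ε s :=
  div_nonneg (le_max_right s 0) (one_add_mul_max_pos hε s).le

lemma saturate_le_inv (hε : 0 < ε) (s : ℝ) : saturate ε s ≤ ε⁻¹ := by
  unfold saturate
  rw [div_le_iff₀ (one_add_mul_max_pos hε s), mul_add, inv_mul_cancel_left₀ hε.ne']
  linarith [inv_pos.2 hε]

lemma saturate_le (hε : 0 < ε) (s : ℝ) : saturate ε s ≤ max s 0 := by
  have := le_max_right s 0
  exact div_le_self this (by nlinarith)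

lemma continuous_saturate (hε : 0 < ε) : Continuous (saturate ε) :=
  (by fun_prop : Continuous fun s : ℝ => max s 0).div₀ (by fun_prop)
    fun s => (one_add_mul_max_pos hε s).ne'

lemma saturate_of_nonpos (hs : s ≤ 0) : saturate ε s = 0 := by
  simp [saturate, max_eq_right hs]

lemma one_le_factor (hm : 0 < m) (hε : 0 < ε) (s : ℝ) : 1 ≤ 1 + m / (1 + ε * max s 0) := by
  have := div_pos hm (one_add_mul_max_pos hε s)
  linarith

lemma factor_le (hm : 0 < m) (hε : 0 < ε) (s : ℝ) : 1 + m / (1 + ε * max s 0) ≤ 1 + m := by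
  have h1 := le_max_right s 0
  have := div_le_self hm.le (by nlinarith : 1 ≤ 1 + ε * max s 0)
  linarith

/-- The product of an `O(s)` and an `o(1)`; the kink of `s⁺` is erased by a continuous factor
vanishing at `0`. -/
lemma hasDerivAt_max_mul_zero {g : ℝ → ℝ} (hg : ContinuousAt g 0) (h0 : g 0 = 0) :
    HasDerivAt (fun s => max s 0 * g s) 0 0 := by
  rw [hasDerivAt_iff_isLittleO]
  simp only [max_self, zero_mul, sub_zero, smul_zero]
  have h1 : (fun s : ℝ => max s 0) =O[𝓝 0] fun s => s :=
    Asymptotics.IsBigO.of_bound 1 (Eventually.of_forall fun s => by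
      rw [one_mul, Real.norm_eq_abs, Real.norm_eq_abs, abs_of_nonneg (le_max_right s 0)]
      exact max_le (le_abs_self s) (abs_nonneg s))
  have h2 : g =o[𝓝 0] fun _ => (1 : ℝ) := by
    rw [Asymptotics.isLittleO_one_iff]
    simpa only [ContinuousAt, h0] using hg
  simpa using h1.mul_isLittleO h2

lemma hasDerivAt_saturate (hε : 0 < ε) (hs : 0 < s) :
    HasDerivAt (saturate ε) (1 / (1 + ε * s) ^ 2) s := by
  have h0 : 1 + ε * s ≠ 0 := by positivity
  have h1 : HasDerivAt (fun s : ℝ => s / (1 + ε * s)) (1 / (1 + ε * s) ^ 2) s := by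
    have h2 := (hasDerivAt_id s).div (((hasDerivAt_id s).const_mul ε).const_add 1) h0
    refine h2.congr_deriv ?_
    simp only [id]
    ring
  refine h1.congr_of_eventuallyEq ?_
  filter_upwards [lt_mem_nhds hs] with r hr
  simp [saturate, max_eq_left (le_of_lt hr)]

lemma hasDerivAt_saturate_rpow (hε : 0 < ε) (hs : 0 < s) :
    HasDerivAt (fun s => saturate ε s ^ m) (saturate ε s ^ m * (m / (s * (1 + ε * s)))) s := by
  have h0 : 0 < 1 + ε * s := by positivity
  have hy : saturate ε s = s / (1 + ε * s) := by simp [saturate, max_eq_left hs.le]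
  have hy0 : 0 < saturate ε s := by rw [hy]; positivity
  have h1 := (hasDerivAt_saturate hε hs).rpow_const (p := m) (Or.inl hy0.ne')
  convert h1 using 1
  rw [Real.rpow_sub_one hy0.ne']
  generalize saturate ε s ^ m = P
  rw [hy]
  field_simp

lemma hasDerivAt_truncPow (hm : 0 < m) (hε : 0 < ε) (s : ℝ) :
    HasDerivAt (truncPow m ε) (truncPowDeriv m ε s) s := by
  rcases lt_trichotomy s 0 with hs | rfl | hs
  · have : truncPowDeriv m ε s = 0 := by
      simp [truncPowDeriv, saturate_of_nonpos hs.le, Real.zero_rpow hm.ne']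
    rw [this]
    refine (hasDerivAt_const s (0 : ℝ)).congr_of_eventuallyEq ?_
    filter_upwards [gt_mem_nhds hs] with r hr
    simp [truncPow, max_eq_right (le_of_lt hr)]
  · have : truncPowDeriv m ε 0 = 0 := by
      simp [truncPowDeriv, saturate_of_nonpos le_rfl, Real.zero_rpow hm.ne']
    rw [this]
    refine hasDerivAt_max_mul_zero
      ((continuous_saturate hε).rpow_const fun _ => Or.inr hm.le).continuousAt ?_
    simp [saturate_of_nonpos le_rfl, Real.zero_rpow hm.ne']
  · have h1 := (hasDerivAt_id s).mul (hasDerivAt_saturate_rpow (m := m) hε hs)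
    have h0 : 1 + ε * s ≠ 0 := by positivity
    have h2 : HasDerivAt (fun s => s * saturate ε s ^ m) (truncPowDeriv m ε s) s := by
      refine h1.congr_deriv ?_
      simp only [truncPowDeriv, max_eq_left hs.le, id]
      field_simp
    refine h2.congr_of_eventuallyEq ?_
    filter_upwards [lt_mem_nhds hs] with r hr
    simp [truncPow, max_eq_left (le_of_lt hr)]

lemma hasDerivAt_truncPowDeriv (hε : 0 < ε) (hs : 0 < s) :
    HasDerivAt (truncPowDeriv m ε) (truncPowDeriv₂ m ε s) s := by
  have h0 : 1 + ε * s ≠ 0 := by positivity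
  have h3 : HasDerivAt (fun s : ℝ => 1 + m / (1 + ε * s)) (-(m * ε) / (1 + ε * s) ^ 2) s := by
    have h2 := ((hasDerivAt_const s m).div
      (((hasDerivAt_id s).const_mul ε).const_add 1) h0).const_add 1
    refine h2.congr_deriv ?_
    simp
  have h1 := (hasDerivAt_saturate_rpow (m := m) hε hs).mul h3
  have h2 : HasDerivAt (fun s => saturate ε s ^ m * (1 + m / (1 + ε * s)))
      (truncPowDeriv₂ m ε s) s := by
    refine h1.congr_deriv ?_
    simp only [truncPowDeriv₂, max_eq_left hs.le]
    generalize saturate ε s ^ m = P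
    field_simp
    ring
  refine h2.congr_of_eventuallyEq ?_
  filter_upwards [lt_mem_nhds hs] with r hr
  simp [truncPowDeriv, max_eq_left (le_of_lt hr)]

/-- Near `0⁺` the derivative of the truncated power behaves like `s^m`, hence need not be
differentiable at `0`; the extra factor repairs this for every `m > 0`. At `0` the division by zero
in `truncPowDeriv₂` is irrelevant, since it is multiplied by `truncPow m ε 0 = 0`. -/
lemma hasDerivAt_truncPow_mul_deriv (hm : 0 < m) (hε : 0 < ε) (s : ℝ) :
    HasDerivAt (fun s => truncPow m ε s * truncPowDeriv m ε s)
      (truncPowDeriv m ε s ^ 2 + truncPow m ε s * truncPowDeriv₂ m ε s) s := by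
  rcases lt_trichotomy s 0 with hs | rfl | hs
  · have h0 : ∀ r : ℝ, r ≤ 0 → truncPow m ε r = 0 := fun r hr => by
      simp [truncPow, max_eq_right hr]
    have h1 : truncPowDeriv m ε s = 0 := by
      simp [truncPowDeriv, saturate_of_nonpos hs.le, Real.zero_rpow hm.ne']
    rw [h1, h0 s hs.le]
    norm_num
    refine (hasDerivAt_const s (0 : ℝ)).congr_of_eventuallyEq ?_
    filter_upwards [gt_mem_nhds hs] with r hr
    simp [h0 r (le_of_lt hr)]
  · have h1 : truncPowDeriv m ε 0 = 0 := by
      simp [truncPowDeriv, saturate_of_nonpos le_rfl, Real.zero_rpow hm.ne']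
    have h2 : truncPow m ε 0 = 0 := by simp [truncPow]
    rw [h1, h2]
    norm_num
    have hc : Continuous fun s => saturate ε s ^ m :=
      (continuous_saturate hε).rpow_const fun _ => Or.inr hm.le
    have hc2 : Continuous fun s : ℝ => 1 + m / (1 + ε * max s 0) :=
      continuous_const.add (continuous_const.div₀ (by fun_prop)
        fun s => (one_add_mul_max_pos hε s).ne')
    have := hasDerivAt_max_mul_zero (g := fun s => saturate ε s ^ m * truncPowDeriv m ε s)
      (hc.mul (hc.mul hc2)).continuousAt (by simp [h1])
    simpa only [truncPow, mul_assoc] using this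
  · have := (hasDerivAt_truncPow hm hε s).mul (hasDerivAt_truncPowDeriv (m := m) hε hs)
    rw [sq]
    exact this

lemma truncPow_nonneg (hε : 0 < ε) (s : ℝ) : 0 ≤ truncPow m ε s :=
  mul_nonneg (le_max_right s 0) (Real.rpow_nonneg (saturate_nonneg hε s) _)

lemma truncPowDeriv_nonneg (hm : 0 < m) (hε : 0 < ε) (s : ℝ) : 0 ≤ truncPowDeriv m ε s :=
  mul_nonneg (Real.rpow_nonneg (saturate_nonneg hε s) _)
    (by linarith [one_le_factor hm hε s])

lemma saturate_rpow_le (hm : 0 < m) (hε : 0 < ε) (s : ℝ) : saturate ε s ^ m ≤ ε⁻¹ ^ m :=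
  Real.rpow_le_rpow (saturate_nonneg hε s) (saturate_le_inv hε s) hm.le

lemma truncPowDeriv_le (hm : 0 < m) (hε : 0 < ε) (s : ℝ) :
    truncPowDeriv m ε s ≤ ε⁻¹ ^ m * (1 + m) :=
  mul_le_mul (saturate_rpow_le hm hε s) (factor_le hm hε s)
    (by linarith [one_le_factor hm hε s]) (by positivity)

/-- For `s > 0` the product is `P² r (θ - εs/(1+εs))` with `P = saturate ε s ^ m`, `r = m/(1+εs)`
and `θ = 1 + r ≥ 1`. The sign lets a gradient term be discarded when testing; the upper bound makes
the test function Lipschitz. -/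
lemma truncPow_mul_deriv₂_mem (hm : 0 < m) (hε : 0 < ε) (s : ℝ) :
    0 ≤ truncPow m ε s * truncPowDeriv₂ m ε s ∧
      truncPow m ε s * truncPowDeriv₂ m ε s ≤ (ε⁻¹ ^ m) ^ 2 * (m * (1 + m)) := by
  rcases le_or_gt s 0 with hs | hs
  · simp only [truncPow, max_eq_right hs, zero_mul, le_refl, true_and]
    positivity
  · have hD : 0 < 1 + ε * s := by positivity
    have h1 := one_le_factor hm hε s
    have h2 := factor_le hm hε s
    have hP := Real.rpow_nonneg (saturate_nonneg hε s) m
    have hP' := saturate_rpow_le hm hε s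
    simp only [truncPow, truncPowDeriv₂, max_eq_left hs.le] at h1 h2 ⊢
    set P := saturate ε s ^ m
    set θ := 1 + m / (1 + ε * s)
    have e : s * P * (P * (m / (1 + ε * s)) * (θ / s - ε / (1 + ε * s)))
        = P ^ 2 * ((m / (1 + ε * s)) * (θ - ε * s / (1 + ε * s))) := by
      field_simp
    have hr : m / (1 + ε * s) ≤ m := div_le_self hm.le (by nlinarith)
    have hr0 : 0 ≤ m / (1 + ε * s) := by positivity
    have hq : ε * s / (1 + ε * s) ≤ 1 := by
      rw [div_le_one hD]; linarith
    have hq0 : 0 ≤ ε * s / (1 + ε * s) := by positivity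
    rw [e]
    refine ⟨mul_nonneg (sq_nonneg _) (mul_nonneg hr0 (by linarith)), ?_⟩
    refine mul_le_mul (pow_le_pow_left₀ hP hP' 2) ?_ (mul_nonneg hr0 (by linarith)) (by positivity)
    exact mul_le_mul hr (by linarith) (by linarith) hm.le

/-- The middle term equals `(1 + m/(1+εs⁺))` times the square. The lower bound serves the `λ` term,
the upper bound the negative potential. -/
lemma sq_truncPow_le (hm : 0 < m) (hε : 0 < ε) (s : ℝ) :
    truncPow m ε s ^ 2 ≤ s * (truncPow m ε s * truncPowDeriv m ε s) ∧
      s * (truncPow m ε s * truncPowDeriv m ε s) ≤ (1 + m) * truncPow m ε s ^ 2 := by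
  rcases le_or_gt s 0 with hs | hs
  · simp [truncPow, max_eq_right hs]
  · have e : s * (truncPow m ε s * truncPowDeriv m ε s)
        = (1 + m / (1 + ε * max s 0)) * truncPow m ε s ^ 2 := by
      simp only [truncPow, truncPowDeriv, max_eq_left hs.le]
      ring
    rw [e]
    exact ⟨le_mul_of_one_le_left (sq_nonneg _) (one_le_factor hm hε s),
      mul_le_mul_of_nonneg_right (factor_le hm hε s) (sq_nonneg _)⟩

/-- Uniformity in `ε` is the point: with `2m+1 = P-1` this is the growth needed for Young's
inequality. -/
lemma truncPow_mul_deriv_le (hm : 0 < m) (hε : 0 < ε) (s : ℝ) :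
    truncPow m ε s * truncPowDeriv m ε s ≤ (1 + m) * max s 0 ^ (2 * m + 1) := by
  rcases le_or_gt s 0 with hs | hs
  · simp only [truncPow, max_eq_right hs, zero_mul]
    positivity
  · have hP := Real.rpow_nonneg (saturate_nonneg hε s) m
    have hP' : saturate ε s ^ m ≤ s ^ m := by
      refine Real.rpow_le_rpow (saturate_nonneg hε s) ?_ hm.le
      simpa [max_eq_left hs.le] using saturate_le hε s
    have e : s ^ (2 * m + 1) = s * s ^ m * s ^ m := by
      rw [Real.rpow_add hs, Real.rpow_one, two_mul, Real.rpow_add hs]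
      ring
    have h1 := factor_le hm hε s
    have h2 := one_le_factor hm hε s
    simp only [truncPow, truncPowDeriv, max_eq_left hs.le] at h1 h2 ⊢
    rw [e]
    calc s * saturate ε s ^ m * (saturate ε s ^ m * (1 + m / (1 + ε * s)))
        ≤ s * s ^ m * (s ^ m * (1 + m)) := by gcongr
      _ = _ := by ring

lemma truncPow_pos (hε : 0 < ε) (hs : 0 < s) : 0 < truncPow m ε s := by
  have : 0 < saturate ε s := by
    simp only [saturate, max_eq_left hs.le]
    positivity
  simp only [truncPow, max_eq_left hs.le]
  positivity

end TruncatedPower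

/-! ### Testing the resolvent equation with truncated powers -/

section Testing

variable {N : ℕ} {α β b lam : ℝ}

local notation "𝔼" => EuclideanSpace ℝ (Fin N)

/-- The form domain is stable under composition with `C¹` functions vanishing at zero. -/
lemma InFormDomain.exists_comp_re {u : LpRN N 2} {G : Fin N → LpRN N 2}
    (hu : InFormDomain α β u G) {F F' : ℝ → ℝ} (hF : ∀ s, HasDerivAt F (F' s) s) {L : ℝ}
    (hL : ∀ s, |F' s| ≤ L) (h0 : F 0 = 0) :
    ∃ v H, InFormDomain α β v H ∧ (v =ᵐ[volume] fun x => ((F (u x).re : ℝ) : ℂ)) ∧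
      ∀ i, H i =ᵐ[volume] fun x => ((F' (u x).re * (G i x).re : ℝ) : ℂ) := by
  have hlip : ∀ s, |F s| ≤ L * |s| := fun s => by
    have := Convex.norm_image_sub_le_of_norm_hasDerivWithin_le (f := F) (f' := F') (C := L)
      (fun x _ => (hF x).hasDerivWithinAt) (fun x _ => hL x) convex_univ
      (Set.mem_univ 0) (Set.mem_univ s)
    simpa [h0] using this
  have hFc : Continuous F := continuous_iff_continuousAt.2 fun s => (hF s).continuousAt
  have hF'm : Measurable F' := by
    have : F' = deriv F := funext fun s => (hF s).deriv.symm
    rw [this]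
    exact measurable_deriv F
  have hre : ∀ w : LpRN N 2, AEStronglyMeasurable (fun x => (w x).re) volume := fun w =>
    Complex.continuous_re.comp_aestronglyMeasurable (Lp.aestronglyMeasurable w)
  have hvm : AEStronglyMeasurable (fun x => ((F (u x).re : ℝ) : ℂ)) volume :=
    (Complex.continuous_ofReal.comp hFc).comp_aestronglyMeasurable (hre u)
  have hHm : ∀ i, AEStronglyMeasurable (fun x => ((F' (u x).re * (G i x).re : ℝ) : ℂ)) volume :=
    fun i => Complex.continuous_ofReal.comp_aestronglyMeasurable
      ((hF'm.comp_aemeasurable (hre u).aemeasurable).aestronglyMeasurable.mul (hre (G i)))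
  have hvb : ∀ x, ‖((F (u x).re : ℝ) : ℂ)‖ ≤ L * ‖u x‖ := fun x => by
    rw [Complex.norm_real]
    exact (hlip _).trans (mul_le_mul_of_nonneg_left (Complex.abs_re_le_norm _)
      ((abs_nonneg _).trans (hL 0)))
  have hHb : ∀ i x, ‖((F' (u x).re * (G i x).re : ℝ) : ℂ)‖ ≤ L * ‖G i x‖ := fun i x => by
    rw [Complex.norm_real, norm_mul]
    exact mul_le_mul (hL _) (Complex.abs_re_le_norm _) (abs_nonneg _)
      ((abs_nonneg _).trans (hL 0))
  have hv : MemLp (fun x => ((F (u x).re : ℝ) : ℂ)) 2 volume :=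
    (Lp.memLp u).of_le_mul hvm (Eventually.of_forall hvb)
  have hH : ∀ i, MemLp (fun x => ((F' (u x).re * (G i x).re : ℝ) : ℂ)) 2 volume := fun i =>
    (Lp.memLp (G i)).of_le_mul (hHm i) (Eventually.of_forall (hHb i))
  have key : ∀ (θ : 𝔼 → ℝ) (f g : LpRN N 2), Measurable θ →
      (∀ᵐ x, ‖g x‖ ≤ L * ‖f x‖) → MemLp (fun x => θ x • f x) 2 volume →
      MemLp (fun x => θ x • g x) 2 volume := fun θ f g hθ hfg hf => by
    refine hf.of_le_mul (c := L) (hθ.aestronglyMeasurable.smul (Lp.aestronglyMeasurable g)) ?_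
    filter_upwards [hfg] with x hx
    rw [norm_smul, norm_smul, mul_left_comm]
    exact mul_le_mul_of_nonneg_left hx (norm_nonneg _)
  have bv : ∀ᵐ x, ‖(hv.toLp : LpRN N 2) x‖ ≤ L * ‖u x‖ := by
    filter_upwards [hv.coeFn_toLp] with x hx
    rw [hx]
    exact hvb x
  refine ⟨hv.toLp, fun i => (hH i).toLp, ⟨?_, fun i => ?_, ?_, ?_⟩, hv.coeFn_toLp,
    fun i => (hH i).coeFn_toLp⟩
  · exact hu.weakGradient.comp_re hF hL hv.coeFn_toLp fun i => (hH i).coeFn_toLp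
  · refine key (fun x => √(1 + ‖x‖ ^ α)) (G i) _ (by fun_prop) ?_ (hu.gradient_memLp i)
    filter_upwards [(hH i).coeFn_toLp] with x hx
    rw [hx]
    exact hHb i x
  · exact key (fun x => √(‖x‖ ^ (α - 2))) u _ (by fun_prop) bv hu.singular_memLp
  · exact key (fun x => √(‖x‖ ^ β)) u _ (by fun_prop) bv hu.growth_memLp

/-- Testing the resolvent equation with a truncated power of the solution. -/
theorem FormOperator.integral_test_le {u f : LpRN N 2} {μ : ℝ} (hN : 3 ≤ N) (hα0 : 0 < α)
    (hα2 : α < 2) (hlam : 0 < lam) {c c' : ℝ} (hc : c ≤ 0)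
    (hpos : ∀ x : 𝔼, x ≠ 0 → 0 < (((N : ℝ) - 2) / 2) ^ 2 / (2 * ‖x‖ ^ 2)
        + (c' - 1 - (α - b) / 2 * (α - 2 + N)) * ‖x‖ ^ (α - 2) + lam)
    {V : 𝔼 → ℝ} (hV : AEStronglyMeasurable V volume) {C : ℝ} (hC : ∀ᵐ x, |V x| ≤ C)
    (hVc : ∀ᵐ x : 𝔼, c * ‖x‖ ^ (α - 2) ≤ V x)
    (hu : FormOperator α β b 0 lam u (mulOp 2 V hV C hC u + (μ : ℂ) • u - f))
    {m ε : ℝ} (hm : 0 < m) (hε : 0 < ε) (hmc : c' - 1 ≤ (1 + m) * c) :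
    Integrable (fun x => (u x).re * (truncPow m ε (u x).re * truncPowDeriv m ε (u x).re)) ∧
    Integrable (fun x => (f x).re * (truncPow m ε (u x).re * truncPowDeriv m ε (u x).re)) ∧
    μ * ∫ x, (u x).re * (truncPow m ε (u x).re * truncPowDeriv m ε (u x).re)
      ≤ ∫ x, (f x).re * (truncPow m ε (u x).re * truncPowDeriv m ε (u x).re) := by
  obtain ⟨G, hG, hu⟩ := hu
  -- The test function is `h = W·D` with `W = truncPow m ε (Re u)` and `D` its derivative in `Re u`.
  -- The constant bounds `D² + W D₂`, the derivative of `W·D`.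
  obtain ⟨h, H, hH, hh, hHi⟩ := hG.exists_comp_re (hasDerivAt_truncPow_mul_deriv hm hε)
    (L := (ε⁻¹ ^ m * (1 + m)) ^ 2 + (ε⁻¹ ^ m) ^ 2 * (m * (1 + m))) (fun s => by
      have h1 := truncPowDeriv_nonneg hm hε s
      have h2 := pow_le_pow_left₀ h1 (truncPowDeriv_le hm hε s) 2
      obtain ⟨h3, h4⟩ := truncPow_mul_deriv₂_mem hm hε s
      rw [abs_of_nonneg (by positivity)]
      linarith) (by simp [truncPow])
  -- The basic inequality is applied to `W` itself, whose gradient is `D ∇Re u`.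
  obtain ⟨w, K, hK, hw, hKi⟩ := hG.exists_comp_re (hasDerivAt_truncPow hm hε)
    (L := ε⁻¹ ^ m * (1 + m)) (fun s => by
      rw [abs_of_nonneg (truncPowDeriv_nonneg hm hε s)]
      exact truncPowDeriv_le hm hε s) (by simp [truncPow])
  obtain ⟨icore, hcore⟩ := hK.coreIntegrand_nonneg hN hα0 hα2 hpos
  have hint : ∀ g : LpRN N 2, Integrable fun x =>
      (g x).re * (truncPow m ε (u x).re * truncPowDeriv m ε (u x).re) := fun g => by
    refine (integrable_mul_conj_Lp h g).re.congr ?_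
    filter_upwards [hh] with x hx
    rw [hx, Complex.conj_ofReal]
    simp
  refine ⟨hint u, hint f, ?_⟩
  have e1 := congrArg Complex.re (hu h H hH)
  rw [hG.re_sesqForm hH (by omega)] at e1
  set M := mulOp 2 V hV C hC
  have iS : Integrable fun x => (sesqIntegrand α β b lam u G h H x).re :=
    (hG.integrable_sesqIntegrand hH (by omega) b lam).re
  have iV := hint (M u)
  have e2 : (∫ x, -(M u + (μ : ℂ) • u - f) x * conj (h x)).re
      = (∫ x, (f x).re * (truncPow m ε (u x).re * truncPowDeriv m ε (u x).re))
        - (μ * ∫ x, (u x).re * (truncPow m ε (u x).re * truncPowDeriv m ε (u x).re))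
        - ∫ x, (M u x).re * (truncPow m ε (u x).re * truncPowDeriv m ε (u x).re) := by
    have iA : Integrable fun x => -(M u + (μ : ℂ) • u - f) x * conj (h x) :=
      integrable_mul_conj (Lp.memLp _).neg (Lp.memLp h)
    have i1 : Integrable fun x =>
        (f x).re * (truncPow m ε (u x).re * truncPowDeriv m ε (u x).re)
        - μ * ((u x).re * (truncPow m ε (u x).re * truncPowDeriv m ε (u x).re)) :=
      (hint f).sub ((hint u).const_mul μ)
    rw [← integral_const_mul, ← integral_sub (hint f) ((hint u).const_mul μ), ← integral_sub i1 iV]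
    refine (integral_re iA).symm.trans (integral_congr_ae ?_)
    filter_upwards [hh, Lp.coeFn_sub (M u + (μ : ℂ) • u) f, Lp.coeFn_add (M u) ((μ : ℂ) • u),
      Lp.coeFn_smul (μ : ℂ) u] with x h1 h2 h3 h4
    rw [h1, h2, Pi.sub_apply, h3, Pi.add_apply, h4, Pi.smul_apply, Complex.conj_ofReal]
    simp
    ring
  rw [e2] at e1
  suffices hle : 0 ≤ ∫ x, ((sesqIntegrand α β b lam u G h H x).re
      + (M u x).re * (truncPow m ε (u x).re * truncPowDeriv m ε (u x).re)) by
    rw [integral_add iS iV] at hle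
    linarith
  -- The comparison is pointwise: the drift terms coincide exactly, `D²|∇Re u|² = |∇W|²` covers the
  -- gradient term of the core integrand, and every other difference is nonnegative.
  refine hcore.trans (integral_mono_ae icore (iS.add iV) ?_)
  filter_upwards [hh, hw, ae_all_iff.2 hHi, ae_all_iff.2 hKi, mulOp_coeFn hV hC u, hVc]
    with x h1 h2 h3 h4 h5 h6
  simp only [coreIntegrand, sesqIntegrand, h1, h2, h3, h4]
  rw [show M u x = _ from h5]
  set s := (u x).re
  set W := truncPow m ε s
  set D := truncPowDeriv m ε s
  set D₂ := truncPowDeriv₂ m ε s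
  set S := ∑ i, (G i x).re ^ 2
  set B := ∑ i, x i * (G i x).re
  have hS : 0 ≤ S := Finset.sum_nonneg fun i _ => sq_nonneg _
  obtain ⟨p1, p2⟩ := sq_truncPow_le hm hε s
  have hD₂ := (truncPow_mul_deriv₂_mem hm hε s).1
  have c1 : ∑ i, ‖((D * (G i x).re : ℝ) : ℂ)‖ ^ 2 = D ^ 2 * S := by
    rw [Finset.mul_sum]
    refine Finset.sum_congr rfl fun i _ => ?_
    rw [Complex.norm_real, Real.norm_eq_abs, sq_abs, mul_pow]
  have c2 : ∑ i, x i * (conj (W : ℂ) * ((D * (G i x).re : ℝ) : ℂ)).re = W * D * B := by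
    rw [Finset.mul_sum]
    refine Finset.sum_congr rfl fun i _ => ?_
    rw [Complex.conj_ofReal, ← Complex.ofReal_mul, Complex.ofReal_re]
    ring
  have c3 : ‖(W : ℂ)‖ ^ 2 = W ^ 2 := by rw [Complex.norm_real, Real.norm_eq_abs, sq_abs]
  have c4 : (∑ i, G i x * (((D ^ 2 + W * D₂) * (G i x).re : ℝ) : ℂ)).re
      = (D ^ 2 + W * D₂) * S := by
    rw [Complex.re_sum, Finset.mul_sum]
    refine Finset.sum_congr rfl fun i _ => ?_
    rw [Complex.re_mul_ofReal]
    ring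
  have c5 : (∑ i, (x i : ℂ) * G i x).re = B := by
    rw [Complex.re_sum]
    exact Finset.sum_congr rfl fun i _ => by rw [Complex.re_ofReal_mul]
  rw [c1, c2, c3]
  simp only [Complex.add_re, Complex.conj_ofReal, Complex.re_mul_ofReal, Complex.re_ofReal_mul,
    mul_assoc, c4, c5]
  have q1 : 0 ≤ ‖x‖ ^ α * ((D ^ 2 + W * D₂) * S) := by positivity
  have q2 : 0 ≤ W * D₂ * S := mul_nonneg hD₂ hS
  have q3 : 0 ≤ D ^ 2 * S := by positivity
  have q4 : 0 ≤ s * (W * D) := (sq_nonneg W).trans p1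
  have q5 : 0 ≤ ‖x‖ ^ β * (s * (W * D)) := by positivity
  have q6 : 0 ≤ lam * (s * (W * D) - W ^ 2) := mul_nonneg hlam.le (sub_nonneg.2 p1)
  have r0 : 0 ≤ ‖x‖ ^ (α - 2) := by positivity
  -- As `c ≤ 0`, replacing `s W D` by its upper bound `(1+m)W²` lowers the potential term, so the
  -- effective constant becomes `(1+m)c`, at least `c' - 1`.
  have q7 : (c' - 1) * (‖x‖ ^ (α - 2) * W ^ 2) ≤ V x * (s * (W * D)) := by
    calc (c' - 1) * (‖x‖ ^ (α - 2) * W ^ 2) ≤ (1 + m) * c * (‖x‖ ^ (α - 2) * W ^ 2) :=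
          mul_le_mul_of_nonneg_right hmc (by positivity)
      _ = c * ‖x‖ ^ (α - 2) * ((1 + m) * W ^ 2) := by ring
      _ ≤ c * ‖x‖ ^ (α - 2) * (s * (W * D)) :=
          mul_le_mul_of_nonpos_left p2 (mul_nonpos_of_nonpos_of_nonneg hc r0)
      _ ≤ V x * (s * (W * D)) := mul_le_mul_of_nonneg_right h6 q4
  rw [show (u x).re = s from rfl]
  linarith

end Testing

/-! ### Positive operators on complex `L^p` -/

section Positivity

/-- Rotate `w` by `conj w / |w|`. Only a dense set of rotations is required, so a countable one can
be used and its exceptional null sets united. -/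
lemma norm_le_of_forall_dense_circle {w : ℂ} {t : ℝ} {S : Set Circle} (hS : Dense S)
    (h : ∀ z ∈ S, ((z : ℂ) * w).re ≤ t) : ‖w‖ ≤ t := by
  have hall : ∀ z : Circle, ((z : ℂ) * w).re ≤ t := by
    have hcl : IsClosed {z : Circle | ((z : ℂ) * w).re ≤ t} :=
      isClosed_le (by fun_prop) continuous_const
    intro z
    exact hcl.closure_subset_iff.2 h (hS z)
  rcases eq_or_ne w 0 with rfl | hw
  · simpa using hall 1
  · have hn : (‖w‖ : ℂ) ≠ 0 := by exact_mod_cast norm_ne_zero_iff.2 hw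
    let z : Circle := ⟨conj w / ‖w‖, by
      rw [Submonoid.unitSphere, Submonoid.mem_mk, Subsemigroup.mem_mk, mem_sphere_zero_iff_norm, norm_div, Complex.norm_conj, Complex.norm_real, norm_norm]
      exact div_self (norm_ne_zero_iff.2 hw)⟩
    have h2 := hall z
    have e : (z : ℂ) * w = (‖w‖ : ℂ) := by
      change conj w / ‖w‖ * w = _
      rw [div_mul_eq_mul_div, mul_comm, Complex.mul_conj, Complex.normSq_eq_norm_sq]
      push_cast
      field_simp
    rw [e, Complex.ofReal_re] at h2
    exact h2

variable {Ω : Type*} [MeasurableSpace Ω] {μ : Measure Ω} {p : ℝ≥0∞} [Fact (1 ≤ p)]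

/-- For `f ≥ 0` both `i f` and `-i f` have vanishing real part, so the hypothesis applied to them
forces `A f` to be real. -/
lemma isPositiveOp_of_re_nonneg {A : Lp ℂ p μ →L[ℂ] Lp ℂ p μ}
    (hA : ∀ f : Lp ℂ p μ, (∀ᵐ x ∂μ, 0 ≤ (f x).re) → ∀ᵐ x ∂μ, 0 ≤ (A f x).re) :
    IsPositiveOp A := by
  intro f hf
  have h1 := hA f (hf.mono fun x hx => (Complex.nonneg_iff.1 hx).1)
  have h2 : ∀ a : ℂ, a.re = 0 → ∀ᵐ x ∂μ, 0 ≤ (a * A f x).re := fun a ha => by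
    have h3 := hA (a • f) (by
      filter_upwards [hf, Lp.coeFn_smul a f] with x hx h4
      rw [h4, Pi.smul_apply, smul_eq_mul, Complex.mul_re, ha, ← (Complex.nonneg_iff.1 hx).2]
      simp)
    filter_upwards [h3, Lp.coeFn_smul a (A f)] with x h4 h5
    rw [map_smul, h5] at h4
    exact h4
  filter_upwards [h1, h2 Complex.I Complex.I_re, h2 (-Complex.I) (by simp)] with x h3 h4 h5
  simp only [Complex.mul_re, Complex.neg_re, Complex.I_re, Complex.I_im, zero_mul,
    one_mul, neg_mul] at h4 h5
  exact Complex.nonneg_iff.2 ⟨h3, by linarith⟩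

/-- A positive operator satisfies `|A f| ≤ A |f|`. -/
lemma norm_apply_le_of_re_nonneg {A : Lp ℂ p μ →L[ℂ] Lp ℂ p μ}
    (hA : ∀ f : Lp ℂ p μ, (∀ᵐ x ∂μ, 0 ≤ (f x).re) → ∀ᵐ x ∂μ, 0 ≤ (A f x).re) {f g : Lp ℂ p μ}
    (hg : ∀ᵐ x ∂μ, ‖f x‖ ≤ (g x).re) : ∀ᵐ x ∂μ, ‖A f x‖ ≤ (A g x).re := by
  obtain ⟨S, hSc, hSd⟩ := TopologicalSpace.exists_countable_dense Circle
  have h1 : ∀ᵐ x ∂μ, ∀ z ∈ S, ((z : ℂ) * A f x).re ≤ (A g x).re := by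
    rw [ae_ball_iff hSc]
    intro z _
    have h2 := hA (g - (z : ℂ) • f) (by
      filter_upwards [hg, Lp.coeFn_smul (z : ℂ) f, Lp.coeFn_sub g ((z : ℂ) • f)] with x hx h4 h5
      rw [h5, Pi.sub_apply, h4, Pi.smul_apply, smul_eq_mul, Complex.sub_re, sub_nonneg]
      refine ((Complex.re_le_norm _).trans ?_).trans hx
      rw [norm_mul, Circle.norm_coe, one_mul])
    filter_upwards [h2, Lp.coeFn_smul (z : ℂ) (A f), Lp.coeFn_sub (A g) ((z : ℂ) • A f)]
      with x h3 h4 h5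
    rw [map_sub, map_smul, h5, Pi.sub_apply, h4, Pi.smul_apply, smul_eq_mul, Complex.sub_re,
      sub_nonneg] at h3
    exact h3
  filter_upwards [h1] with x hx
  exact norm_le_of_forall_dense_circle hSd hx

end Positivity

/-! ### Maximum principle and `L^p` estimate for solutions -/

section LpBound

variable {N : ℕ} {α β b lam : ℝ}

local notation "𝔼" => EuclideanSpace ℝ (Fin N)

/-- The test function is nonnegative, so `μ ∫ s W D ≤ ∫ (Re f) W D ≤ 0` while `s W D ≥ W² ≥ 0`;
hence `W = 0` and `Re u ≤ 0`. Here the power is free, and any `m` small enough for the spare `-1` in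
the hypothesis will do. -/
theorem FormOperator.re_nonpos {u f : LpRN N 2} {μ : ℝ} (hN : 3 ≤ N) (hα0 : 0 < α)
    (hα2 : α < 2) (hlam : 0 < lam) {c c' : ℝ} (hc : c < 0) (hcc : c' ≤ c)
    (hpos : ∀ x : 𝔼, x ≠ 0 → 0 < (((N : ℝ) - 2) / 2) ^ 2 / (2 * ‖x‖ ^ 2)
        + (c' - 1 - (α - b) / 2 * (α - 2 + N)) * ‖x‖ ^ (α - 2) + lam)
    {V : 𝔼 → ℝ} (hV : AEStronglyMeasurable V volume) {C : ℝ} (hC : ∀ᵐ x, |V x| ≤ C)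
    (hVc : ∀ᵐ x : 𝔼, c * ‖x‖ ^ (α - 2) ≤ V x) (hμ : 0 < μ)
    (hu : FormOperator α β b 0 lam u (mulOp 2 V hV C hC u + (μ : ℂ) • u - f))
    (hf : ∀ᵐ x, (f x).re ≤ 0) : ∀ᵐ x, (u x).re ≤ 0 := by
  -- With `m = -1/c` one has `(1+m)c = c - 1`, which is at least `c' - 1`.
  have hm : 0 < -c⁻¹ := neg_pos.2 (inv_lt_zero.2 hc)
  obtain ⟨h1, -, h3⟩ := FormOperator.integral_test_le hN hα0 hα2 hlam hc.le hpos hV hC hVc hu hm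
    one_pos (by rw [add_mul, neg_mul, inv_mul_cancel₀ hc.ne]; linarith)
  have hΦ : ∀ s, 0 ≤ truncPow (-c⁻¹) 1 s * truncPowDeriv (-c⁻¹) 1 s := fun s =>
    mul_nonneg (truncPow_nonneg one_pos s) (truncPowDeriv_nonneg hm one_pos s)
  have h4 : ∫ x, (f x).re * (truncPow (-c⁻¹) 1 (u x).re * truncPowDeriv (-c⁻¹) 1 (u x).re) ≤ 0 :=
    integral_nonpos_of_ae (hf.mono fun x hx => mul_nonpos_of_nonpos_of_nonneg hx (hΦ _))
  have h5 : ∀ x, 0 ≤ (u x).re * (truncPow (-c⁻¹) 1 (u x).re * truncPowDeriv (-c⁻¹) 1 (u x).re) :=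
    fun x => (sq_nonneg _).trans (sq_truncPow_le hm one_pos _).1
  have h6 : ∫ x, (u x).re * (truncPow (-c⁻¹) 1 (u x).re * truncPowDeriv (-c⁻¹) 1 (u x).re) = 0 :=
    le_antisymm (by nlinarith) (integral_nonneg h5)
  rw [integral_eq_zero_iff_of_nonneg h5 h1] at h6
  filter_upwards [h6] with x hx
  by_contra! hs
  have h7 := (sq_truncPow_le hm one_pos (u x).re).1
  have h8 := truncPow_pos (m := -c⁻¹) one_pos hs
  simp only [Pi.zero_apply] at hx
  rw [hx] at h7
  exact absurd h7 (not_le.2 (by positivity))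

/-- Young's inequality, followed by `φ^{P'} ≤ sφ`: the conjugate exponent satisfies `P' - 1 =
1/(P-1)`, and `φ^{1/(P-1)} ≤ s`. -/
lemma mul_le_of_le_rpow_sub_one {P s t φ : ℝ} (hP : 1 < P) (hs : 0 ≤ s) (ht : 0 ≤ t) (hφ : 0 ≤ φ)
    (h : φ ≤ s ^ (P - 1)) : t * φ ≤ t ^ P / P + (1 - P⁻¹) * (s * φ) := by
  have hPq := Real.HolderConjugate.conjExponent hP
  have h1 := Real.young_inequality_of_nonneg ht hφ hPq
  have h2 : φ ^ P.conjExponent ≤ s * φ := by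
    have e : P.conjExponent = (P - 1)⁻¹ + 1 := by
      have : P - 1 ≠ 0 := by linarith
      rw [Real.conjExponent]
      field_simp
      ring
    have hp1 : 0 < P - 1 := by linarith
    rw [e, Real.rpow_add_one' hφ (by positivity)]
    refine mul_le_mul_of_nonneg_right ?_ hφ
    calc φ ^ (P - 1)⁻¹ ≤ (s ^ (P - 1)) ^ (P - 1)⁻¹ :=
          Real.rpow_le_rpow hφ h (by positivity)
      _ = s := Real.rpow_rpow_inv hs hp1.ne'
  have h3 : P.conjExponent⁻¹ = 1 - P⁻¹ := by
    have := hPq.inv_add_inv_eq_one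
    linarith
  rw [← h3]
  refine h1.trans (add_le_add le_rfl ?_)
  rw [div_eq_inv_mul]
  exact mul_le_mul_of_nonneg_left h2 (by rw [h3, sub_nonneg]; exact inv_le_one_of_one_le₀ hP.le)

lemma tendsto_truncPow_mul_deriv {m : ℝ} (hm : 0 < m) {ε : ℕ → ℝ}
    (hε0 : Tendsto ε atTop (𝓝 0)) (s : ℝ) :
    Tendsto (fun k => s * (truncPow m (ε k) s * truncPowDeriv m (ε k) s) / (1 + m)) atTop
      (𝓝 (max s 0 ^ (2 * m + 2))) := by
  rcases le_or_gt s 0 with hs | hs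
  · simp only [truncPow, max_eq_right hs, zero_mul, mul_zero, zero_div]
    rw [Real.zero_rpow (by positivity)]
    exact tendsto_const_nhds
  · simp only [truncPow, truncPowDeriv, saturate, max_eq_left hs.le]
    have h1 : Tendsto (fun k => 1 + ε k * s) atTop (𝓝 1) := by
      simpa using (hε0.mul_const s).const_add 1
    have h2 : Tendsto (fun k => (s / (1 + ε k * s)) ^ m) atTop (𝓝 (s ^ m)) := by
      have h3 : Tendsto (fun k => s / (1 + ε k * s)) atTop (𝓝 s) := by
        have := (tendsto_const_nhds (x := s)).div h1 one_ne_zero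
        rw [div_one] at this
        exact this
      exact h3.rpow_const (Or.inl hs.ne')
    have h4 : Tendsto (fun k => 1 + m / (1 + ε k * s)) atTop (𝓝 (1 + m)) := by
      simpa using (tendsto_const_nhds (x := m).div h1 one_ne_zero).const_add 1
    have h5 := (((h2.const_mul s).mul (h2.mul h4)).const_mul s).div_const (1 + m)
    convert h5 using 2
    rw [show 2 * m + 2 = m + m + 1 + 1 by ring, Real.rpow_add_one hs.ne', Real.rpow_add_one hs.ne',
      Real.rpow_add hs]
    field_simp

/-- The `L^p` estimate for the positive part of the solution of the resolvent equation. -/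
theorem FormOperator.lintegral_rpow_le {u f : LpRN N 2} {μ : ℝ} (hN : 3 ≤ N) (hα0 : 0 < α)
    (hα2 : α < 2) (hlam : 0 < lam) {c P : ℝ} (hc : c < 0) (hP : 2 < P)
    (hpos : ∀ x : 𝔼, x ≠ 0 → 0 < (((N : ℝ) - 2) / 2) ^ 2 / (2 * ‖x‖ ^ 2)
        + (c * P / 2 - 1 - (α - b) / 2 * (α - 2 + N)) * ‖x‖ ^ (α - 2) + lam)
    {V : 𝔼 → ℝ} (hV : AEStronglyMeasurable V volume) {C : ℝ} (hC : ∀ᵐ x, |V x| ≤ C)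
    (hVc : ∀ᵐ x : 𝔼, c * ‖x‖ ^ (α - 2) ≤ V x) (hμ : 0 < μ)
    (hu : FormOperator α β b 0 lam u (mulOp 2 V hV C hC u + (μ : ℂ) • u - f))
    (hf : Integrable fun x => (‖f x‖ / μ) ^ P) :
    ∫⁻ x, ENNReal.ofReal (max (u x).re 0 ^ P) ≤ ENNReal.ofReal (∫ x, (‖f x‖ / μ) ^ P) := by
  -- Then `(1+m)c = cP/2` is the constant in the hypothesis, and the normalized `s W D/(1+m)` tends
  -- to `s₊^P` as `ε → 0`.
  set m : ℝ := P / 2 - 1 with hmdef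
  have hm : 0 < m := by simp only [hmdef]; linarith
  let ε : ℕ → ℝ := fun n => 1 / ((n : ℝ) + 1)
  have hε : ∀ n, 0 < ε n := fun n => by positivity
  let g : ℕ → 𝔼 → ℝ := fun k x =>
    (u x).re * (truncPow m (ε k) (u x).re * truncPowDeriv m (ε k) (u x).re) / (1 + m)
  have hg0 : ∀ k x, 0 ≤ g k x := fun k x =>
    div_nonneg ((sq_nonneg _).trans (sq_truncPow_le hm (hε k) _).1) (by linarith)
  have hg : ∀ k, Integrable (g k) ∧ ∫ x, g k x ≤ ∫ x, (‖f x‖ / μ) ^ P := fun k => by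
    obtain ⟨h1, h2, h3⟩ := FormOperator.integral_test_le hN hα0 hα2 hlam hc.le hpos hV hC hVc hu
      hm (hε k) (by simp only [hmdef]; linarith)
    have ig : Integrable (g k) := h1.div_const _
    refine ⟨ig, ?_⟩
    have ih : Integrable fun x => (f x).re / μ
        * (truncPow m (ε k) (u x).re * truncPowDeriv m (ε k) (u x).re / (1 + m)) := by
      refine (h2.div_const (μ * (1 + m))).congr (Eventually.of_forall fun x => ?_)
      simp only
      field_simp
    have h4 : ∫ x, g k x ≤ ∫ x, (f x).re / μ
        * (truncPow m (ε k) (u x).re * truncPowDeriv m (ε k) (u x).re / (1 + m)) := by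
      have e : ∫ x, (f x).re / μ
        * (truncPow m (ε k) (u x).re * truncPowDeriv m (ε k) (u x).re / (1 + m))
        = (∫ x, (f x).re * (truncPow m (ε k) (u x).re * truncPowDeriv m (ε k) (u x).re))
          / (μ * (1 + m)) := by
        rw [← integral_div]
        refine integral_congr_ae (Eventually.of_forall fun x => ?_)
        simp only
        field_simp
      rw [e, integral_div, le_div_iff₀ (by positivity)]
      refine (le_of_eq ?_).trans h3
      field_simp
    have h5 : ∫ x, (f x).re / μ
        * (truncPow m (ε k) (u x).re * truncPowDeriv m (ε k) (u x).re / (1 + m))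
        ≤ ∫ x, ((‖f x‖ / μ) ^ P / P + (1 - P⁻¹) * g k x) := by
      refine integral_mono ih ((hf.div_const P).add (ig.const_mul _)) fun x => ?_
      have hΦ : 0 ≤ truncPow m (ε k) (u x).re * truncPowDeriv m (ε k) (u x).re / (1 + m) :=
        div_nonneg (mul_nonneg (truncPow_nonneg (hε k) _) (truncPowDeriv_nonneg hm (hε k) _))
          (by linarith)
      have hle : truncPow m (ε k) (u x).re * truncPowDeriv m (ε k) (u x).re / (1 + m)
          ≤ max (u x).re 0 ^ (P - 1) := by
        rw [div_le_iff₀ (by linarith), mul_comm (_ ^ _)]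
        have := truncPow_mul_deriv_le hm (hε k) (u x).re
        rwa [show 2 * m + 1 = P - 1 by simp only [hmdef]; ring] at this
      have h6 := mul_le_of_le_rpow_sub_one (by linarith) (le_max_right (u x).re 0)
        (by positivity : 0 ≤ ‖f x‖ / μ) hΦ hle
      have e : max (u x).re 0
          * (truncPow m (ε k) (u x).re * truncPowDeriv m (ε k) (u x).re / (1 + m)) = g k x := by
        simp only [g]
        rcases le_or_gt (u x).re 0 with hs | hs
        · simp [truncPow, max_eq_right hs]
        · rw [max_eq_left hs.le]; ring
      rw [e] at h6
      refine le_trans ?_ h6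
      refine mul_le_mul_of_nonneg_right ?_ hΦ
      exact div_le_div_of_nonneg_right (Complex.re_le_norm _) hμ.le
    rw [integral_add (hf.div_const P) (ig.const_mul _), integral_div, integral_const_mul] at h5
    have hPi : 0 < P⁻¹ := by positivity
    have h6 := h4.trans h5
    rw [div_eq_inv_mul] at h6
    -- For fixed `ε` the integral of `g k` is finite, so its fraction `1 - 1/P` can be absorbed on
    -- the left. The constant that remains is exactly `1`, as contractivity requires.
    have h7 : P⁻¹ * ∫ x, g k x ≤ P⁻¹ * ∫ x, (‖f x‖ / μ) ^ P := by linarith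
    exact le_of_mul_le_mul_left h7 hPi
  calc ∫⁻ x, ENNReal.ofReal (max (u x).re 0 ^ P)
      = ∫⁻ x, liminf (fun k => ENNReal.ofReal (g k x)) atTop := by
        refine lintegral_congr fun x => ?_
        have h1 := tendsto_truncPow_mul_deriv hm
          (tendsto_one_div_add_atTop_nhds_zero_nat (𝕜 := ℝ)) (u x).re
        rw [show 2 * m + 2 = P by simp only [hmdef]; ring] at h1
        exact ((ENNReal.continuous_ofReal.tendsto _).comp h1).liminf_eq.symm
    _ ≤ liminf (fun k => ∫⁻ x, ENNReal.ofReal (g k x)) atTop :=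
        lintegral_liminf_le' fun k => (hg k).1.1.aemeasurable.ennreal_ofReal
    _ ≤ _ := by
        refine liminf_le_of_frequently_le' (Frequently.of_forall fun k => ?_)
        rw [← ofReal_integral_eq_lintegral_ofReal (hg k).1 (Eventually.of_forall (hg0 k))]
        exact ENNReal.ofReal_le_ofReal (hg k).2

end LpBound

/-! ### Positivity and `L^p` contractivity of the resolvents -/

section ResolventBounds

variable {N : ℕ} {α β b lam : ℝ}

local notation "𝔼" => EuclideanSpace ℝ (Fin N)

theorem IsFormResolvent.re_nonneg (hN : 3 ≤ N) (hα0 : 0 < α)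
    (hα2 : α < 2) (hlam : 0 < lam) {c c' : ℝ} (hc : c < 0) (hcc : c' ≤ c)
    (hpos : ∀ x : 𝔼, x ≠ 0 → 0 < (((N : ℝ) - 2) / 2) ^ 2 / (2 * ‖x‖ ^ 2)
        + (c' - 1 - (α - b) / 2 * (α - 2 + N)) * ‖x‖ ^ (α - 2) + lam)
    {V : 𝔼 → ℝ} {hV : AEStronglyMeasurable V volume} {C : ℝ} {hC : ∀ᵐ x, |V x| ≤ C}
    (hVc : ∀ᵐ x : 𝔼, c * ‖x‖ ^ (α - 2) ≤ V x) {R : ℝ → LpRN N 2 →L[ℂ] LpRN N 2}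
    (hR : IsFormResolvent α β b lam (mulOp 2 V hV C hC) R) {μ : ℝ} (hμ : 0 < μ) (f : LpRN N 2)
    (hf : ∀ᵐ x, 0 ≤ (f x).re) : ∀ᵐ x, 0 ≤ (R μ f x).re := by
  have h1 := (hR.formOperator hμ (-f)).re_nonpos hN hα0 hα2 hlam hc hcc hpos hV hC hVc hμ (by
    filter_upwards [hf, Lp.coeFn_neg f] with x hx h
    rw [h, Pi.neg_apply, Complex.neg_re]
    linarith)
  filter_upwards [h1, Lp.coeFn_neg (R μ f)] with x hx h
  rw [map_neg, h, Pi.neg_apply, Complex.neg_re] at hx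
  linarith

/-- Positivity gives `|R f| ≤ Re R|f|`, so the truncated-power estimate for the positive part of the
real part suffices for complex data. That estimate needs `p > 2`, since `m = p/2 - 1` must be
positive; for `p = 2` the bound is the operator norm bound. -/
theorem IsFormResolvent.eLpNorm_le (hN : 3 ≤ N) (hα0 : 0 < α)
    (hα2 : α < 2) (hlam : 0 < lam) {c : ℝ} (hc : c < 0) {p : ℝ≥0∞} (hp2 : 2 ≤ p) (hp : p ≠ ⊤)
    (hpos : ∀ x : 𝔼, x ≠ 0 → 0 < (((N : ℝ) - 2) / 2) ^ 2 / (2 * ‖x‖ ^ 2)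
        + (c * p.toReal / 2 - 1 - (α - b) / 2 * (α - 2 + N)) * ‖x‖ ^ (α - 2) + lam)
    {V : 𝔼 → ℝ} {hV : AEStronglyMeasurable V volume} {C : ℝ} {hC : ∀ᵐ x, |V x| ≤ C}
    (hVc : ∀ᵐ x : 𝔼, c * ‖x‖ ^ (α - 2) ≤ V x) {R : ℝ → LpRN N 2 →L[ℂ] LpRN N 2}
    (hR : IsFormResolvent α β b lam (mulOp 2 V hV C hC) R) {μ : ℝ} (hμ : 0 < μ) (f : LpRN N 2)
    (hf : MemLp f p volume) :
    eLpNorm (R μ f) p volume ≤ ENNReal.ofReal μ⁻¹ * eLpNorm f p volume := by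
  have hμi : 0 < μ⁻¹ := inv_pos.2 hμ
  rcases eq_or_lt_of_le hp2 with rfl | hlt
  · rw [← Lp.enorm_def, ← Lp.enorm_def, ← ofReal_norm, ← ofReal_norm,
      ← ENNReal.ofReal_mul hμi.le]
    exact ENNReal.ofReal_le_ofReal ((R μ).le_of_opNorm_le (hR.1 μ hμ) f)
  · have hP : 2 < p.toReal := by
      rw [← ENNReal.toReal_ofNat]
      exact (ENNReal.toReal_lt_toReal (by simp) hp).2 hlt
    have hp0 : p ≠ 0 := (lt_of_le_of_lt bot_le hlt).ne'
    have hcc : c * p.toReal / 2 ≤ c := by nlinarith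
    have hre := fun g hg => hR.re_nonneg hN hα0 hα2 hlam hc hcc hpos hVc hμ g hg
    have hnm : MemLp (fun x => (‖f x‖ : ℂ)) 2 volume :=
      (Lp.memLp f).norm.ofReal
    let g : LpRN N 2 := hnm.toLp
    have hg : g =ᵐ[volume] fun x => (‖f x‖ : ℂ) := hnm.coeFn_toLp
    have hgn : ∀ᵐ x, ‖g x‖ = ‖f x‖ := by
      filter_upwards [hg] with x hx
      rw [hx, Complex.norm_real, norm_norm]
    have hdom : ∀ᵐ x, ‖R μ f x‖ ≤ (R μ g x).re := norm_apply_le_of_re_nonneg hre (by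
      filter_upwards [hg] with x hx
      rw [hx, Complex.ofReal_re])
    have hsc : MemLp (fun x => μ⁻¹ • g x) p volume :=
      ((memLp_congr_norm hf.1 (Lp.aestronglyMeasurable g) (hgn.mono fun x hx => hx.symm)).1 hf).const_smul μ⁻¹
    have hint : Integrable fun x => (‖g x‖ / μ) ^ p.toReal := by
      refine (hsc.integrable_norm_rpow hp0 hp).congr (Eventually.of_forall fun x => ?_)
      simp only
      rw [norm_smul, Real.norm_of_nonneg hμi.le, div_eq_inv_mul]
    have key := (hR.formOperator hμ g).lintegral_rpow_le hN hα0 hα2 hlam hc hP hpos hV hC hVc hμ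
      hint
    have e1 : eLpNorm f p volume = eLpNorm g p volume :=
      eLpNorm_congr_norm_ae (hgn.mono fun x hx => hx.symm)
    have e2 : ENNReal.ofReal μ⁻¹ * eLpNorm g p volume
        = eLpNorm (fun x => μ⁻¹ • g x) p volume := by
      have := eLpNorm_const_smul (μ⁻¹ : ℝ) (g : 𝔼 → ℂ) p volume
      rw [Real.enorm_of_nonneg hμi.le] at this
      exact this.symm
    rw [e1, e2, eLpNorm_eq_lintegral_rpow_enorm_toReal hp0 hp,
      eLpNorm_eq_lintegral_rpow_enorm_toReal hp0 hp]
    refine ENNReal.rpow_le_rpow ?_ (by positivity)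
    have e3 : ENNReal.ofReal (∫ x, (‖g x‖ / μ) ^ p.toReal)
        = ∫⁻ x, ‖μ⁻¹ • g x‖ₑ ^ p.toReal := by
      rw [ofReal_integral_eq_lintegral_ofReal hint (Eventually.of_forall fun x => by positivity)]
      refine lintegral_congr fun x => ?_
      rw [← ENNReal.ofReal_rpow_of_nonneg (by positivity) (by positivity), ← ofReal_norm,
        norm_smul, Real.norm_of_nonneg hμi.le, div_eq_inv_mul]
    rw [← e3]
    refine le_trans (lintegral_mono_ae ?_) key
    filter_upwards [hdom] with x hx
    rw [← ofReal_norm, ENNReal.ofReal_rpow_of_nonneg (norm_nonneg _) (by positivity)]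
    exact ENNReal.ofReal_le_ofReal (Real.rpow_le_rpow (norm_nonneg _) (hx.trans (le_max_left _ _))
      (by positivity))

end ResolventBounds

/-! ### Test functions lie in the domain -/

section TestFunctions

variable {N : ℕ} {α β b lam : ℝ}

local notation "𝔼" => EuclideanSpace ℝ (Fin N)

/-- The weights `|x|^γ` are smooth off the origin, so multiplication by them preserves the class;
this is why test functions are kept away from `0`. -/
lemma IsTestAwayFromZero.mul_left {u : 𝔼 → ℂ} (hu : IsTestAwayFromZero u) {θ : 𝔼 → ℝ}
    (hθ : ∀ x, x ≠ 0 → ContDiffAt ℝ ∞ θ x) : IsTestAwayFromZero fun x => (θ x : ℂ) * u x := by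
  have hsub : tsupport (fun x => (θ x : ℂ) * u x) ⊆ tsupport u := tsupport_mul_subset_right
  refine ⟨contDiff_iff_contDiffAt.2 fun x => ?_, hu.2.1.mul_left, fun h => hu.2.2 (hsub h)⟩
  by_cases hx : x ∈ tsupport fun x => (θ x : ℂ) * u x
  swap
  · exact contDiffAt_const.congr_of_eventuallyEq (notMem_tsupport_iff_eventuallyEq.1 hx)
  have hx0 : x ≠ 0 := fun h => hu.2.2 (hsub (h ▸ hx))
  have h1 : ContDiffAt ℝ ∞ (fun x => (θ x : ℂ)) x :=
    Complex.ofRealCLM.contDiff.contDiffAt.comp x (hθ x hx0)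
  exact h1.mul hu.1.contDiffAt

lemma IsTestAwayFromZero.add {u v : 𝔼 → ℂ} (hu : IsTestAwayFromZero u)
    (hv : IsTestAwayFromZero v) : IsTestAwayFromZero fun x => u x + v x := by
  refine ⟨hu.1.add hv.1, hu.2.1.add hv.2.1, fun h => ?_⟩
  rcases tsupport_add u v h with h | h
  · exact hu.2.2 h
  · exact hv.2.2 h

lemma isTestAwayFromZero_zero : IsTestAwayFromZero fun _ : 𝔼 => (0 : ℂ) := by
  refine ⟨contDiff_const, HasCompactSupport.zero, ?_⟩
  rw [show (fun _ : 𝔼 => (0 : ℂ)) = 0 from rfl, tsupport_zero]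
  simp

lemma IsTestAwayFromZero.finsetSum {ι : Type*} (s : Finset ι) {u : ι → 𝔼 → ℂ}
    (hu : ∀ i, IsTestAwayFromZero (u i)) : IsTestAwayFromZero fun x => ∑ i ∈ s, u i x := by
  classical
  induction s using Finset.induction_on with
  | empty => simpa using isTestAwayFromZero_zero
  | insert i s hi ih =>
    simp only [Finset.sum_insert hi]
    exact (hu i).add ih

lemma IsTestAwayFromZero.fderiv_apply {u : 𝔼 → ℂ} (hu : IsTestAwayFromZero u) (e : 𝔼) :
    IsTestAwayFromZero fun x => fderiv ℝ u x e :=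
  ⟨(hu.1.fderiv_right (m := ∞) (by simp)).clm_apply contDiff_const, hu.2.1.fderiv_apply ℝ e,
    fun h => hu.2.2 (tsupport_fderiv_apply_subset ℝ e h)⟩

lemma IsTestAwayFromZero.isWeakGradient {u : 𝔼 → ℂ} (hu : IsTestAwayFromZero u) :
    IsWeakGradient ((hu.memLp 2).toLp : LpRN N 2)
      fun i => ((hu.fderiv_apply (EuclideanSpace.single i 1)).memLp 2).toLp := by
  intro i φ hφ hc
  set e : 𝔼 := EuclideanSpace.single i 1
  have hd := hu.fderiv_apply e
  have h1 : ∫ x, fderiv ℝ φ x e • ((hu.memLp 2).toLp : LpRN N 2) x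
      = ∫ x, fderiv ℝ φ x e • u x := by
    refine integral_congr_ae ?_
    filter_upwards [(hu.memLp 2).coeFn_toLp] with x hx
    rw [hx]
  have h2 : ∫ x, φ x • ((hd.memLp 2).toLp : LpRN N 2) x = ∫ x, φ x • fderiv ℝ u x e := by
    refine integral_congr_ae ?_
    filter_upwards [(hd.memLp 2).coeFn_toLp] with x hx
    rw [hx]
  rw [h1, h2, ← neg_eq_iff_eq_neg, ← integral_smul_fderiv_eq_neg_fderiv_smul_of_integrable]
  · exact ((continuous_fderiv_apply hφ e).smul hu.1.continuous).integrable_of_hasCompactSupport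
      hu.2.1.smul_left
  · exact (hφ.continuous.smul hd.1.continuous).integrable_of_hasCompactSupport hc.smul_right
  · exact (hφ.continuous.smul hu.1.continuous).integrable_of_hasCompactSupport hc.smul_right
  · exact fun x _ => hφ.differentiable (by simp) x
  · exact fun x _ => hu.1.differentiable (by simp) x

lemma contDiffAt_norm_rpow (γ : ℝ) {x : 𝔼} (hx : x ≠ 0) :
    ContDiffAt ℝ ∞ (fun x : 𝔼 => ‖x‖ ^ γ) x :=
  (contDiffAt_norm ℝ hx).rpow_const_of_ne (norm_ne_zero_iff.2 hx)

lemma IsTestAwayFromZero.memLp_sqrt_smul {u : 𝔼 → ℂ} (hu : IsTestAwayFromZero u) {θ : 𝔼 → ℝ}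
    (hθ : ∀ x, x ≠ 0 → ContDiffAt ℝ ∞ θ x) (hθ0 : ∀ x, x ≠ 0 → 0 < θ x) {U : LpRN N 2}
    (hU : U =ᵐ[volume] u) : MemLp (fun x => √(θ x) • U x) 2 volume := by
  refine ((hu.mul_left (θ := fun x => √(θ x)) fun x hx =>
    (hθ x hx).sqrt (hθ0 x hx).ne').memLp 2).ae_eq ?_
  filter_upwards [hU] with x hx
  rw [hx, Complex.real_smul]

lemma IsTestAwayFromZero.inFormDomain {u : 𝔼 → ℂ} (hu : IsTestAwayFromZero u) :
    InFormDomain α β ((hu.memLp 2).toLp : LpRN N 2)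
      fun i => ((hu.fderiv_apply (EuclideanSpace.single i 1)).memLp 2).toLp :=
  ⟨hu.isWeakGradient,
    fun i => (hu.fderiv_apply _).memLp_sqrt_smul
      (fun x hx => contDiffAt_const.add (contDiffAt_norm_rpow α hx))
      (fun x _ => by positivity) (MemLp.coeFn_toLp _),
    hu.memLp_sqrt_smul (fun x hx => contDiffAt_norm_rpow _ hx)
      (fun x hx => Real.rpow_pos_of_pos (norm_pos_iff.2 hx) _) (MemLp.coeFn_toLp _),
    hu.memLp_sqrt_smul (fun x hx => contDiffAt_norm_rpow _ hx)
      (fun x hx => Real.rpow_pos_of_pos (norm_pos_iff.2 hx) _) (MemLp.coeFn_toLp _)⟩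

lemma laplacian_eq_sum_fderiv {u : 𝔼 → ℂ} (hu : ContDiff ℝ ∞ u) (x : 𝔼) :
    Laplacian.laplacian u x = ∑ i, fderiv ℝ (fun y => fderiv ℝ u y (EuclideanSpace.single i 1)) x
      (EuclideanSpace.single i 1) := by
  rw [InnerProductSpace.laplacian_eq_iteratedFDeriv_orthonormalBasis u
    (EuclideanSpace.basisFun (Fin N) ℝ)]
  refine Finset.sum_congr rfl fun i _ => ?_
  have hd : DifferentiableAt ℝ (fderiv ℝ u) x :=
    (hu.fderiv_right (m := ∞) (by simp)).differentiable (by simp) x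
  rw [iteratedFDeriv_two_apply, fderiv_clm_apply hd (differentiableAt_const _)]
  simp

lemma fderiv_apply_self_eq_sum (u : 𝔼 → ℂ) (x : 𝔼) :
    fderiv ℝ u x x = ∑ i, (x i : ℂ) * fderiv ℝ u x (EuclideanSpace.single i 1) := by
  have h := congrArg (fderiv ℝ u x) ((EuclideanSpace.basisFun (Fin N) ℝ).sum_repr x)
  rw [← h, map_sum]
  refine Finset.sum_congr rfl fun i _ => ?_
  rw [map_smul, Complex.real_smul]
  simp

lemma IsTestAwayFromZero.diffOp_sub {u : 𝔼 → ℂ} (hu : IsTestAwayFromZero u) (c : ℝ) :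
    IsTestAwayFromZero fun x => diffOp α β b c u x - (lam : ℂ) * u x := by
  have h1 : IsTestAwayFromZero fun x : 𝔼 => ((1 + ‖x‖ ^ α : ℝ) : ℂ) * Laplacian.laplacian u x := by
    refine IsTestAwayFromZero.mul_left (u := Laplacian.laplacian u) (θ := fun x => 1 + ‖x‖ ^ α) ?_
      fun x hx => contDiffAt_const.add (contDiffAt_norm_rpow α hx)
    rw [show Laplacian.laplacian u = _ from funext (laplacian_eq_sum_fderiv hu.1)]
    exact IsTestAwayFromZero.finsetSum _ fun i => (hu.fderiv_apply _).fderiv_apply _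
  have h2 : IsTestAwayFromZero fun x : 𝔼 => ((b * ‖x‖ ^ (α - 2) : ℝ) : ℂ) * fderiv ℝ u x x := by
    refine IsTestAwayFromZero.mul_left (u := fun x => fderiv ℝ u x x)
      (θ := fun x => b * ‖x‖ ^ (α - 2)) ?_
      fun x hx => contDiffAt_const.mul (contDiffAt_norm_rpow _ hx)
    simp only [fderiv_apply_self_eq_sum u]
    exact IsTestAwayFromZero.finsetSum _ fun i =>
      (hu.fderiv_apply _).mul_left (θ := fun x => x i) fun x _ => by fun_prop
  have h3 : IsTestAwayFromZero fun x : 𝔼 =>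
      ((-(c * ‖x‖ ^ (α - 2)) - ‖x‖ ^ β - lam : ℝ) : ℂ) * u x :=
    hu.mul_left (θ := fun x => -(c * ‖x‖ ^ (α - 2)) - ‖x‖ ^ β - lam) fun x hx =>
      ((contDiffAt_const.mul (contDiffAt_norm_rpow _ hx)).neg.sub (contDiffAt_norm_rpow _ hx)).sub
        contDiffAt_const
  convert (h1.add h2).add h3 using 2 with x
  simp only [diffOp]
  push_cast
  ring

/-- This derivative explains the coefficient `α - b` of the form: `div((1+|x|^α)∇u)` contributes
`α|x|^{α-2}x·∇u`, from which the form drift leaves `b|x|^{α-2}x·∇u`. -/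
lemma fderiv_one_add_norm_rpow (α : ℝ) {x : 𝔼} (hx : x ≠ 0) (i : Fin N) :
    fderiv ℝ (fun x : 𝔼 => 1 + ‖x‖ ^ α) x (EuclideanSpace.single i 1)
      = α * ‖x‖ ^ (α - 2) * x i := by
  have hpow : ∀ (γ : ℝ) (y : 𝔼), ‖y‖ ^ γ = (‖y‖ ^ 2) ^ (γ / 2) := fun γ y => by
    rw [← Real.rpow_natCast, ← Real.rpow_mul (norm_nonneg y)]
    congr 1
    push_cast
    ring
  have hx2 : ‖x‖ ^ 2 ≠ 0 := pow_ne_zero 2 (norm_ne_zero_iff.2 hx)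
  have h1 : HasDerivAt (fun r : ℝ => 1 + r ^ (α / 2)) (α / 2 * (‖x‖ ^ 2) ^ (α / 2 - 1))
      (‖x‖ ^ 2) := (Real.hasDerivAt_rpow_const (Or.inl hx2)).const_add 1
  have h2 := hasFDerivAt_comp_norm_sq h1 i
  simp only [← hpow] at h2
  rw [h2, hpow (α - 2), show (α - 2) / 2 = α / 2 - 1 by ring]
  ring

/-- Test functions lie in the domain of the form operator. -/
theorem IsTestAwayFromZero.formOperator {u : 𝔼 → ℂ} (hu : IsTestAwayFromZero u) (hN : 0 < N) :
    FormOperator α β b 0 lam ((hu.memLp 2).toLp : LpRN N 2)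
      (((hu.diffOp_sub (α := α) (β := β) (b := b) (lam := lam) 0).memLp 2).toLp) := by
  have hdom : InFormDomain α β ((hu.memLp 2).toLp : LpRN N 2)
      fun i => ((hu.fderiv_apply (EuclideanSpace.single i 1)).memLp 2).toLp := hu.inFormDomain
  have hW := hu.diffOp_sub (α := α) (β := β) (b := b) (lam := lam) 0
  refine ⟨_, hdom, fun h H hh => ?_⟩
  -- The components of the flux `(1+|x|^α)∇u` are again test functions, so the integration by parts
  -- for two weakly differentiable functions applies to each of them against `h`.
  let ψ : Fin N → 𝔼 → ℂ := fun i x => ((1 + ‖x‖ ^ α : ℝ) : ℂ) * fderiv ℝ u x (EuclideanSpace.single i 1)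
  have hψ : ∀ i, IsTestAwayFromZero (ψ i) := fun i =>
    (hu.fderiv_apply (EuclideanSpace.single i 1)).mul_left (θ := fun x => 1 + ‖x‖ ^ α)
      fun x hx => contDiffAt_const.add (contDiffAt_norm_rpow α hx)
  have hψd : ∀ i, ∀ x : 𝔼, x ≠ 0 → fderiv ℝ (ψ i) x (EuclideanSpace.single i 1)
      = ((1 + ‖x‖ ^ α : ℝ) : ℂ) * fderiv ℝ (fun y => fderiv ℝ u y (EuclideanSpace.single i 1)) x (EuclideanSpace.single i 1)
        + ((α * ‖x‖ ^ (α - 2) : ℝ) : ℂ) * ((x i : ℂ) * fderiv ℝ u x (EuclideanSpace.single i 1)) := fun i x hx => by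
    have hθ := fderiv_one_add_norm_rpow α hx i
    have hd1 : DifferentiableAt ℝ (fun x : 𝔼 => 1 + ‖x‖ ^ α) x :=
      (contDiffAt_const.add (contDiffAt_norm_rpow α hx)).differentiableAt (by simp)
    have hd2 : DifferentiableAt ℝ (fun y => fderiv ℝ u y (EuclideanSpace.single i 1)) x :=
      (hu.fderiv_apply _).1.differentiable (by simp) x
    have e1 : ψ i = fun x => (1 + ‖x‖ ^ α) • fderiv ℝ u x (EuclideanSpace.single i 1) := by
      funext y
      rw [Complex.real_smul]
    rw [e1, fderiv_fun_smul hd1 hd2]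
    simp only [add_apply, smul_apply,
      ContinuousLinearMap.smulRight_apply, hθ, Complex.real_smul]
    push_cast
    ring
  have hibp : ∀ i, ∫ x, ψ i x * conj (H i x) = -∫ x, fderiv ℝ (ψ i) x (EuclideanSpace.single i 1) * conj (h x) :=
    fun i => by
    have := hh.weakGradient.inner_eq_neg (hψ i).isWeakGradient i
    rw [inner_eq_integral_mul_conj, inner_eq_integral_mul_conj] at this
    have e1 : ∫ x, (((hψ i).memLp 2).toLp : LpRN N 2) x * conj (H i x)
        = ∫ x, ψ i x * conj (H i x) := by
      refine integral_congr_ae ?_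
      filter_upwards [((hψ i).memLp 2).coeFn_toLp] with x hx
      rw [hx]
    have e2 : ∫ x, ((((hψ i).fderiv_apply (EuclideanSpace.single i 1)).memLp 2).toLp : LpRN N 2) x * conj (h x)
        = ∫ x, fderiv ℝ (ψ i) x (EuclideanSpace.single i 1) * conj (h x) := by
      refine integral_congr_ae ?_
      filter_upwards [(((hψ i).fderiv_apply (EuclideanSpace.single i 1)).memLp 2).coeFn_toLp] with x hx
      rw [hx]
    rw [← e1, ← e2]
    exact this
  have iψ : ∀ i, Integrable fun x => ψ i x * conj (H i x) := fun i =>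
    integrable_mul_conj ((hψ i).memLp 2) (Lp.memLp (H i))
  have iψ' : ∀ i, Integrable fun x => fderiv ℝ (ψ i) x (EuclideanSpace.single i 1) * conj (h x) := fun i =>
    integrable_mul_conj (((hψ i).fderiv_apply (EuclideanSpace.single i 1)).memLp 2) (Lp.memLp h)
  have iS := hdom.integrable_sesqIntegrand hh hN b lam
  rw [sesqForm_zero_eq]
  have hsum : ∫ x, ∑ i, ψ i x * conj (H i x)
      = -∫ x, ∑ i, fderiv ℝ (ψ i) x (EuclideanSpace.single i 1) * conj (h x) := by
    rw [integral_finsetSum _ fun i _ => iψ i, integral_finsetSum _ fun i _ => iψ' i,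
      ← Finset.sum_neg_distrib]
    exact Finset.sum_congr rfl fun i _ => hibp i
  have iA : Integrable fun x => ∑ i, ψ i x * conj (H i x) :=
    integrable_finsetSum _ fun i _ => iψ i
  have iB : Integrable fun x => ∑ i, fderiv ℝ (ψ i) x (EuclideanSpace.single i 1) * conj (h x) :=
    integrable_finsetSum _ fun i _ => iψ' i
  have iC : Integrable fun x => -(diffOp α β b 0 u x - (lam : ℂ) * u x) * conj (h x) :=
    integrable_mul_conj (hW.memLp 2).neg (Lp.memLp h)
  have hRHS : ∫ x, -((hW.memLp 2).toLp : LpRN N 2) x * conj (h x)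
      = ∫ x, -(diffOp α β b 0 u x - (lam : ℂ) * u x) * conj (h x) := by
    refine integral_congr_ae ?_
    filter_upwards [(hW.memLp 2).coeFn_toLp] with x hx
    rw [hx]
  rw [hRHS, ← sub_eq_zero, ← integral_sub iS iC]
  have hz : ∫ x, ((∑ i, ψ i x * conj (H i x))
      + ∑ i, fderiv ℝ (ψ i) x (EuclideanSpace.single i 1) * conj (h x)) = 0 := by
    rw [integral_add iA iB, hsum]
    ring
  rw [← hz]
  refine integral_congr_ae ?_
  filter_upwards [ae_ne_zero hN, (hu.memLp 2).coeFn_toLp,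
    ae_all_iff.2 fun i => ((hu.fderiv_apply (EuclideanSpace.single i 1)).memLp 2).coeFn_toLp] with x hx h1 h2
  simp only [sesqIntegrand, diffOp, h1, h2, hψd _ x hx, laplacian_eq_sum_fderiv hu.1,
    fderiv_apply_self_eq_sum u x, ψ]
  rw [← Finset.sum_mul, Finset.sum_add_distrib, ← Finset.mul_sum, ← Finset.mul_sum]
  have t1 : ∑ i, ((1 + ‖x‖ ^ α : ℝ) : ℂ) * fderiv ℝ u x (EuclideanSpace.single i 1)
      * conj (H i x) = ((1 + ‖x‖ ^ α : ℝ) : ℂ)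
        * ∑ i, fderiv ℝ u x (EuclideanSpace.single i 1) * conj (H i x) := by
    rw [Finset.mul_sum]
    exact Finset.sum_congr rfl fun i _ => by ring
  rw [t1]
  push_cast
  ring

end TestFunctions

/-! ### Extended resolvents and identification of generators on `L^p` -/

section Extrapolation

variable {N : ℕ} {α β b lam : ℝ} {p : ℝ≥0∞} [Fact (1 ≤ p)]

local notation "𝔼" => EuclideanSpace ℝ (Fin N)

/-- The Hille–Yosida theorem with the resolvent identity written with complex scalars. -/
theorem hille_yosida_complex {X : Type*} [NormedAddCommGroup X] [NormedSpace ℂ X]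
    [CompleteSpace X] (R : ℝ → X →L[ℂ] X) (hR : ∀ μ, 0 < μ → ‖R μ‖ ≤ μ⁻¹)
    (hres : ∀ μ ν, 0 < μ → 0 < ν → R μ - R ν = ((ν - μ : ℝ) : ℂ) • (R μ * R ν))
    (hdense : Dense {f | ∃ g, R 1 (f - g) = f}) :
    ∃ T : C0Semigroup X, T.IsContractive ∧ (∀ f g, T.Gen f g ↔ R 1 (f - g) = f) ∧
      ∀ t f, Tendsto (fun n : ℕ => (C0Semigroup.ofBounded (yosida R (n + 1))).op t f) atTop
        (𝓝 (T.op t f)) :=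
  hille_yosida R hR (fun μ ν hμ hν => (hres μ ν hμ hν).trans (Complex.coe_smul _ _)) hdense

variable {M : LpRN N 2 →L[ℂ] LpRN N 2} {R : ℝ → LpRN N 2 →L[ℂ] LpRN N 2}

lemma IsFormResolvent.sub_eq (hR : IsFormResolvent α β b lam M R) {μ ν : ℝ} (hμ : 0 < μ)
    (hν : 0 < ν) : R μ - R ν = ((ν - μ : ℝ) : ℂ) • (R μ * R ν) := by
  ext1 f
  exact hR.resolvent_identity hμ hν f

/-- Resolvents on `L²` with `L^p` bounds extend to resolvents on `L^p`. -/
lemma IsFormResolvent.exists_extension (hR : IsFormResolvent α β b lam M R) (hp2 : 2 ≤ p)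
    (hp : p ≠ ⊤) (hb : ∀ μ, 0 < μ → ∀ f : LpRN N 2, MemLp f p volume →
      eLpNorm (R μ f) p volume ≤ ENNReal.ofReal μ⁻¹ * eLpNorm f p volume) :
    ∃ Q : ℝ → LpRN N p →L[ℂ] LpRN N p, (∀ μ, 0 < μ → ‖Q μ‖ ≤ μ⁻¹) ∧
      (∀ μ, 0 < μ → AreConsistent (R μ) (Q μ)) ∧
      ∀ μ ν, 0 < μ → 0 < ν → Q μ - Q ν = ((ν - μ : ℝ) : ℂ) • (Q μ * Q ν) := by
  have hex : ∀ μ : ℝ, ∃ Q : LpRN N p →L[ℂ] LpRN N p, 0 < μ → ‖Q‖ ≤ μ⁻¹ ∧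
      AreConsistent (R μ) Q := fun μ => by
    by_cases hμ : 0 < μ
    · obtain ⟨Q, h1, h2⟩ := exists_consistent_extension hp2 hp (R μ) (inv_pos.2 hμ).le (hb μ hμ)
      exact ⟨Q, fun _ => ⟨h1, h2⟩⟩
    · exact ⟨0, fun h => absurd h hμ⟩
  choose Q hQ using hex
  refine ⟨Q, fun μ hμ => (hQ μ hμ).1, fun μ hμ => (hQ μ hμ).2, fun μ ν hμ hν => ?_⟩
  refine eq_of_consistent hp2 hp (A := R μ - R ν) ((hQ μ hμ).2.sub (hQ ν hν).2) ?_
  rw [hR.sub_eq hμ hν]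
  exact ((hQ μ hμ).2.mul (hQ ν hν).2).smul _

variable {V : EuclideanSpace ℝ (Fin N) → ℝ} {hV : AEStronglyMeasurable V volume} {C : ℝ}
  {hC : ∀ᵐ x, |V x| ≤ C}

/-- Test functions lie in the range of the extended resolvents. -/
lemma IsFormResolvent.apply_test (hN : 0 < N)
    (hR : IsFormResolvent α β b lam (mulOp 2 V hV C hC) R) {Q : ℝ → LpRN N p →L[ℂ] LpRN N p}
    (hQ : AreConsistent (R 1) (Q 1)) {u : 𝔼 → ℂ} (hu : IsTestAwayFromZero u) {f g : LpRN N p}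
    (hf : f =ᵐ[volume] u)
    (hg : ∀ᵐ x, g x = diffOp α β b 0 u x - (lam : ℂ) * u x - (V x : ℂ) * u x) :
    Q 1 (f - g) = f := by
  set U : LpRN N 2 := (hu.memLp 2).toLp
  have hW := hu.diffOp_sub (α := α) (β := β) (b := b) (lam := lam) 0
  set W : LpRN N 2 := (hW.memLp 2).toLp
  have h1 : R 1 (U - (W - mulOp 2 V hV C hC U)) = U := by
    rw [hR.2 1 one_pos]
    convert hu.formOperator hN using 1
    rw [Complex.ofReal_one]
    module
  have hU : U =ᵐ[volume] u := MemLp.coeFn_toLp _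
  have h2 := hQ (U - (W - mulOp 2 V hV C hC U)) (f - g) (by
    filter_upwards [hU, hf, hg, (hW.memLp 2).coeFn_toLp, mulOp_coeFn hV hC U,
      Lp.coeFn_sub U (W - mulOp 2 V hV C hC U), Lp.coeFn_sub W (mulOp 2 V hV C hC U),
      Lp.coeFn_sub f g] with x e1 e2 e3 e4 e5 e6 e7 e8
    rw [e6, Pi.sub_apply, e7, Pi.sub_apply, e5, e8, Pi.sub_apply, e2, e3, e1]
    rw [show W x = _ from e4])
  rw [h1] at h2
  ext1
  exact h2.symm.trans (hU.trans hf.symm)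

/-- The domain contains the test functions, which are dense. -/
lemma IsFormResolvent.dense (hN : 0 < N) (hp : p ≠ ⊤)
    (hR : IsFormResolvent α β b lam (mulOp 2 V hV C hC) R) {Q : ℝ → LpRN N p →L[ℂ] LpRN N p}
    (hQ : AreConsistent (R 1) (Q 1)) : Dense {f | ∃ g, Q 1 (f - g) = f} := by
  refine (dense_isTestAwayFromZero hN hp).mono ?_
  rintro f ⟨u, hu, hf⟩
  have hW := hu.diffOp_sub (α := α) (β := β) (b := b) (lam := lam) 0
  refine ⟨(hW.memLp p).toLp - mulOp p V hV C hC f, hR.apply_test hN hQ hu hf ?_⟩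
  filter_upwards [hf, (hW.memLp p).coeFn_toLp, mulOp_coeFn hV hC f,
    Lp.coeFn_sub (hW.memLp p).toLp (mulOp p V hV C hC f)] with x e1 e2 e3 e4
  rw [e4, Pi.sub_apply, e2, e3, e1]

/-- Consistency passes from resolvents to the exponentials of their Yosida approximations, and then
to the strong limits, which must agree almost everywhere. -/
lemma IsConsistent.of_yosida {R : ℝ → LpRN N 2 →L[ℂ] LpRN N 2}
    {Q : ℝ → LpRN N p →L[ℂ] LpRN N p} (hQ : ∀ μ, 0 < μ → AreConsistent (R μ) (Q μ))
    {T : C0Semigroup (LpRN N 2)} {S : C0Semigroup (LpRN N p)}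
    (hT : ∀ t f, Tendsto (fun n : ℕ => (C0Semigroup.ofBounded (yosida R (n + 1))).op t f) atTop
        (𝓝 (T.op t f)))
    (hS : ∀ t f, Tendsto (fun n : ℕ => (C0Semigroup.ofBounded (yosida Q (n + 1))).op t f) atTop
        (𝓝 (S.op t f))) : IsConsistent T S := fun t f g hfg =>
  ae_eq_of_tendsto (hT t f) (hS t g) fun n =>
    AreConsistent.ofBounded_yosida (hQ (n + 1) (by positivity)) t f g hfg

variable {V' : EuclideanSpace ℝ (Fin N) → ℝ} {hV' : AEStronglyMeasurable V' volume} {C' : ℝ}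
  {hC' : ∀ᵐ x, |V' x| ≤ C'} {R' : ℝ → LpRN N 2 →L[ℂ] LpRN N 2}

/-- Decreasing the potential increases the resolvent. -/
lemma IsFormResolvent.isPositiveOp_sub (hR : IsFormResolvent α β b lam (mulOp 2 V hV C hC) R)
    (hR' : IsFormResolvent α β b lam (mulOp 2 V' hV' C' hC') R') (hVV : ∀ᵐ x, V' x ≤ V x) {μ : ℝ}
    (hμ : 0 < μ) (hpos : IsPositiveOp (R μ)) (hpos' : IsPositiveOp (R' μ)) :
    IsPositiveOp (R' μ - R μ) := by
  intro f hf
  have h1 := hR.apply_eq hR' hμ hμ f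
  rw [sub_self, Complex.ofReal_zero, zero_smul, add_zero, map_add] at h1
  -- `R' - R = R'(V - V')R` is a product of three positive operators.
  have h2 : (R' μ - R μ) f
      = R' μ (mulOp 2 V hV C hC (R μ f) - mulOp 2 V' hV' C' hC' (R μ f)) := by
    have e : (R' μ - R μ) f = R' μ f - R μ f := rfl
    rw [e]
    nth_rewrite 1 [h1]
    rw [map_sub, map_sub]
    abel
  rw [h2]
  refine hpos' _ ?_
  filter_upwards [hpos f hf, hVV, mulOp_coeFn hV hC (R μ f), mulOp_coeFn hV' hC' (R μ f),
    Lp.coeFn_sub (mulOp 2 V hV C hC (R μ f)) (mulOp 2 V' hV' C' hC' (R μ f))] with x e1 e2 e3 e4 e5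
  rw [e5, Pi.sub_apply, e3, e4, ← sub_mul, ← Complex.ofReal_sub]
  exact mul_nonneg (Complex.zero_le_real.2 (sub_nonneg.2 e2)) e1

/-- The second resolvent identity on `L^p`. -/
lemma IsFormResolvent.extension_eq (hp2 : 2 ≤ p) (hp : p ≠ ⊤)
    (hR : IsFormResolvent α β b lam (mulOp 2 V hV C hC) R)
    (hR' : IsFormResolvent α β b lam (mulOp 2 V' hV' C' hC') R') {μ : ℝ} (hμ : 0 < μ)
    {Q Q' : ℝ → LpRN N p →L[ℂ] LpRN N p} (hQ : AreConsistent (R μ) (Q μ))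
    (hQ' : AreConsistent (R' μ) (Q' μ)) (f : LpRN N p) :
    Q μ f = Q' μ (f + (mulOp p V' hV' C' hC' (Q μ f) - mulOp p V hV C hC (Q μ f))) := by
  -- Written as an operator identity using only sums and products, the `L²` statement is transported
  -- by consistency term by term.
  have h1 : R μ = R' μ * (1 + (mulOp 2 V' hV' C' hC' - mulOp 2 V hV C hC) * R μ) := by
    ext1 f
    have h2 := hR.apply_eq hR' hμ hμ f
    rw [sub_self, Complex.ofReal_zero, zero_smul, add_zero] at h2
    exact h2
  have h2 : Q μ = Q' μ * (1 + (mulOp p V' hV' C' hC' - mulOp p V hV C hC) * Q μ) := by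
    refine eq_of_consistent hp2 hp hQ ?_
    nth_rewrite 1 [h1]
    exact hQ'.mul (areConsistent_one.add
      (((mulOp_areConsistent hV' hC').sub (mulOp_areConsistent hV hC)).mul hQ))
  exact congrArg (fun A : LpRN N p →L[ℂ] LpRN N p => A f) h2

/-- The semigroups of the extended resolvents have generators which differ by the potential. -/
lemma IsFormResolvent.extension_iff (hp2 : 2 ≤ p) (hp : p ≠ ⊤)
    (hR : IsFormResolvent α β b lam (mulOp 2 V hV C hC) R)
    (hR' : IsFormResolvent α β b lam (mulOp 2 V' hV' C' hC') R') (hV0 : ∀ᵐ x, V x = 0)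
    {Q Q' : ℝ → LpRN N p →L[ℂ] LpRN N p} (hQ : AreConsistent (R 1) (Q 1))
    (hQ' : AreConsistent (R' 1) (Q' 1)) (f g : LpRN N p) :
    Q' 1 (f - g) = f ↔ ∃ h, Q 1 (f - h) = f ∧ ∀ᵐ x, g x = h x - (V' x : ℂ) * f x := by
  have h0 : ∀ f : LpRN N p, mulOp p V hV C hC f = 0 := fun f => by
    ext1
    filter_upwards [mulOp_coeFn hV hC f, hV0, Lp.coeFn_zero ℂ p (volume : Measure 𝔼)] with x e1 e2 e3
    rw [e1, e2, e3]
    simp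
  have h1 : ∀ h : LpRN N p, (∀ᵐ x, g x = h x - (V' x : ℂ) * f x) ↔
      g = h - mulOp p V' hV' C' hC' f := fun h => by
    constructor
    · intro e
      ext1
      filter_upwards [e, mulOp_coeFn hV' hC' f, Lp.coeFn_sub h (mulOp p V' hV' C' hC' f)]
        with x e1 e2 e3
      rw [e1, e3, Pi.sub_apply, e2]
    · rintro rfl
      filter_upwards [mulOp_coeFn hV' hC' f, Lp.coeFn_sub h (mulOp p V' hV' C' hC' f)]
        with x e2 e3
      rw [e3, Pi.sub_apply, e2]
  simp only [h1]
  constructor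
  · intro h
    refine ⟨g + mulOp p V' hV' C' hC' f, ?_, (add_sub_cancel_right _ _).symm⟩
    have h2 := hR'.extension_eq hp2 hp hR one_pos hQ' hQ (f - g)
    rw [h, h0] at h2
    rw [show f - (g + mulOp p V' hV' C' hC' f) = f - g + (0 - mulOp p V' hV' C' hC' f) by abel]
    exact h2.symm
  · rintro ⟨h, h3, rfl⟩
    have h2 := hR.extension_eq hp2 hp hR' one_pos hQ hQ' (f - h)
    rw [h3, h0] at h2
    rw [show f - (h - mulOp p V' hV' C' hC' f) = f - h + (mulOp p V' hV' C' hC' f - 0) by abel]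
    exact h2.symm

end Extrapolation

/-! ### The truncated potentials -/

section Potential

variable {N : ℕ} {α c : ℝ}

local notation "𝔼" => EuclideanSpace ℝ (Fin N)

lemma truncPot_nonpos (hc : c < 0) (n : ℕ) (x : 𝔼) : truncPot α c n x ≤ 0 :=
  max_le (by simp) (mul_nonpos_of_nonpos_of_nonneg hc.le (by positivity))

lemma abs_truncPot_le (hc : c < 0) (n : ℕ) (x : 𝔼) : |truncPot α c n x| ≤ n := by
  rw [abs_of_nonpos (truncPot_nonpos hc n x), neg_le]
  exact le_max_left _ _

lemma truncPot_zero (hc : c < 0) (x : 𝔼) : truncPot α c 0 x = 0 :=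
  le_antisymm (truncPot_nonpos hc 0 x) (by simp [truncPot])

lemma truncPot_succ_le (n : ℕ) (x : 𝔼) : truncPot α c (n + 1) x ≤ truncPot α c n x :=
  max_le_max (by push_cast; linarith) le_rfl

lemma measurable_truncPot (n : ℕ) : Measurable (truncPot α c n : 𝔼 → ℝ) := by
  unfold truncPot
  fun_prop

/-- The support stays at a distance `δ > 0` from the origin, where `|c||x|^{α-2} ≤ |c|δ^{α-2}`;
beyond that level the truncation is invisible to `u`. -/
lemma IsTestAwayFromZero.eventually_truncPot_mul {u : 𝔼 → ℂ} (hu : IsTestAwayFromZero u)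
    (hα2 : α < 2) : ∀ᶠ n : ℕ in atTop, ∀ x,
      (truncPot α c n x : ℂ) * u x = ((c * ‖x‖ ^ (α - 2) : ℝ) : ℂ) * u x := by
  obtain ⟨δ, hδ, hball⟩ := Metric.isOpen_iff.1 (isClosed_tsupport u).isOpen_compl 0 hu.2.2
  obtain ⟨n₀, hn₀⟩ := exists_nat_ge (|c| * δ ^ (α - 2))
  filter_upwards [eventually_ge_atTop n₀] with n hn x
  by_cases hx : x ∈ tsupport u
  · have h1 : δ ≤ ‖x‖ := by
      by_contra! h
      exact hball (mem_ball_zero_iff.2 h) hx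
    have h2 : ‖x‖ ^ (α - 2) ≤ δ ^ (α - 2) :=
      Real.rpow_le_rpow_of_nonpos hδ h1 (by linarith)
    have h3 : -(n : ℝ) ≤ c * ‖x‖ ^ (α - 2) := by
      have h4 : (n₀ : ℝ) ≤ n := by exact_mod_cast hn
      have h5 := mul_le_mul_of_nonneg_left h2 (abs_nonneg c)
      have h6 : -(|c| * ‖x‖ ^ (α - 2)) ≤ c * ‖x‖ ^ (α - 2) := by
        rw [← neg_mul]
        exact mul_le_mul_of_nonneg_right (neg_abs_le c) (by positivity)
      linarith
    rw [truncPot, max_eq_right h3]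
  · rw [image_eq_zero_of_notMem_tsupport hx, mul_zero, mul_zero]

end Potential

/-! ### Passage to the limit and conclusion -/

/-- An increasing sequence of positive contractions on `L^p` converges strongly. -/
lemma exists_tendsto_of_monotone_contractions {Ω : Type*} [MeasurableSpace Ω] {μ : Measure Ω}
    {p : ℝ≥0∞} [Fact (1 ≤ p)] (hp : p ≠ ⊤) {A : ℕ → Lp ℂ p μ →L[ℂ] Lp ℂ p μ}
    (hpos : ∀ n, IsPositiveOp (A n)) (hmono : ∀ n, IsPositiveOp (A (n + 1) - A n))
    (hA : ∀ n, ‖A n‖ ≤ 1) (f : Lp ℂ p μ) : ∃ g, Tendsto (fun n => A n f) atTop (𝓝 g) := by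
  have h : ∀ f : Lp ℂ p μ, (∀ᵐ x ∂μ, 0 ≤ f x) → ∃ g, Tendsto (fun n => A n f) atTop (𝓝 g) :=
    fun f hf => exists_tendsto_of_monotone_of_bounded hp (fun n => hpos n f hf)
      (fun n => ae_le_iff_ae_nonneg_sub.2 (hmono n f hf)) (C := ‖f‖) fun n => by
        simpa using (A n).le_of_opNorm_le (hA n) f
  obtain ⟨f₁, f₂, f₃, f₄, h₁, h₂, h₃, h₄, rfl⟩ := exists_nonneg_decomposition f
  obtain ⟨g₁, hg₁⟩ := h f₁ h₁
  obtain ⟨g₂, hg₂⟩ := h f₂ h₂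
  obtain ⟨g₃, hg₃⟩ := h f₃ h₃
  obtain ⟨g₄, hg₄⟩ := h f₄ h₄
  refine ⟨g₁ - g₂ + Complex.I • (g₃ - g₄), ?_⟩
  simp only [map_add, map_sub, map_smul]
  exact (hg₁.sub hg₂).add ((hg₃.sub hg₄).const_smul _)

theorem mainTheorem7 (N : ℕ) (hN : 3 ≤ N) (α β b c : ℝ) (hα0 : 0 < α) (hα2 : α < 2)
    (hβ : 0 < β) (hc : c < 0)
    (p : ℝ≥0∞) [Fact (1 ≤ p)] (hp2 : 2 ≤ p) (hp : p ≠ ⊤)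
    (lam : ℝ) (hlam : 0 < lam)
    (hpos : ∀ x : EuclideanSpace ℝ (Fin N), x ≠ 0 →
      0 < (((N : ℝ) - 2) / 2) ^ 2 / (2 * ‖x‖ ^ 2)
        + (c * p.toReal / 2 - 1 - (α - b) / 2 * (α - 2 + N)) * ‖x‖ ^ (α - 2) + lam) :
    -- the semigroup generated on `L²` by the operator of the form with `c = 0`,
    ∃ T₂ : C0Semigroup (LpRN N 2),
      (∀ u w, T₂.Gen u w ↔ FormOperator α β b 0 lam u w) ∧ T₂.IsContractive ∧
    -- its extrapolation to `L^p`,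
    ∃ T : C0Semigroup (LpRN N p), IsConsistent T₂ T ∧ T.IsContractive ∧
    -- the semigroups generated by the perturbations by `-W_n`,
    ∃ S : ℕ → C0Semigroup (LpRN N p),
      (∀ n f g, (S n).Gen f g ↔
        ∃ h, T.Gen f h ∧ ∀ᵐ x, g x = h x - (truncPot α c n x : ℂ) * f x) ∧
      (∀ (n : ℕ) (t : ℝ≥0) (f : LpRN N p), (∀ᵐ x, 0 ≤ f x) →
        ∀ᵐ x, 0 ≤ (S n).op t f x ∧ (S n).op t f x ≤ (S (n + 1)).op t f x) ∧
      (∀ n, (S n).IsContractive) ∧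
    -- and their limit
    ∃ S' : C0Semigroup (LpRN N p),
      S'.IsContractive ∧
      (∀ t f, Tendsto (fun n => (S n).op t f) atTop (𝓝 (S'.op t f))) ∧
      (∀ u, IsTestAwayFromZero u → ∃ f g : LpRN N p,
        f =ᵐ[volume] u ∧ (g =ᵐ[volume] fun x => diffOp α β b c u x - (lam : ℂ) * u x) ∧
        S'.Gen f g) := by
  have hN0 : 0 < N := by omega
  have hcc : c * p.toReal / 2 ≤ c := by
    have h2 : (2 : ℝ) ≤ p.toReal := by
      simpa using ENNReal.toReal_mono hp hp2
    nlinarith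
  have hV : ∀ n : ℕ, AEStronglyMeasurable
      (truncPot α c n : EuclideanSpace ℝ (Fin N) → ℝ) volume := fun n =>
    (measurable_truncPot n).aestronglyMeasurable
  have hC : ∀ n : ℕ, ∀ᵐ x : EuclideanSpace ℝ (Fin N), |truncPot α c n x| ≤ n := fun n =>
    Eventually.of_forall (abs_truncPot_le hc n)
  have hVc : ∀ n : ℕ, ∀ᵐ x : EuclideanSpace ℝ (Fin N),
      c * ‖x‖ ^ (α - 2) ≤ truncPot α c n x := fun n =>
    Eventually.of_forall fun x => le_max_right _ _
  -- Coercivity is used with the constant `cp/2`, for which the hypothesis on `λ` is stated; `cp/2 ≤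
  -- c` shows that `W_n` dominates the corresponding potential.
  have hR : ∀ n : ℕ, ∃ R, IsFormResolvent α β b lam (mulOp 2 (truncPot α c n) (hV n) n (hC n)) R :=
    fun n => exists_isFormResolvent hN hα0 hα2 hβ hpos (hV n) (hC n) <| (hVc n).mono fun x hx =>
      (mul_le_mul_of_nonneg_right hcc (by positivity)).trans hx
  choose R hR using hR
  have hQ : ∀ n : ℕ, _ := fun n => (hR n).exists_extension hp2 hp fun μ hμ f hf =>
    (hR n).eLpNorm_le hN hα0 hα2 hlam hc hp2 hp hpos (hVc n) hμ f hf
  choose Q hQn hQc hQr using hQ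
  have hRpos : ∀ n μ, 0 < μ → IsPositiveOp (R n μ) := fun n μ hμ =>
    isPositiveOp_of_re_nonneg fun f hf =>
      (hR n).re_nonneg hN hα0 hα2 hlam hc hcc hpos (hVc n) hμ f hf
  have hQpos : ∀ n μ, 0 < μ → IsPositiveOp (Q n μ) := fun n μ hμ =>
    (hRpos n μ hμ).of_consistent hp2 hp (hQc n μ hμ)
  have hQmono : ∀ n μ, 0 < μ → IsPositiveOp (Q (n + 1) μ - Q n μ) := fun n μ hμ =>
    ((hR n).isPositiveOp_sub (hR (n + 1)) (Eventually.of_forall (truncPot_succ_le n)) hμ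
      (hRpos n μ hμ) (hRpos (n + 1) μ hμ)).of_consistent hp2 hp
      ((hQc (n + 1) μ hμ).sub (hQc n μ hμ))
  obtain ⟨T₂, hT₂, hT₂G, hT₂Y⟩ := hille_yosida_complex (R 0) (hR 0).1
    (fun μ ν hμ hν => (hR 0).sub_eq hμ hν)
    ((hR 0).dense hN0 (by simp) fun f g hfg => by rw [Lp.ext hfg])
  have hS : ∀ n : ℕ, _ := fun n => hille_yosida_complex (Q n) (hQn n) (hQr n)
    ((hR n).dense hN0 hp (hQc n 1 one_pos))
  choose S hSc hSG hSY using hS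
  have hSpos : ∀ n t, IsPositiveOp ((S n).op t) := fun n t =>
    IsPositiveOp.of_tendsto
      (fun k => isPositiveOp_ofBounded_yosida (hQpos n (k + 1) (by positivity)) t) (hSY n t)
  have hSmono : ∀ n t, IsPositiveOp ((S (n + 1)).op t - (S n).op t) := fun n t =>
    IsPositiveOp.of_tendsto
      (fun k => isPositiveOp_ofBounded_yosida_sub (hQpos n (k + 1) (by positivity))
        (hQmono n (k + 1) (by positivity)) t) fun f => (hSY (n + 1) t f).sub (hSY n t f)
  choose L hL using fun t f => exists_tendsto_of_monotone_contractions hp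
    (fun n => hSpos n t) (fun n => hSmono n t) (fun n => hSc n t) f
  obtain ⟨S', hS'c, hS'L, hS'G⟩ := C0Semigroup.exists_limit S hSc L hL
    {a | ∃ u, IsTestAwayFromZero u ∧ a.1 =ᵐ[volume] u ∧
      a.2 =ᵐ[volume] fun x => diffOp α β b c u x - (lam : ℂ) * u x}
    ((dense_isTestAwayFromZero hN0 hp).mono (by
      rintro f ⟨u, hu, hf⟩
      exact ⟨(f, _), ⟨u, hu, hf, ((hu.diffOp_sub c).memLp p).coeFn_toLp⟩, rfl⟩))
    -- The approximating sequence in the generator condition is constant: for large `n` the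
    -- generator of `S n` already sends `f` to `g`.
    (by
      rintro ⟨f, g⟩ ⟨u, hu, hf, hg⟩
      refine ⟨fun _ => g, tendsto_const_nhds, ?_⟩
      filter_upwards [hu.eventually_truncPot_mul (c := c) hα2] with n hn
      refine (hSG n f g).2 ((hR n).apply_test hN0 (hQc n 1 one_pos) hu hf ?_)
      filter_upwards [hg] with x hx
      rw [hx, hn x, diffOp, diffOp]
      push_cast
      ring)
  have hW0 : ∀ u : LpRN N 2, mulOp 2 (truncPot α c 0) (hV 0) (0 : ℕ) (hC 0) u = 0 := fun u => by
    ext1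
    filter_upwards [mulOp_coeFn (hV 0) (hC 0) u, Lp.coeFn_zero ℂ 2 volume] with x h1 h2
    rw [h1, h2, truncPot_zero hc]
    simp
  -- Since `W_0 = 0`, the extrapolated semigroup is taken to be `S 0`, and consistency comes from
  -- the common resolvent `R 0`.
  refine ⟨T₂, fun u w => ?_, hT₂, S 0, IsConsistent.of_yosida (hQc 0) hT₂Y (hSY 0), hSc 0, S,
    fun n f g => ?_, fun n t f hf => ?_, hSc, S', hS'c, fun t f => ?_, fun u hu => ?_⟩
  · rw [hT₂G, (hR 0).2 1 one_pos, hW0, Complex.ofReal_one, one_smul, zero_add, sub_sub_cancel]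
  · simp only [hSG]
    exact (hR 0).extension_iff hp2 hp (hR n) (Eventually.of_forall (truncPot_zero hc))
      (hQc 0 1 one_pos) (hQc n 1 one_pos) f g
  · exact (hSpos n t f hf).and (ae_le_iff_ae_nonneg_sub.2 (hSmono n t f hf))
  · rw [hS'L]
    exact hL t f
  · have hf := (hu.memLp p).coeFn_toLp
    have hg := ((hu.diffOp_sub (α := α) (β := β) (b := b) (lam := lam) c).memLp p).coeFn_toLp
    exact ⟨_, _, hf, hg, hS'G (_, _) ⟨u, hu, hf, hg⟩⟩
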